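/- Let $O=(W,A,Z,M,Y)$ with $W\in\mathcal W$ and $M\in\mathcal M$ (Polish spaces), $A,Z\in\{0,1\}$ and $Y\in\mathbb R$, and let $\nu$ be a $\sigma$-finite measure on the sample space. The nonparametric model $\mathcal P$ consists of all probability laws of $O$ that have a continuous density with respect to $\nu$. Fix $a,a'\in\{0,1\}$. For a law $P$ of $O$ write $g(\alpha\mid w)=P(A=\alpha\mid W=w)$, $q(\zeta\mid \alpha,w)=P(Z=\zeta\mid A=\alpha,W=w)$, $e(\alpha\mid m,\zeta,w)=P(A=\alpha\mid M=m,Z=\zeta,W=w)$, $r(\zeta\mid \alpha,m,w)=P(Z=\zeta\mid A=\alpha,M=m,W=w)$, $\mu(m,\zeta,\alpha,w)=E(Y\mid M=m,Z=\zeta,A=\alpha,W=w)$, $P(dm\mid \alpha,\zeta,w)$ for the conditional law of $M$ given $A=\alpha,Z=\zeta,W=w$, and $$\rho_{z,z'}(w)=\int\mu(m,z,a,w)\,dP(m\mid a',z',w),\qquad \Delta(w)=q(1\mid a,w)-q(1\mid a',w).$$ For $(z,z')\in\{(1,1),(1,0),(0,0)\}$ put $\lambda_{1,1}(w)=q(1\mid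 a',w)$, $\lambda_{1,0}(w)=\Delta(w)$, $\lambda_{0,0}(w)=q(0\mid a,w)$ and $$\theta_{z,z'}(a,a')=\int \rho_{z,z'}(w)\,\lambda_{z,z'}(w)\,dP(w),\qquad \theta(a,a')=\theta_{1,1}(a,a')+\theta_{1,0}(a,a')+\theta_{0,0}(a,a').$$ Define $$H_{Y,1,1}=\frac{1\{Z=1,A=a\}}{g(a'\mid W)}\frac{e(a'\mid M,1,W)}{e(a\mid M,1,W)},\quad H_{Y,1,0}=\frac{1\{Z=1,A=a\}}{g(a'\mid W)q(0\mid a',W)}\frac{e(a'\mid M,1,W)}{e(a\mid M,1,W)}\frac{r(0\mid a',M,W)}{r(1\mid a',M,W)}\Delta(W),$$ $$H_{Y,0,0}=\frac{1\{Z=0,A=a\}}{g(a'\mid W)}\frac{e(a'\mid M,0,W)}{e(a\mid M,0,W)}\frac{q(0\mid a,W)}{q(0\mid a',W)},$$ $$H_{M,1,1}=\frac{1\{A=a',Z=1\}}{g(a'\mid W)},\quad H_{M,1,0}=\frac{1\{A=a',Z=0\}}{q(0\mid a',W)g(a'\mid W)}\Delta(W),\quad H_{M,0,0}=\frac{1\{A=a',Z=0\}}{q(0\mid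 a',W)g(a'\mid W)}q(0\mid a,W),$$ $$H_{Z,1,1}=\frac{1\{A=a'\}}{g(a'\mid W)}\rho_{1,1}(W),\quad H_{Z,1,0}=\Big(\frac{1\{A=a\}}{g(a\mid W)}-\frac{1\{A=a'\}}{g(a'\mid W)}\Big)\rho_{1,0}(W),\quad H_{Z,0,0}=-\frac{1\{A=a\}}{g(a\mid W)}\rho_{0,0}(W),$$ $H_{W,z,z'}=\rho_{z,z'}(W)\lambda_{z,z'}(W)$, and $$D_{z,z'}(O)=H_{Y,z,z'}\,[Y-\mu(M,Z,A,W)]+H_{Z,z,z'}\,[Z-q(1\mid A,W)]+H_{M,z,z'}\,[\mu(M,z,a,W)-\rho_{z,z'}(W)]+H_{W,z,z'}.$$ Let $P\in\mathcal P$ with $E|Y|<\infty$ satisfy: (i) Positivity. For $P$-almost every $w$: $g(0\mid w),g(1\mid w)>0$; for each of the three pairs, $\lambda_{z,z'}(w)>0$ implies $q(z'\mid a',w)>0$ and $q(z\mid a,w)>0$; $\Delta(w)\neq0$ implies $q(1\mid a',w)>0$; and for each of the three pairs and $\alpha\in\{a,a'\}$, if $q(z'\mid a',w)>0$ and $q(z\mid\alpha,w)>0$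 then $P(dm\mid a',z',w)\ll P(dm\mid\alpha,z,w)$. (ii) Square integrability. For each of the three pairs the four terms of $D_{z,z'}(O)$ are in $L^2(P)$; moreover, for $(z,z')=(1,0)$, the terms with $H_Y$, $H_M$ and $H_W$ remain in $L^2(P)$ when the factor $\Delta(W)=q(1\mid a,W)q(0\mid a',W)-q(1\mid a',W)q(0\mid a,W)$ is replaced by $q(1\mid a,W)q(0\mid a',W)+q(1\mid a',W)q(0\mid a,W)$. Call a path $t\mapsto Q_t$ with $Q_0=P$ a regular submodel with score $s\in L^2(P)$ if, for $t$ near $0$, $Q_t\in\mathcal P$ and $C^{-1}P\le Q_t\le C\,P$ for some constant $C$, and if it is differentiable in quadratic mean at $0$, i.e. $\int\big(\tfrac{\sqrt{dQ_t/d\nu}-\sqrt{dP/d\nu}}{t}-\tfrac12 s\sqrt{dP/d\nu}\big)^2d\nu\to0$ as $t\to0$. The tangent space at $P$ is the closed linear span in $L^2(P)$ of all scores of regular submodels. The efficient influence function (EIF) of a parameter $\psi$ at $P$ is the ($P$-a.e. unique) mean-zero $\varphi$ in the tangent space such that $\frac{d}{dt}\psi(Q_t)|_{t=0}=E_P[\varphi\,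 s]$ for every regular submodel. Then, for each $(z,z')\in\{(1,1),(1,0),(0,0)\}$, the EIF at $P$ of $\theta_{z,z'}(a,a')$ in the model $\mathcal P$ is $D_{z,z'}(O)-\theta_{z,z'}(a,a')$, and the EIF at $P$ of $\theta(a,a')$ is $D_{1,1}(O)+D_{1,0}(O)+D_{0,0}(O)-\theta(a,a')$. -/

import Mathlib

open MeasureTheory ProbabilityTheory Filter Topology
open scoped ENNReal NNReal

noncomputable section

/-! ### Semiparametric efficiency: models, submodels, tangent space, efficient influence function -/

section Efficiency

variable {𝓞 : Type*} [MeasurableSpace 𝓞]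

/-- The nonparametric model: all probability laws having a continuous density with respect to the
dominating measure `ν`. -/
def nonparametricModel [TopologicalSpace 𝓞] (ν : Measure 𝓞) : Set (ProbabilityMeasure 𝓞) :=
  {P | ∃ p : 𝓞 → ℝ, Continuous p ∧ (∀ o, 0 ≤ p o) ∧
    (P : Measure 𝓞) = ν.withDensity (fun o => ENNReal.ofReal (p o))}

/-- The (real-valued) density of `P` with respect to `ν`. -/
def dens (ν : Measure 𝓞) (P : ProbabilityMeasure 𝓞) (o : 𝓞) : ℝ :=
  ((P : Measure 𝓞).rnDeriv ν o).toReal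

/-- `Q` is a regular one-dimensional parametric submodel of the model `𝓜` through `P` at `t = 0`
with score `s`: it stays in `𝓜` near `0`, its likelihood ratios with respect to `P` are bounded
above and away from zero near `0`, and it is differentiable in quadratic mean at `0` with
score `s ∈ L²(P)`. -/
structure IsRegularSubmodel (𝓜 : Set (ProbabilityMeasure 𝓞)) (ν : Measure 𝓞)
    (P : ProbabilityMeasure 𝓞) (Q : ℝ → ProbabilityMeasure 𝓞) (s : 𝓞 → ℝ) : Prop where
  base : Q 0 = P
  mem_model : ∀ᶠ t in 𝓝 (0 : ℝ), Q t ∈ 𝓜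
  likelihood_ratio : ∃ C : ℝ≥0, ∀ᶠ t in 𝓝 (0 : ℝ),
    (Q t : Measure 𝓞) ≤ C • (P : Measure 𝓞) ∧ (P : Measure 𝓞) ≤ C • (Q t : Measure 𝓞)
  score_memLp : MemLp s 2 (P : Measure 𝓞)
  quadratic_mean : Tendsto
    (fun t : ℝ => ∫⁻ o, ENNReal.ofReal
      (((√(dens ν (Q t) o) - √(dens ν P o)) / t - s o * √(dens ν P o) / 2) ^ 2) ∂ν)
    (𝓝[≠] 0) (𝓝 0)

/-- The tangent space of the model `𝓜` at `P`: the closed linear span in `L²(P)` of the scores of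
all regular parametric submodels. -/
def tangentSpace (𝓜 : Set (ProbabilityMeasure 𝓞)) (ν : Measure 𝓞) (P : ProbabilityMeasure 𝓞) :
    Submodule ℝ (Lp ℝ 2 (P : Measure 𝓞)) :=
  (Submodule.span ℝ {g : Lp ℝ 2 (P : Measure 𝓞) |
    ∃ Q : ℝ → ProbabilityMeasure 𝓞, IsRegularSubmodel 𝓜 ν P Q g}).topologicalClosure

/-- `φ` is the efficient influence function at `P` of the parameter `ψ` in the model `𝓜`:
the parameter is pathwise differentiable along every regular parametric submodel, with derivative
the `L²(P)` inner product of `φ` and the score, and `φ` has mean zero and belongs to the tangent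
space.  This determines `φ` up to `P`-almost everywhere equality. -/
structure IsEfficientInfluenceFunction (𝓜 : Set (ProbabilityMeasure 𝓞)) (ν : Measure 𝓞)
    (ψ : ProbabilityMeasure 𝓞 → ℝ) (P : ProbabilityMeasure 𝓞) (φ : 𝓞 → ℝ) : Prop where
  memLp : MemLp φ 2 (P : Measure 𝓞)
  mean_zero : ∫ o, φ o ∂(P : Measure 𝓞) = 0
  mem_tangentSpace : memLp.toLp φ ∈ tangentSpace 𝓜 ν P
  pathwise_derivative : ∀ (Q : ℝ → ProbabilityMeasure 𝓞) (s : 𝓞 → ℝ),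
    IsRegularSubmodel 𝓜 ν P Q s →
      HasDerivAt (fun t => ψ (Q t)) (∫ o, φ o * s o ∂(P : Measure 𝓞)) 0

end Efficiency

/-! ### The observed data `O = (W, A, Z, M, Y)` -/

/-- Observations `(w, a, z, m, y)`, with binary treatment `a`, binary intermediate confounder `z`,
and real outcome `y`. -/
abbrev Obs (𝒲 ℳ : Type*) : Type _ := 𝒲 × Fin 2 × Fin 2 × ℳ × ℝ

namespace Obs

variable {𝒲 ℳ : Type*}

def W (o : Obs 𝒲 ℳ) : 𝒲 := o.1
def A (o : Obs 𝒲 ℳ) : Fin 2 := o.2.1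
def Z (o : Obs 𝒲 ℳ) : Fin 2 := o.2.2.1
def M (o : Obs 𝒲 ℳ) : ℳ := o.2.2.2.1
def Y (o : Obs 𝒲 ℳ) : ℝ := o.2.2.2.2

end Obs

/-- The three pairs `(z, z') ∈ {(1,1), (1,0), (0,0)}`. -/
inductive ZPair where
  | oneOne
  | oneZero
  | zeroZero

namespace ZPair

/-- First coordinate of the pair `(z, z')`. -/
def z : ZPair → Fin 2
  | oneOne => 1
  | oneZero => 1
  | zeroZero => 0

/-- Second coordinate of the pair `(z, z')`. -/
def z' : ZPair → Fin 2
  | oneOne => 1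
  | oneZero => 0
  | zeroZero => 0

end ZPair

namespace Mediation

variable {𝒲 ℳ : Type*} [MeasurableSpace 𝒲] [MeasurableSpace ℳ] [StandardBorelSpace ℳ] [Nonempty ℳ]

/-! Nuisance parameters: regular conditional distributions under `P`. -/

/-- The law of `W`. -/
def lawW (P : ProbabilityMeasure (Obs 𝒲 ℳ)) : Measure 𝒲 :=
  (P : Measure (Obs 𝒲 ℳ)).map Obs.W

/-- `g(α | w) = P(A = α | W = w)`. -/
def g (P : ProbabilityMeasure (Obs 𝒲 ℳ)) (α : Fin 2) (w : 𝒲) : ℝ :=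
  (condDistrib Obs.A Obs.W (P : Measure (Obs 𝒲 ℳ)) w).real {α}

/-- `q(ζ | α, w) = P(Z = ζ | A = α, W = w)`. -/
def q (P : ProbabilityMeasure (Obs 𝒲 ℳ)) (ζ α : Fin 2) (w : 𝒲) : ℝ :=
  (condDistrib Obs.Z (fun o => (o.A, o.W)) (P : Measure (Obs 𝒲 ℳ)) (α, w)).real {ζ}

/-- `e(α | m, ζ, w) = P(A = α | M = m, Z = ζ, W = w)`. -/
def e (P : ProbabilityMeasure (Obs 𝒲 ℳ)) (α : Fin 2) (m : ℳ) (ζ : Fin 2) (w : 𝒲) : ℝ :=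
  (condDistrib Obs.A (fun o => (o.M, o.Z, o.W)) (P : Measure (Obs 𝒲 ℳ)) (m, ζ, w)).real {α}

/-- `r(ζ | α, m, w) = P(Z = ζ | A = α, M = m, W = w)`. -/
def r (P : ProbabilityMeasure (Obs 𝒲 ℳ)) (ζ α : Fin 2) (m : ℳ) (w : 𝒲) : ℝ :=
  (condDistrib Obs.Z (fun o => (o.A, o.M, o.W)) (P : Measure (Obs 𝒲 ℳ)) (α, m, w)).real {ζ}

/-- The outcome regression `E(Y | M = m, Z = ζ, A = α, W = w)`. -/
def mu (P : ProbabilityMeasure (Obs 𝒲 ℳ)) (m : ℳ) (ζ α : Fin 2) (w : 𝒲) : ℝ :=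
  ∫ y, y ∂(condDistrib Obs.Y (fun o => (o.M, o.Z, o.A, o.W)) (P : Measure (Obs 𝒲 ℳ)) (m, ζ, α, w))

/-- The conditional law `P(dm | A = α, Z = ζ, W = w)` of the mediator. -/
def lawM (P : ProbabilityMeasure (Obs 𝒲 ℳ)) (α ζ : Fin 2) (w : 𝒲) : Measure ℳ :=
  condDistrib Obs.M (fun o => (o.A, o.Z, o.W)) (P : Measure (Obs 𝒲 ℳ)) (α, ζ, w)

/-- `∫ E(Y | a, m, z, w) dP(m | a', z', w)`. -/
def rho (P : ProbabilityMeasure (Obs 𝒲 ℳ)) (a a' z z' : Fin 2) (w : 𝒲) : ℝ :=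
  ∫ m, mu P m z a w ∂(lawM P a' z' w)

/-- `P(Z = 1 | a, w) - P(Z = 1 | a', w)`. -/
def qDiff (P : ProbabilityMeasure (Obs 𝒲 ℳ)) (a a' : Fin 2) (w : 𝒲) : ℝ :=
  q P 1 a w - q P 1 a' w

/-- `P(Z=1|a,w) P(Z=0|a',w) + P(Z=1|a',w) P(Z=0|a,w)`: the sum of the two nonnegative products
whose difference is `qDiff`. -/
def qSum (P : ProbabilityMeasure (Obs 𝒲 ℳ)) (a a' : Fin 2) (w : 𝒲) : ℝ :=
  q P 1 a w * q P 0 a' w + q P 1 a' w * q P 0 a w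

/-- The stratum weights `P(Z=1|a',w)`, `P(Z=1|a,w) - P(Z=1|a',w)`, `P(Z=0|a,w)`. -/
def weight (P : ProbabilityMeasure (Obs 𝒲 ℳ)) (a a' : Fin 2) : ZPair → 𝒲 → ℝ
  | .oneOne => q P 1 a'
  | .oneZero => qDiff P a a'
  | .zeroZero => q P 0 a

/-! The parameters. -/

/-- `θ_{z,z'}(a,a')`. -/
def theta (a a' : Fin 2) (k : ZPair) (P : ProbabilityMeasure (Obs 𝒲 ℳ)) : ℝ :=
  ∫ w, (∫ m, mu P m k.z a w ∂(lawM P a' k.z' w)) * weight P a a' k w ∂(lawW P)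

/-- `θ(a,a') = θ_{1,1}(a,a') + θ_{1,0}(a,a') + θ_{0,0}(a,a')`. -/
def thetaTotal (a a' : Fin 2) (P : ProbabilityMeasure (Obs 𝒲 ℳ)) : ℝ :=
  theta a a' .oneOne P + theta a a' .oneZero P + theta a a' .zeroZero P

/-! The weights `H` and the uncentered influence functions `D`. In the `(1,0)` weights the
factor `P(Z=1|a,W) - P(Z=1|a',W)` is an argument `δ`. -/

/-- The indicator `1{A = α}`. -/
def indA (α : Fin 2) (o : Obs 𝒲 ℳ) : ℝ := if o.A = α then 1 else 0

/-- The indicator `1{Z = ζ, A = α}`. -/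
def indZA (ζ α : Fin 2) (o : Obs 𝒲 ℳ) : ℝ := if o.Z = ζ ∧ o.A = α then 1 else 0

def HY10 (P : ProbabilityMeasure (Obs 𝒲 ℳ)) (a a' : Fin 2) (δ : 𝒲 → ℝ) (o : Obs 𝒲 ℳ) : ℝ :=
  indZA 1 a o / (g P a' o.W * q P 0 a' o.W) * (e P a' o.M 1 o.W / e P a o.M 1 o.W)
    * (r P 0 a' o.M o.W / r P 1 a' o.M o.W) * δ o.W

def HM10 (P : ProbabilityMeasure (Obs 𝒲 ℳ)) (a' : Fin 2) (δ : 𝒲 → ℝ) (o : Obs 𝒲 ℳ) : ℝ :=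
  indZA 0 a' o / (q P 0 a' o.W * g P a' o.W) * δ o.W

def HW10 (P : ProbabilityMeasure (Obs 𝒲 ℳ)) (a a' : Fin 2) (δ : 𝒲 → ℝ) (o : Obs 𝒲 ℳ) : ℝ :=
  rho P a a' 1 0 o.W * δ o.W

def HY (P : ProbabilityMeasure (Obs 𝒲 ℳ)) (a a' : Fin 2) : ZPair → Obs 𝒲 ℳ → ℝ
  | .oneOne, o => indZA 1 a o / g P a' o.W * (e P a' o.M 1 o.W / e P a o.M 1 o.W)
  | .oneZero, o => HY10 P a a' (qDiff P a a') o
  | .zeroZero, o => indZA 0 a o / g P a' o.W * (e P a' o.M 0 o.W / e P a o.M 0 o.W)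
      * (q P 0 a o.W / q P 0 a' o.W)

def HM (P : ProbabilityMeasure (Obs 𝒲 ℳ)) (a a' : Fin 2) : ZPair → Obs 𝒲 ℳ → ℝ
  | .oneOne, o => indZA 1 a' o / g P a' o.W
  | .oneZero, o => HM10 P a' (qDiff P a a') o
  | .zeroZero, o => indZA 0 a' o / (q P 0 a' o.W * g P a' o.W) * q P 0 a o.W

def HZ (P : ProbabilityMeasure (Obs 𝒲 ℳ)) (a a' : Fin 2) : ZPair → Obs 𝒲 ℳ → ℝ
  | .oneOne, o => indA a' o / g P a' o.W * rho P a a' 1 1 o.W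
  | .oneZero, o => (indA a o / g P a o.W - indA a' o / g P a' o.W) * rho P a a' 1 0 o.W
  | .zeroZero, o => -(indA a o / g P a o.W) * rho P a a' 0 0 o.W

def HW (P : ProbabilityMeasure (Obs 𝒲 ℳ)) (a a' : Fin 2) : ZPair → Obs 𝒲 ℳ → ℝ
  | .oneOne, o => rho P a a' 1 1 o.W * q P 1 a' o.W
  | .oneZero, o => HW10 P a a' (qDiff P a a') o
  | .zeroZero, o => rho P a a' 0 0 o.W * q P 0 a o.W

/-- The outcome residual `Y - E(Y | A, M, Z, W)`. -/
def resY (P : ProbabilityMeasure (Obs 𝒲 ℳ)) (o : Obs 𝒲 ℳ) : ℝ :=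
  o.Y - mu P o.M o.Z o.A o.W

/-- The residual `Z - P(Z = 1 | A, W)`. -/
def resZ (P : ProbabilityMeasure (Obs 𝒲 ℳ)) (o : Obs 𝒲 ℳ) : ℝ :=
  (if o.Z = 1 then 1 else 0) - q P 1 o.A o.W

/-- The residual `E(Y | a, M, z, W) - ∫ E(Y | a, m, z, W) dP(m | a', z', W)`. -/
def resM (P : ProbabilityMeasure (Obs 𝒲 ℳ)) (a a' : Fin 2) (k : ZPair) (o : Obs 𝒲 ℳ) : ℝ :=
  mu P o.M k.z a o.W - rho P a a' k.z k.z' o.W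

/-- `D_{z,z'}(O)`. -/
def D (P : ProbabilityMeasure (Obs 𝒲 ℳ)) (a a' : Fin 2) (k : ZPair) (o : Obs 𝒲 ℳ) : ℝ :=
  HY P a a' k o * resY P o + HZ P a a' k o * resZ P o + HM P a a' k o * resM P a a' k o
    + HW P a a' k o

/-- `D(O) = D_{1,1}(O) + D_{1,0}(O) + D_{0,0}(O)`. -/
def DTotal (P : ProbabilityMeasure (Obs 𝒲 ℳ)) (a a' : Fin 2) (o : Obs 𝒲 ℳ) : ℝ :=
  D P a a' .oneOne o + D P a a' .oneZero o + D P a a' .zeroZero o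

/-! Standing conditions on the law `P`. -/

/-- Positivity of the treatment, intermediate confounder and mediator mechanisms. -/
structure Positivity (P : ProbabilityMeasure (Obs 𝒲 ℳ)) (a a' : Fin 2) : Prop where
  treatment : ∀ᵐ w ∂(lawW P), ∀ α : Fin 2, 0 < g P α w
  confounder : ∀ᵐ w ∂(lawW P), ∀ k : ZPair,
    0 < weight P a a' k w → 0 < q P k.z' a' w ∧ 0 < q P k.z a w
  /-- The denominator `P(Z = 1 | M, a', W)` of the `(1,0)` outcome weight can only vanish where
  the weight is irrelevant. -/
  confounder_one : ∀ᵐ w ∂(lawW P), qDiff P a a' w ≠ 0 → 0 < q P 1 a' w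
  /-- `p(m | z', a', w) > 0` implies `p(m | z, α, w) > 0`, for `α ∈ {a, a'}`. -/
  mediator : ∀ᵐ w ∂(lawW P), ∀ k : ZPair, ∀ α : Fin 2, (α = a ∨ α = a') →
    0 < q P k.z' a' w → 0 < q P k.z α w → lawM P a' k.z' w ≪ lawM P α k.z w

/-- Square integrability: every term of each `D_{z,z'}` is square integrable, and for `(1,0)` this
persists when the factor `qDiff` is replaced by `qSum`. -/
structure SquareIntegrable (P : ProbabilityMeasure (Obs 𝒲 ℳ)) (a a' : Fin 2) : Prop where
  outcome : ∀ k : ZPair, MemLp (fun o => HY P a a' k o * resY P o) 2 (P : Measure (Obs 𝒲 ℳ))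
  confounder : ∀ k : ZPair, MemLp (fun o => HZ P a a' k o * resZ P o) 2 (P : Measure (Obs 𝒲 ℳ))
  mediator : ∀ k : ZPair,
    MemLp (fun o => HM P a a' k o * resM P a a' k o) 2 (P : Measure (Obs 𝒲 ℳ))
  plugin : ∀ k : ZPair, MemLp (HW P a a' k) 2 (P : Measure (Obs 𝒲 ℳ))
  outcome_sum : MemLp (fun o => HY10 P a a' (qSum P a a') o * resY P o) 2
    (P : Measure (Obs 𝒲 ℳ))
  mediator_sum : MemLp
    (fun o => HM10 P a' (qSum P a a') o * resM P a a' .oneZero o) 2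
    (P : Measure (Obs 𝒲 ℳ))
  plugin_sum : MemLp (HW10 P a a' (qSum P a a')) 2
    (P : Measure (Obs 𝒲 ℳ))

end Mediation

end

set_option linter.unusedSectionVars false

noncomputable section

section CondMean

variable {Ω β γ : Type*} [MeasurableSpace Ω] [MeasurableSpace β] [MeasurableSpace γ]

/-! ### Densities given by nonnegative real functions -/

/-! Near 0 a regular submodel consists of laws `Q = p P` with `p` valued in some `[1/C, C]`, and for
such a `Q` the parameter has an exact expansion without remainder (`theta_sub_theta`): `θ(Q) - θ(P)
= ∫ (p - 1) D̃ dP`. Here `D̃` (`tiltedD`) is the influence function with each residual term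
multiplied by a factor built from conditional means of `p` and from the weight under `Q`.

The expansion comes from writing `θ(Q)` as an inverse probability weighted integral of `μ_Q` over
the event `Z = z', A = a'` and splitting `μ_Q = (μ_Q - μ_P) + (μ_P - ρ_P) + ρ_P`. The first piece is
carried to the event `Z = z, A = a` by the mediator likelihood ratio
(`restrict_map_V_eq_withDensity`) and becomes the outcome residual (`outcome_term`). The second is
the mediator residual (`mediator_term`). The third gives the plug-in term and, through `λ_Q - λ_P`,
the confounder residual (`confounder_term`). Thus `∫ p D̃ dP = θ(Q)`. The factors depend only on the
variables conditioned on, so the residual terms keep mean zero under `P`, and `∫ D̃ dP = θ(P)`.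

Dividing by `t`, write `(p - 1)/t = ((√p - 1)/t)(√p + 1)`. The first factor tends to `s/2` in L² by
differentiability in quadratic mean. The rest tends almost everywhere to `2 D` and is dominated in
L², because all factors are bounded by powers of `C` (`tendsto_integral_sub_div`). Almost everywhere
convergence of conditional means is obtained along subsequences with `∑ ‖p_n - 1‖₁ < ∞`, which
suffices for the derivative (`IsRegularSubmodel.exists_subseq`, `IsRegularSubmodel.hasDerivAt`).

For the pair (1,0) the difference `Δ` may cancel at `P` and not at `Q`, so `λ_Q` is not bounded by a
multiple of `|λ_P|`. It is bounded by a multiple of the sum of the two products whose difference is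
`Δ`. This absolute weight serves as the reference in the weights and accounts for the integrability
conditions with `qSum`.

Finally, bounded continuous functions `h` of mean zero are scores of the paths `(1 + t h) P`, which
keep a continuous density. They are dense among the mean-zero elements of `L²(P)`, so the centred
influence function lies in the tangent space (`toLp_mem_tangentSpace`). -/

lemma integral_withDensity_ofReal {μ : Measure Ω} {p : Ω → ℝ} (hp : Measurable p)
    (h0 : ∀ o, 0 ≤ p o) (f : Ω → ℝ) :
    ∫ o, f o ∂(μ.withDensity fun o => ENNReal.ofReal (p o)) = ∫ o, p o * f o ∂μ := by
  rw [integral_withDensity_eq_integral_toReal_smul hp.ennreal_ofReal (by simp)]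
  simp [ENNReal.toReal_ofReal (h0 _)]

lemma integrable_withDensity_ofReal {μ : Measure Ω} {p : Ω → ℝ} (hp : Measurable p)
    (h0 : ∀ o, 0 ≤ p o) {f : Ω → ℝ} :
    Integrable f (μ.withDensity fun o => ENNReal.ofReal (p o)) ↔
      Integrable (fun o => p o * f o) μ := by
  rw [integrable_withDensity_iff_integrable_smul' hp.ennreal_ofReal (by simp)]
  simp [ENNReal.toReal_ofReal (h0 _)]

lemma integral_comp_of_map_eq_withDensity {μ μ' : Measure Ω} {X : Ω → β} (hX : Measurable X)
    {u : β → ℝ} (hu : Measurable u) (hu0 : ∀ x, 0 ≤ u x)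
    (H : μ'.map X = (μ.map X).withDensity fun x => ENNReal.ofReal (u x)) {ψ : β → ℝ}
    (hψ : Measurable ψ) : ∫ o, ψ (X o) ∂μ' = ∫ o, u (X o) * ψ (X o) ∂μ := by
  rw [← integral_map hX.aemeasurable hψ.aestronglyMeasurable, H, integral_withDensity_ofReal hu hu0,
    integral_map (f := fun x => u x * ψ x) hX.aemeasurable (hu.mul hψ).aestronglyMeasurable]

lemma integrable_comp_iff_of_map_eq_withDensity {μ μ' : Measure Ω} {X : Ω → β} (hX : Measurable X)
    {u : β → ℝ} (hu : Measurable u) (hu0 : ∀ x, 0 ≤ u x)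
    (H : μ'.map X = (μ.map X).withDensity fun x => ENNReal.ofReal (u x)) {ψ : β → ℝ}
    (hψ : Measurable ψ) :
    Integrable (fun o => ψ (X o)) μ' ↔ Integrable (fun o => u (X o) * ψ (X o)) μ := by
  refine (integrable_map_measure hψ.aestronglyMeasurable hX.aemeasurable).symm.trans
    (Iff.trans ?_ (integrable_map_measure (g := fun x => u x * ψ x)
      (hu.mul hψ).aestronglyMeasurable hX.aemeasurable))
  rw [H, integrable_withDensity_ofReal hu hu0]

/-! ### Conditional means relative to a random variable -/

/-- `h` is a version of the conditional expectation of `f` given `X`. -/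
structure IsCondMean (μ : Measure Ω) (X : Ω → β) (f : Ω → ℝ) (h : β → ℝ) : Prop where
  measurable : Measurable h
  integrable : Integrable f μ
  condExp_eq : μ[f | MeasurableSpace.comap X inferInstance] =ᵐ[μ] fun o => h (X o)

namespace IsCondMean

variable {μ : Measure Ω} [IsFiniteMeasure μ] {X : Ω → β} {f : Ω → ℝ} {h : β → ℝ}

lemma of_setIntegral (hX : Measurable X) (hh : Measurable h) (hf : Integrable f μ)
    (hhi : Integrable (fun o => h (X o)) μ)
    (H : ∀ B, MeasurableSet B → ∫ o in X ⁻¹' B, h (X o) ∂μ = ∫ o in X ⁻¹' B, f o ∂μ) :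
    IsCondMean μ X f h := by
  refine ⟨hh, hf, (ae_eq_condExp_of_forall_setIntegral_eq hX.comap_le hf
    (fun _ _ _ => hhi.integrableOn) ?_ ?_).symm⟩
  · rintro s ⟨B, hB, rfl⟩ -
    exact H B hB
  · exact (hh.comp (comap_measurable X)).stronglyMeasurable.aestronglyMeasurable

lemma integrable_comp (H : IsCondMean μ X f h) : Integrable (fun o => h (X o)) μ :=
  integrable_condExp.congr H.condExp_eq

/-- The pull-out property. Only integrability of the product is required, so that unbounded inverse
probability weights are allowed as `φ`. -/
lemma mul_aux (H : IsCondMean μ X f h) {φ : β → ℝ} (hφ : Measurable φ)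
    (hi : Integrable (fun o => φ (X o) * f o) μ) :
    μ[fun o => φ (X o) * f o | MeasurableSpace.comap X inferInstance]
      =ᵐ[μ] fun o => φ (X o) * h (X o) := by
  have h1 := condExp_mul_of_stronglyMeasurable_left
    (m := MeasurableSpace.comap X inferInstance) (μ := μ) (f := fun o => φ (X o)) (g := f)
    (hφ.comp (comap_measurable X)).stronglyMeasurable hi H.integrable
  refine h1.trans ?_
  filter_upwards [H.condExp_eq] with o ho
  simp [ho]

lemma integrable_mul (H : IsCondMean μ X f h) {φ : β → ℝ} (hφ : Measurable φ)
    (hi : Integrable (fun o => φ (X o) * f o) μ) :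
    Integrable (fun o => φ (X o) * h (X o)) μ :=
  integrable_condExp.congr (mul_aux H hφ hi)

lemma integral_mul (H : IsCondMean μ X f h) (hX : Measurable X) {φ : β → ℝ} (hφ : Measurable φ)
    (hi : Integrable (fun o => φ (X o) * f o) μ) :
    ∫ o, φ (X o) * f o ∂μ = ∫ o, φ (X o) * h (X o) ∂μ := by
  rw [← integral_condExp hX.comap_le]
  exact integral_congr_ae (mul_aux H hφ hi)

lemma setIntegral (H : IsCondMean μ X f h) (hX : Measurable X) {B : Set β} (hB : MeasurableSet B) :
    ∫ o in X ⁻¹' B, f o ∂μ = ∫ o in X ⁻¹' B, h (X o) ∂μ := by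
  rw [← setIntegral_condExp hX.comap_le H.integrable ⟨B, hB, rfl⟩]
  exact setIntegral_congr_ae (hX hB) (H.condExp_eq.mono fun _ h _ => h)

lemma unique (H : IsCondMean μ X f h) (hX : Measurable X) {h' : β → ℝ} (H' : IsCondMean μ X f h') :
    h =ᵐ[μ.map X] h' := by
  rw [Filter.EventuallyEq, ae_map_iff hX.aemeasurable (measurableSet_eq_fun H.measurable H'.measurable)]
  exact H.condExp_eq.symm.trans H'.condExp_eq

lemma sub_comp (H : IsCondMean μ X f h) (hX : Measurable X) {k : β → ℝ} (hk : Measurable k)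
    (hi : Integrable (fun o => k (X o)) μ) :
    IsCondMean μ X (fun o => f o - k (X o)) (fun x => h x - k x) := by
  refine of_setIntegral hX (H.measurable.sub hk) (H.integrable.sub hi) (H.integrable_comp.sub hi) ?_
  intro B hB
  rw [integral_sub H.integrable_comp.integrableOn hi.integrableOn,
    integral_sub H.integrable.integrableOn hi.integrableOn, H.setIntegral hX hB]

/-- Change of measure. -/
lemma of_withDensity (hX : Measurable X) {p : Ω → ℝ} (hp : Measurable p) (h0 : ∀ o, 0 ≤ p o)
    {Q : Measure Ω} [IsFiniteMeasure Q] (hQ : Q = μ.withDensity fun o => ENNReal.ofReal (p o))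
    {π : β → ℝ} (Hp : IsCondMean μ X p π) (H : IsCondMean Q X f h) :
    IsCondMean μ X (fun o => p o * f o) (fun x => π x * h x) := by
  have hi1 : Integrable (fun o => h (X o) * p o) μ := by
    have := H.integrable_comp
    rw [hQ, integrable_withDensity_ofReal hp h0] at this
    exact this.congr (.of_forall fun o => mul_comm _ _)
  refine of_setIntegral hX (Hp.measurable.mul H.measurable) ?_ ?_ ?_
  · have := H.integrable
    rwa [hQ, integrable_withDensity_ofReal hp h0] at this
  · exact (Hp.integrable_mul H.measurable hi1).congr (.of_forall fun o => mul_comm _ _)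
  · intro B hB
    have h1 := H.setIntegral hX hB
    rw [hQ, restrict_withDensity (hX hB), integral_withDensity_ofReal hp h0,
      integral_withDensity_ofReal hp h0] at h1
    rw [h1, ← integral_indicator (hX hB), ← integral_indicator (hX hB)]
    -- Over `X ⁻¹' B`, the factor `h` is a function of `X`, so the density `p` beside it can be
    -- replaced by its conditional mean.
    have h2 := Hp.integral_mul hX (φ := B.indicator h) (H.measurable.indicator hB) (by
      refine (hi1.indicator (hX hB)).congr (.of_forall fun o => ?_)
      by_cases ho : X o ∈ B <;> simp [Set.indicator, ho])
    refine Eq.trans ?_ (h2.symm.trans ?_) <;> refine integral_congr_ae (.of_forall fun o => ?_) <;>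
      by_cases ho : X o ∈ B <;> simp [Set.indicator, ho, mul_comm]

/-- The marginal on an event has the conditional probability as its density. -/
lemma map_restrict_eq_withDensity (hX : Measurable X) {E : Set Ω} (hE : MeasurableSet E) {u : β → ℝ}
    (hu : ∀ x, 0 ≤ u x) (H : IsCondMean μ X (E.indicator fun _ => (1 : ℝ)) u) :
    (μ.restrict E).map X = (μ.map X).withDensity fun x => ENNReal.ofReal (u x) := by
  ext B hB
  rw [Measure.map_apply hX hB, Measure.restrict_apply (hX hB), withDensity_apply _ hB,
    setLIntegral_map hB H.measurable.ennreal_ofReal hX]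
  rw [← ofReal_integral_eq_lintegral_ofReal H.integrable_comp.integrableOn (.of_forall fun o => hu _)]
  rw [← H.setIntegral hX hB, setIntegral_indicator hE]
  simp [Measure.real]

/-- Conditional means on an event, multiplied by the conditional probability of the event. -/
lemma of_restrict (hX : Measurable X) {E : Set Ω} (hE : MeasurableSet E) {u : β → ℝ}
    (hu : ∀ x, 0 ≤ u x) (H : IsCondMean μ X (E.indicator fun _ => (1 : ℝ)) u)
    (Hf : IsCondMean (μ.restrict E) X f h) :
    IsCondMean μ X (E.indicator f) (fun x => u x * h x) := by
  have hm := map_restrict_eq_withDensity hX hE hu H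
  refine of_setIntegral hX (H.measurable.mul Hf.measurable)
    ((integrable_indicator_iff hE).2 Hf.integrable) ?_ ?_
  · have h1 := Hf.integrable_comp
    change Integrable (h ∘ X) _ at h1
    rw [← integrable_map_measure Hf.measurable.aestronglyMeasurable hX.aemeasurable, hm,
      integrable_withDensity_ofReal H.measurable hu] at h1
    exact h1.comp_measurable hX
  · intro B hB
    have h1 := Hf.setIntegral hX hB
    rw [Measure.restrict_restrict (hX hB)] at h1
    rw [setIntegral_indicator hE, h1, ← Measure.restrict_restrict (hX hB),
      ← setIntegral_map hB Hf.measurable.aestronglyMeasurable hX.aemeasurable, hm,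
      restrict_withDensity hB, integral_withDensity_ofReal H.measurable hu,
      setIntegral_map hB (f := fun x => u x * h x)
        (H.measurable.mul Hf.measurable).aestronglyMeasurable hX.aemeasurable]

/-- The Bayes rule for tilted conditional probabilities. -/
lemma tilt_mul_eq (hX : Measurable X) {E : Set Ω} (hE : MeasurableSet E) {p : Ω → ℝ}
    (hp : Measurable p) (h0 : ∀ o, 0 ≤ p o)
    {Q : Measure Ω} [IsFiniteMeasure Q] (hQ : Q = μ.withDensity fun o => ENNReal.ofReal (p o))
    {u uQ π πE : β → ℝ} (hu : ∀ x, 0 ≤ u x)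
    (H : IsCondMean μ X (E.indicator fun _ => (1 : ℝ)) u)
    (HQ : IsCondMean Q X (E.indicator fun _ => (1 : ℝ)) uQ)
    (Hp : IsCondMean μ X p π) (HpE : IsCondMean (μ.restrict E) X p πE) :
    ∀ᵐ x ∂(μ.map X), π x * uQ x = u x * πE x := by
  -- Both products are conditional means of `p · 1_E` given `X` under `μ`: one by changing the
  -- measure to `Q`, the other by restricting to `E`.
  have h1 := of_withDensity hX hp h0 hQ Hp HQ
  have h2 := of_restrict hX hE hu H HpE
  refine unique h1 hX ?_
  convert h2 using 1
  ext o
  by_cases ho : o ∈ E <;> simp [ho]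

end IsCondMean

/-! ### Disintegrations -/

/-- A disintegration given `X'` induces one on an event determined by `X'` on which `X'` is a
function of the coarser variable `X`. -/
lemma map_restrict_prodMk_eq_compProd {δ : Type*} [mδ : MeasurableSpace δ] [StandardBorelSpace γ]
    [Nonempty γ] {μ : Measure Ω} [IsFiniteMeasure μ]
    {X : Ω → β} {X' : Ω → δ} {Y : Ω → γ} (hX' : Measurable X') (hY : Measurable Y)
    {k : δ → β} (hk : Measurable k) (hkX : ∀ o, X o = k (X' o))
    {S : Set δ} (hS : MeasurableSet S) {j : β → δ} (hj : Measurable j)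
    (hjX : ∀ o, X' o ∈ S → X' o = j (X o)) :
    (μ.restrict (X' ⁻¹' S)).map (fun o => (X o, Y o)) =
      ((μ.restrict (X' ⁻¹' S)).map X) ⊗ₘ ((condDistrib Y X' μ).comap j hj) := by
  have hX : Measurable X := by
    have : X = k ∘ X' := funext hkX
    rw [this]; exact hk.comp hX'
  ext B hB
  rw [Measure.map_apply (hX.prodMk hY) hB, Measure.compProd_apply hB,
    lintegral_map (Kernel.measurable_kernel_prodMk_left hB) hX,
    Measure.restrict_apply (hX.prodMk hY hB)]
  have h1 := compProd_map_condDistrib (mβ := mδ) (X := X') (μ := μ) hY.aemeasurable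
  -- This set expresses, in terms of the finer variable `X'`, the event that `X'` lies in `S` and
  -- `(X, Y)` lies in `B`.
  have hB' : MeasurableSet {x : δ × γ | x.1 ∈ S ∧ (k x.1, x.2) ∈ B} :=
    (measurable_fst hS).inter ((by fun_prop : Measurable fun x : δ × γ => (k x.1, x.2)) hB)
  have h2 := congrArg (fun m => m {x : δ × γ | x.1 ∈ S ∧ (k x.1, x.2) ∈ B}) h1
  rw [Measure.compProd_apply hB', Measure.map_apply (hX'.prodMk hY) hB',
    lintegral_map (Kernel.measurable_kernel_prodMk_left hB') hX'] at h2
  have h3 : (fun o => (X o, Y o)) ⁻¹' B ∩ X' ⁻¹' S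
      = (fun a => (X' a, Y a)) ⁻¹' {x : δ × γ | x.1 ∈ S ∧ (k x.1, x.2) ∈ B} := by
    ext o; simp [← hkX, and_comm]
  rw [h3, ← h2, ← lintegral_indicator (hX' hS)]
  refine lintegral_congr fun o => ?_
  by_cases ho : X' o ∈ S
  · simp [Set.indicator, ho, Kernel.comap_apply, ← hjX o ho, ← hkX]
    rfl
  · simp [Set.indicator, ho]

lemma IsCondMean.of_disintegration {μ : Measure Ω} [IsFiniteMeasure μ] {X : Ω → β} {Y : Ω → γ}
    (hX : Measurable X) (hY : Measurable Y) {κ : Kernel β γ} [IsMarkovKernel κ]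
    (H : μ.map (fun o => (X o, Y o)) = (μ.map X) ⊗ₘ κ) {f : γ → ℝ} (hf : Measurable f)
    (hi : Integrable (fun o => f (Y o)) μ) :
    IsCondMean μ X (fun o => f (Y o)) (fun x => ∫ y, f y ∂(κ x)) := by
  have hmeas : Measurable fun x => ∫ y, f y ∂(κ x) :=
    (hf.stronglyMeasurable.integral_kernel).measurable
  have hi2 : Integrable (fun z : β × γ => f z.2) ((μ.map X) ⊗ₘ κ) := by
    rw [← H]
    exact (integrable_map_measure (hf.comp measurable_snd).aestronglyMeasurable
      (hX.prodMk hY).aemeasurable).2 hi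
  refine of_setIntegral hX hmeas hi ?_ ?_
  · have := hi2.integral_compProd
    exact this.comp_measurable hX
  · intro B hB
    rw [← setIntegral_map hB hmeas.aestronglyMeasurable hX.aemeasurable]
    have h1 : ∫ o in X ⁻¹' B, f (Y o) ∂μ
        = ∫ z in B ×ˢ Set.univ, f z.2 ∂(μ.map (fun o => (X o, Y o))) := by
      rw [setIntegral_map (hB.prod .univ) (f := fun z : β × γ => f z.2) (hf.comp measurable_snd).aestronglyMeasurable
        (hX.prodMk hY).aemeasurable]
      congr 2
      ext o; simp
    rw [h1, H, Measure.setIntegral_compProd hB .univ hi2.integrableOn]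
    simp

/-! ### Conditional means through regular conditional distributions -/

/-- A version of the conditional expectation of `f` given `X`, as an integral over a regular
conditional distribution; bounds on `f` hold for it everywhere. -/
def condMean [StandardBorelSpace Ω] [Nonempty Ω] (μ : Measure Ω) [IsFiniteMeasure μ] (X : Ω → β)
    (f : Ω → ℝ) (x : β) : ℝ :=
  ∫ o, f o ∂(condDistrib id X μ x)

variable [StandardBorelSpace Ω] [Nonempty Ω] {μ : Measure Ω} [IsFiniteMeasure μ] {X : Ω → β}

lemma isCondMean_condMean (hX : Measurable X) {f : Ω → ℝ} (hf : Measurable f)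
    (hi : Integrable f μ) : IsCondMean μ X f (condMean μ X f) :=
  IsCondMean.of_disintegration hX measurable_id
    (compProd_map_condDistrib (aemeasurable_id)).symm hf hi

/-- `condDistrib` is a probability measure at every point, so averages keep the bounds of `f` with
no exceptional null set. -/
lemma condMean_mem_Icc {f : Ω → ℝ} (hf : Measurable f) {c C : ℝ} (hc : ∀ o, c ≤ f o)
    (hC : ∀ o, f o ≤ C) (x : β) : c ≤ condMean μ X f x ∧ condMean μ X f x ≤ C := by
  have hi : Integrable f (condDistrib id X μ x) :=
    Integrable.of_mem_Icc c C hf.aemeasurable (.of_forall fun o => ⟨hc o, hC o⟩)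
  constructor
  · simpa [condMean] using integral_mono (integrable_const c) hi hc
  · simpa [condMean] using integral_mono hi (integrable_const C) hC

/-- Conditional expectation contracts the distance to a constant. -/
lemma lintegral_condMean_sub_le (hX : Measurable X) {f : Ω → ℝ} (hf : Measurable f)
    (hi : Integrable f μ) (c : ℝ) :
    ∫⁻ x, ‖condMean μ X f x - c‖ₑ ∂(μ.map X) ≤ ∫⁻ o, ‖f o - c‖ₑ ∂μ := by
  have H := isCondMean_condMean hX hf hi
  have hs := H.sub_comp hX (k := fun _ => c) measurable_const (integrable_const c)
  rw [lintegral_map (by have := H.measurable; fun_prop) hX]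
  have h1 := eLpNorm_condExp_le_eLpNorm (m := MeasurableSpace.comap X inferInstance) (μ := μ)
    (fun o => f o - c) le_rfl
  rw [eLpNorm_congr_ae hs.condExp_eq, eLpNorm_one_eq_lintegral_enorm,
    eLpNorm_one_eq_lintegral_enorm] at h1
  exact h1

end CondMean

/-! ### Nuisance parameters as conditional means on events -/

namespace Mediation

variable {𝒲 ℳ : Type*} [MeasurableSpace 𝒲] [MeasurableSpace ℳ]

@[fun_prop] lemma measurable_W : Measurable (Obs.W : Obs 𝒲 ℳ → 𝒲) := measurable_fst
@[fun_prop] lemma measurable_A : Measurable (Obs.A : Obs 𝒲 ℳ → Fin 2) :=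
  measurable_fst.comp measurable_snd
@[fun_prop] lemma measurable_Z : Measurable (Obs.Z : Obs 𝒲 ℳ → Fin 2) :=
  measurable_fst.comp (measurable_snd.comp measurable_snd)
@[fun_prop] lemma measurable_M : Measurable (Obs.M : Obs 𝒲 ℳ → ℳ) :=
  measurable_fst.comp (measurable_snd.comp (measurable_snd.comp measurable_snd))
@[fun_prop] lemma measurable_Y : Measurable (Obs.Y : Obs 𝒲 ℳ → ℝ) :=
  measurable_snd.comp (measurable_snd.comp (measurable_snd.comp measurable_snd))

/-- The pair `(W, M)`. -/
def V (o : Obs 𝒲 ℳ) : 𝒲 × ℳ := (o.W, o.M)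

@[fun_prop] lemma measurable_V : Measurable (V : Obs 𝒲 ℳ → 𝒲 × ℳ) :=
  measurable_W.prodMk measurable_M

/-- The event `A = α`. -/
def evA (α : Fin 2) : Set (Obs 𝒲 ℳ) := Obs.A ⁻¹' {α}

/-- The event `Z = ζ`. -/
def evZ (ζ : Fin 2) : Set (Obs 𝒲 ℳ) := Obs.Z ⁻¹' {ζ}

/-- The event `Z = ζ, A = α`. -/
def evZA (ζ α : Fin 2) : Set (Obs 𝒲 ℳ) := evZ ζ ∩ evA α

lemma measurableSet_evA (α : Fin 2) : MeasurableSet (evA α : Set (Obs 𝒲 ℳ)) :=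
  measurable_A (measurableSet_singleton α)
lemma measurableSet_evZ (ζ : Fin 2) : MeasurableSet (evZ ζ : Set (Obs 𝒲 ℳ)) :=
  measurable_Z (measurableSet_singleton ζ)
lemma measurableSet_evZA (ζ α : Fin 2) : MeasurableSet (evZA ζ α : Set (Obs 𝒲 ℳ)) :=
  (measurableSet_evZ ζ).inter (measurableSet_evA α)

lemma restrict_evA_evZ (μ : Measure (Obs 𝒲 ℳ)) (ζ α : Fin 2) :
    (μ.restrict (evA α)).restrict (evZ ζ) = μ.restrict (evZA ζ α) :=
  Measure.restrict_restrict (measurableSet_evZ ζ)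

lemma restrict_evZ_evA (μ : Measure (Obs 𝒲 ℳ)) (ζ α : Fin 2) :
    (μ.restrict (evZ ζ)).restrict (evA α) = μ.restrict (evZA ζ α) := by
  rw [Measure.restrict_restrict (measurableSet_evA α), Set.inter_comm]; rfl

variable [StandardBorelSpace ℳ] [Nonempty ℳ] (P : ProbabilityMeasure (Obs 𝒲 ℳ))

lemma g_nonneg (α : Fin 2) (w : 𝒲) : 0 ≤ g P α w := measureReal_nonneg
lemma q_nonneg (ζ α : Fin 2) (w : 𝒲) : 0 ≤ q P ζ α w := measureReal_nonneg
lemma e_nonneg (α ζ : Fin 2) (m : ℳ) (w : 𝒲) : 0 ≤ e P α m ζ w := measureReal_nonneg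
lemma r_nonneg (ζ α : Fin 2) (m : ℳ) (w : 𝒲) : 0 ≤ r P ζ α m w := measureReal_nonneg

lemma q_zero_add_q_one (α : Fin 2) (w : 𝒲) : q P 0 α w + q P 1 α w = 1 := by
  unfold q
  rw [← measureReal_union (by simp) (by simp)]
  convert probReal_univ (μ := condDistrib Obs.Z (fun o => (o.A, o.W)) (P : Measure (Obs 𝒲 ℳ)) (α, w))
  ext i; fin_cases i <;> simp

/-- The conditional law of the mediator as a kernel in the covariates. -/
def lawMKernel (α ζ : Fin 2) : Kernel 𝒲 ℳ :=
  (condDistrib Obs.M (fun o => (o.A, o.Z, o.W)) (P : Measure (Obs 𝒲 ℳ))).comap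
    (fun w => (α, ζ, w)) (by fun_prop)

instance (α ζ : Fin 2) : IsMarkovKernel (lawMKernel P α ζ) := by
  unfold lawMKernel; infer_instance

instance (α ζ : Fin 2) (w : 𝒲) : IsProbabilityMeasure (lawM P α ζ w) := by
  unfold lawM; infer_instance

lemma isCondMean_event_of_disintegration {β : Type*} [MeasurableSpace β]
    {μ : Measure (Obs 𝒲 ℳ)} [IsFiniteMeasure μ] {X : Obs 𝒲 ℳ → β} {Y : Obs 𝒲 ℳ → Fin 2}
    (hX : Measurable X) (hY : Measurable Y) {κ : Kernel β (Fin 2)} [IsMarkovKernel κ]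
    (H : μ.map (fun o => (X o, Y o)) = (μ.map X) ⊗ₘ κ) (i : Fin 2) :
    IsCondMean μ X ((Y ⁻¹' {i}).indicator fun _ => (1 : ℝ)) (fun x => (κ x).real {i}) := by
  have h := IsCondMean.of_disintegration hX hY H (f := ({i} : Set (Fin 2)).indicator fun _ => 1)
    (measurable_const.indicator (measurableSet_singleton i))
    ((integrable_const (1 : ℝ)).indicator (hY (measurableSet_singleton i)))
  have h2 : (fun x => (κ x).real {i})
      = fun x => ∫ y, ({i} : Set (Fin 2)).indicator (fun _ => (1 : ℝ)) y ∂(κ x) := by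
    ext x
    rw [integral_indicator (measurableSet_singleton i)]
    simp [Measure.real]
  rw [h2]
  exact h

lemma isCondMean_g (α : Fin 2) :
    IsCondMean (P : Measure (Obs 𝒲 ℳ)) Obs.W ((evA α).indicator fun _ => (1 : ℝ)) (g P α) :=
  isCondMean_event_of_disintegration measurable_W measurable_A
    (compProd_map_condDistrib measurable_A.aemeasurable).symm α

/-- Conditioning on `A = α` is encoded by restricting the law to that event, after which only `W` is
conditioned on. If the event is null, the statement is vacuous. The same device serves for `e`, `r`,
`mu` and the law of the mediator. -/
lemma isCondMean_q (ζ α : Fin 2) :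
    IsCondMean ((P : Measure (Obs 𝒲 ℳ)).restrict (evA α)) Obs.W
      ((evZ ζ).indicator fun _ => (1 : ℝ)) (q P ζ α) := by
  refine isCondMean_event_of_disintegration measurable_W measurable_Z
    (map_restrict_prodMk_eq_compProd (μ := (P : Measure (Obs 𝒲 ℳ)))
      (X' := fun o : Obs 𝒲 ℳ => (o.A, o.W)) (Y := Obs.Z)
      (by fun_prop) measurable_Z (k := Prod.snd) (by fun_prop) (fun _ => rfl)
      (S := Prod.fst ⁻¹' {α}) (measurable_fst (measurableSet_singleton α)) (j := fun w => (α, w))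
      (by fun_prop) ?_) ζ
  rintro o rfl; rfl

lemma isCondMean_e (α ζ : Fin 2) :
    IsCondMean ((P : Measure (Obs 𝒲 ℳ)).restrict (evZ ζ)) V
      ((evA α).indicator fun _ => (1 : ℝ)) (fun v => e P α v.2 ζ v.1) := by
  refine isCondMean_event_of_disintegration measurable_V measurable_A
    (map_restrict_prodMk_eq_compProd (μ := (P : Measure (Obs 𝒲 ℳ)))
      (X' := fun o : Obs 𝒲 ℳ => (o.M, o.Z, o.W)) (Y := Obs.A)
      (by fun_prop) measurable_A (k := fun x => (x.2.2, x.1)) (by fun_prop) (fun _ => rfl)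
      (S := (fun x => x.2.1) ⁻¹' {ζ}) ((by fun_prop : Measurable fun x : ℳ × Fin 2 × 𝒲 => x.2.1)
        (measurableSet_singleton ζ)) (j := fun v => (v.2, ζ, v.1))
      (by fun_prop) ?_) α
  rintro o rfl; rfl

lemma isCondMean_r (ζ α : Fin 2) :
    IsCondMean ((P : Measure (Obs 𝒲 ℳ)).restrict (evA α)) V
      ((evZ ζ).indicator fun _ => (1 : ℝ)) (fun v => r P ζ α v.2 v.1) := by
  refine isCondMean_event_of_disintegration measurable_V measurable_Z
    (map_restrict_prodMk_eq_compProd (μ := (P : Measure (Obs 𝒲 ℳ)))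
      (X' := fun o : Obs 𝒲 ℳ => (o.A, o.M, o.W)) (Y := Obs.Z)
      (by fun_prop) measurable_Z (k := fun x => (x.2.2, x.2.1)) (by fun_prop) (fun _ => rfl)
      (S := Prod.fst ⁻¹' {α}) (measurable_fst (measurableSet_singleton α))
      (j := fun v => (α, v.2, v.1)) (by fun_prop) ?_) ζ
  rintro o rfl; rfl

lemma isCondMean_mu (hY : Integrable Obs.Y (P : Measure (Obs 𝒲 ℳ))) (ζ α : Fin 2) :
    IsCondMean ((P : Measure (Obs 𝒲 ℳ)).restrict (evZA ζ α)) V Obs.Y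
      (fun v => mu P v.2 ζ α v.1) := by
  have hS : MeasurableSet {x : ℳ × Fin 2 × Fin 2 × 𝒲 | x.2.1 = ζ ∧ x.2.2.1 = α} :=
    (measurableSet_eq_fun (by fun_prop) (by fun_prop)).inter
      (measurableSet_eq_fun (by fun_prop) (by fun_prop))
  refine IsCondMean.of_disintegration (f := fun y => y) measurable_V measurable_Y
    (map_restrict_prodMk_eq_compProd (μ := (P : Measure (Obs 𝒲 ℳ)))
      (X' := fun o : Obs 𝒲 ℳ => (o.M, o.Z, o.A, o.W)) (Y := Obs.Y)
      (by fun_prop) measurable_Y (k := fun x => (x.2.2.2, x.1)) (by fun_prop) (fun _ => rfl)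
      hS (j := fun v => (v.2, ζ, α, v.1)) (by fun_prop) ?_) measurable_id hY.integrableOn
  rintro o ⟨rfl, rfl⟩; rfl

lemma measurable_g (α : Fin 2) : Measurable (g P α) := (isCondMean_g P α).measurable
lemma measurable_q (ζ α : Fin 2) : Measurable (q P ζ α) := (isCondMean_q P ζ α).measurable
lemma measurable_e (α ζ : Fin 2) : Measurable fun v : 𝒲 × ℳ => e P α v.2 ζ v.1 :=
  (isCondMean_e P α ζ).measurable
lemma measurable_r (ζ α : Fin 2) : Measurable fun v : 𝒲 × ℳ => r P ζ α v.2 v.1 :=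
  (isCondMean_r P ζ α).measurable

lemma measurable_mu (ζ α : Fin 2) : Measurable fun v : 𝒲 × ℳ => mu P v.2 ζ α v.1 := by
  have h : StronglyMeasurable fun x : ℳ × Fin 2 × Fin 2 × 𝒲 => ∫ y, y ∂(condDistrib Obs.Y
      (fun o => (o.M, o.Z, o.A, o.W)) (P : Measure (Obs 𝒲 ℳ)) x) :=
    stronglyMeasurable_id.integral_kernel
  exact h.measurable.comp (by fun_prop : Measurable fun v : 𝒲 × ℳ => (v.2, ζ, α, v.1))

lemma measurable_rho (a a' z z' : Fin 2) : Measurable (rho P a a' z z') := by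
  have h : StronglyMeasurable fun w => ∫ m, mu P m z a w ∂(lawMKernel P a' z' w) :=
    StronglyMeasurable.integral_kernel_prod_right' (measurable_mu P z a).stronglyMeasurable
  exact h.measurable

/-- The law of `W` on the event `A = α`. -/
lemma map_W_evA (α : Fin 2) :
    ((P : Measure (Obs 𝒲 ℳ)).restrict (evA α)).map Obs.W =
      (lawW P).withDensity fun w => ENNReal.ofReal (g P α w) :=
  IsCondMean.map_restrict_eq_withDensity measurable_W (measurableSet_evA α) (g_nonneg P α)
    (isCondMean_g P α)

/-- The law of `W` on the event `Z = ζ, A = α`. -/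
lemma map_W_evZA (ζ α : Fin 2) :
    ((P : Measure (Obs 𝒲 ℳ)).restrict (evZA ζ α)).map Obs.W =
      (lawW P).withDensity fun w => ENNReal.ofReal (g P α w * q P ζ α w) := by
  rw [← restrict_evA_evZ, IsCondMean.map_restrict_eq_withDensity measurable_W (measurableSet_evZ ζ)
    (q_nonneg P ζ α) (isCondMean_q P ζ α), map_W_evA, ← withDensity_mul₀
    (measurable_g P α).ennreal_ofReal.aemeasurable (measurable_q P ζ α).ennreal_ofReal.aemeasurable]
  congr 1
  ext w
  simp [ENNReal.ofReal_mul (g_nonneg P α w)]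

/-- The law of `(W, M)` on the event `Z = ζ, A = α`. -/
lemma map_V_evZA (ζ α : Fin 2) :
    ((P : Measure (Obs 𝒲 ℳ)).restrict (evZA ζ α)).map V =
      (((P : Measure (Obs 𝒲 ℳ)).restrict (evZA ζ α)).map Obs.W) ⊗ₘ lawMKernel P α ζ := by
  have hS : MeasurableSet {x : Fin 2 × Fin 2 × 𝒲 | x.2.1 = ζ ∧ x.1 = α} :=
    (measurableSet_eq_fun (by fun_prop) (by fun_prop)).inter
      (measurableSet_eq_fun (by fun_prop) (by fun_prop))
  refine map_restrict_prodMk_eq_compProd (μ := (P : Measure (Obs 𝒲 ℳ)))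
      (X' := fun o : Obs 𝒲 ℳ => (o.A, o.Z, o.W)) (Y := Obs.M)
      (by fun_prop) measurable_M (k := fun x => x.2.2) (by fun_prop) (fun _ => rfl)
      hS (j := fun w => (α, ζ, w)) (by fun_prop) ?_
  rintro o ⟨rfl, rfl⟩; rfl

lemma map_V_evZA_e (ζ α : Fin 2) :
    ((P : Measure (Obs 𝒲 ℳ)).restrict (evZA ζ α)).map V =
      (((P : Measure (Obs 𝒲 ℳ)).restrict (evZ ζ)).map V).withDensity
        fun v => ENNReal.ofReal (e P α v.2 ζ v.1) := by
  rw [← restrict_evZ_evA]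
  exact IsCondMean.map_restrict_eq_withDensity measurable_V (measurableSet_evA α)
    (fun v => e_nonneg P _ _ _ _) (isCondMean_e P α ζ)

lemma map_V_evZA_r (ζ α : Fin 2) :
    ((P : Measure (Obs 𝒲 ℳ)).restrict (evZA ζ α)).map V =
      (((P : Measure (Obs 𝒲 ℳ)).restrict (evA α)).map V).withDensity
        fun v => ENNReal.ofReal (r P ζ α v.2 v.1) := by
  rw [← restrict_evA_evZ]
  exact IsCondMean.map_restrict_eq_withDensity measurable_V (measurableSet_evZ ζ)
    (fun v => r_nonneg P _ _ _ _) (isCondMean_r P ζ α)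

end Mediation

namespace Mediation

variable {𝒲 ℳ : Type*} [MeasurableSpace 𝒲] [MeasurableSpace ℳ] [StandardBorelSpace ℳ] [Nonempty ℳ]
  (P : ProbabilityMeasure (Obs 𝒲 ℳ))

/-! ### Consequences of positivity -/

/-- The sum of the nonnegative products that make up the weight. -/
def absWeight (a a' : Fin 2) : ZPair → 𝒲 → ℝ
  | .oneOne => q P 1 a'
  | .oneZero => qSum P a a'
  | .zeroZero => q P 0 a

lemma absWeight_nonneg (a a' : Fin 2) (k : ZPair) (w : 𝒲) : 0 ≤ absWeight P a a' k w := by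
  have := q_nonneg P
  cases k <;> simp only [absWeight, qSum, q_nonneg]
  exact add_nonneg (mul_nonneg (this _ _ _) (this _ _ _)) (mul_nonneg (this _ _ _) (this _ _ _))

/-- Each of the two nonnegative products changes by at most a constant factor under a bounded tilt;
their difference need not. -/
lemma qDiff_eq (a a' : Fin 2) (w : 𝒲) :
    qDiff P a a' w = q P 1 a w * q P 0 a' w - q P 1 a' w * q P 0 a w := by
  have h1 := q_zero_add_q_one P a w
  have h2 := q_zero_add_q_one P a' w
  unfold qDiff
  linear_combination q P 1 a' w * h1 - q P 1 a w * h2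

lemma abs_weight_le (a a' : Fin 2) (k : ZPair) (w : 𝒲) :
    |weight P a a' k w| ≤ absWeight P a a' k w := by
  have h := q_nonneg P
  cases k <;> simp only [absWeight, weight]
  · rw [abs_of_nonneg (h _ _ _)]
  · have h1 := mul_nonneg (h 1 a w) (h 0 a' w)
    have h2 := mul_nonneg (h 1 a' w) (h 0 a w)
    rw [qDiff_eq, qSum, abs_le]
    constructor <;> linarith
  · rw [abs_of_nonneg (h _ _ _)]

lemma measurable_weight (a a' : Fin 2) (k : ZPair) : Measurable (weight P a a' k) := by
  have h := measurable_q P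
  cases k
  · exact h _ _
  · exact (h _ _).sub (h _ _)
  · exact h _ _

lemma measurable_absWeight (a a' : Fin 2) (k : ZPair) : Measurable (absWeight P a a' k) := by
  have h := measurable_q P
  cases k
  · exact h _ _
  · exact ((h _ _).mul (h _ _)).add ((h _ _).mul (h _ _))
  · exact h _ _

/-- The good behaviour at a covariate value `w` of a pair `(z, z')` of nonzero absolute weight. -/
structure GoodAt (a a' : Fin 2) (k : ZPair) (w : 𝒲) : Prop where
  q_z' : 0 < q P k.z' a' w
  q_z : 0 < q P k.z a w
  q_za' : 0 < q P k.z a' w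

variable {P} in
-- Only (1,0) needs an argument. If `Δ ≠ 0`, then `q(1|a') > 0` by assumption; if `Δ = 0`, the two
-- products are equal, hence both positive since their sum is. Positivity for (1,1) then gives
-- `q(1|a) > 0`. Lastly `q(0|a') > 0` follows from positivity for (0,0) if `q(0|a) > 0`, and
-- otherwise from the one product that remains.
lemma Positivity.goodAt {a a' : Fin 2} (h : Positivity P a a') :
    ∀ᵐ w ∂(lawW P), ∀ k : ZPair, 0 < absWeight P a a' k w → GoodAt P a a' k w := by
  filter_upwards [h.confounder, h.confounder_one] with w h1 h2
  have hq := q_nonneg P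
  have e1 := q_zero_add_q_one P a w
  have e2 := q_zero_add_q_one P a' w
  intro k hk
  cases k
  · obtain ⟨h3, h4⟩ := h1 .oneOne hk
    exact ⟨h3, h4, h3⟩
  · have h11 : 0 < q P 1 a' w → 0 < q P 1 a w := fun h => (h1 .oneOne h).2
    have h00 : 0 < q P 0 a w → 0 < q P 0 a' w := fun h => (h1 .zeroZero h).1
    have h1a' : 0 < q P 1 a' w := by
      by_cases hD : qDiff P a a' w = 0
      · rw [qDiff_eq] at hD
        simp only [absWeight, qSum] at hk
        have : 0 < q P 1 a' w * q P 0 a w := by linarith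
        exact pos_of_mul_pos_left this (hq _ _ _)
      · exact h2 hD
    have h1a := h11 h1a'
    have h0a' : 0 < q P 0 a' w := by
      rcases (hq 0 a w).lt_or_eq with h0 | h0
      · exact h00 h0
      · simp only [absWeight, qSum, ← h0, mul_zero, add_zero] at hk
        exact pos_of_mul_pos_right hk (hq _ _ _)
    exact ⟨h0a', h1a, h1a'⟩
  · obtain ⟨h3, h4⟩ := h1 .zeroZero hk
    exact ⟨h3, h4, h3⟩

/-- Absolute continuity of the joint laws of `(W, M)` on two events. -/
lemma absolutelyContinuous_map_V {α₁ ζ₁ α₂ ζ₂ : Fin 2} {G : Set 𝒲} (hG : MeasurableSet G)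
    (h : ∀ᵐ w ∂(lawW P), w ∈ G → 0 < q P ζ₁ α₁ w →
      0 < g P α₂ w ∧ 0 < q P ζ₂ α₂ w ∧ lawM P α₁ ζ₁ w ≪ lawM P α₂ ζ₂ w) :
    (((P : Measure (Obs 𝒲 ℳ)).restrict (evZA ζ₁ α₁)).map V).restrict (Prod.fst ⁻¹' G) ≪
      ((P : Measure (Obs 𝒲 ℳ)).restrict (evZA ζ₂ α₂)).map V := by
  refine Measure.AbsolutelyContinuous.mk fun B hB h0 => ?_
  have hm : ∀ α ζ, Measurable fun w => lawMKernel P α ζ w (Prod.mk w ⁻¹' B) :=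
    fun α ζ => Kernel.measurable_kernel_prodMk_left hB
  have hgq : ∀ α ζ, Measurable fun w => ENNReal.ofReal (g P α w * q P ζ α w) :=
    fun α ζ => ((measurable_g P α).mul (measurable_q P ζ α)).ennreal_ofReal
  rw [map_V_evZA, Measure.compProd_apply hB, map_W_evZA, lintegral_eq_zero_iff (hm _ _),
    EventuallyEq, ae_withDensity_iff (hgq _ _)] at h0
  have hG' : MeasurableSet (Prod.fst ⁻¹' G : Set (𝒲 × ℳ)) := measurable_fst hG
  have hB' := hB.inter hG'
  rw [Measure.restrict_apply hB, map_V_evZA, Measure.compProd_apply hB',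
    map_W_evZA, lintegral_eq_zero_iff (Kernel.measurable_kernel_prodMk_left hB'), EventuallyEq,
    ae_withDensity_iff (hgq _ _)]
  filter_upwards [h0, h] with w h1 h2 h3
  by_cases hw : w ∈ G
  · have h4 : 0 < q P ζ₁ α₁ w := by
      rcases (q_nonneg P ζ₁ α₁ w).lt_or_eq with h5 | h5
      · exact h5
      · simp [← h5] at h3
    obtain ⟨h5, h6, h7⟩ := h2 hw h4
    have h8 := h1 (by simpa using mul_pos h5 h6)
    refine measure_mono_null ?_ (h7 h8)
    intro m hm; exact hm.1
  · simp only [Pi.zero_apply]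
    convert measure_empty (μ := lawMKernel P α₁ ζ₁ w)
    ext m; simp [hw]

/-! ### Likelihood ratios of the mediator between events -/

/-- Two subevents of an event, with conditional probabilities `u` and `v`: the law of `X` on the
second has density `v / u` with respect to the law of `X` on the first, where the former is
absolutely continuous with respect to the latter. -/
lemma restrict_withDensity_div {β : Type*} [MeasurableSpace β] {π μ ν : Measure β} {u v : β → ℝ}
    (hu : Measurable u) (hv : Measurable v) (hu0 : ∀ x, 0 ≤ u x)
    (hμ : μ = π.withDensity fun x => ENNReal.ofReal (u x))
    (hν : ν = π.withDensity fun x => ENNReal.ofReal (v x))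
    {G : Set β} (hG : MeasurableSet G) (hac : ν.restrict G ≪ μ) :
    ν.restrict G = (μ.restrict G).withDensity fun x => ENNReal.ofReal (v x / u x) := by
  have hvu : Measurable fun x => v x / u x := hv.div hu
  -- The measure `μ` does not charge `{u = 0}`, so by absolute continuity neither does `ν` on `G`.
  -- The convention `v / 0 = 0` therefore loses no mass.
  have h0 : ∀ᵐ x ∂μ, u x ≠ 0 := by
    rw [hμ, ae_withDensity_iff hu.ennreal_ofReal]
    refine .of_forall fun x hx hx0 => hx (by simp [hx0])
  have h1 : ∀ᵐ x ∂(ν.restrict G), u x ≠ 0 := hac.ae_le h0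
  rw [hν, restrict_withDensity hG, ae_withDensity_iff hv.ennreal_ofReal] at h1
  rw [hμ, hν, restrict_withDensity hG, restrict_withDensity hG, ← withDensity_mul₀
    hu.ennreal_ofReal.aemeasurable hvu.ennreal_ofReal.aemeasurable]
  refine withDensity_congr_ae ?_
  filter_upwards [h1] with x hx
  by_cases hx0 : u x = 0
  · by_contra hne
    refine hx (fun h => hne ?_) hx0
    simp [h, hx0]
  · simp [← ENNReal.ofReal_mul (hu0 x), mul_div_cancel₀ _ hx0]

/-- The likelihood ratio of the mediator in the outcome weight. -/
def mediatorRatio (a a' : Fin 2) : ZPair → 𝒲 × ℳ → ℝ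
  | .oneOne, v => e P a' v.2 1 v.1 / e P a v.2 1 v.1
  | .oneZero, v => e P a' v.2 1 v.1 / e P a v.2 1 v.1 * (r P 0 a' v.2 v.1 / r P 1 a' v.2 v.1)
  | .zeroZero, v => e P a' v.2 0 v.1 / e P a v.2 0 v.1

lemma mediatorRatio_nonneg (a a' : Fin 2) (k : ZPair) (v : 𝒲 × ℳ) :
    0 ≤ mediatorRatio P a a' k v := by
  have h1 := e_nonneg P
  have h2 := r_nonneg P
  cases k <;> simp only [mediatorRatio]
  · exact div_nonneg (h1 _ _ _ _) (h1 _ _ _ _)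
  · exact mul_nonneg (div_nonneg (h1 _ _ _ _) (h1 _ _ _ _)) (div_nonneg (h2 _ _ _ _) (h2 _ _ _ _))
  · exact div_nonneg (h1 _ _ _ _) (h1 _ _ _ _)

lemma measurable_mediatorRatio (a a' : Fin 2) (k : ZPair) :
    Measurable (mediatorRatio P a a' k) := by
  have h1 := measurable_e P
  have h2 := measurable_r P
  cases k
  · exact (h1 _ _).div (h1 _ _)
  · exact ((h1 _ _).div (h1 _ _)).mul ((h2 _ _).div (h2 _ _))
  · exact (h1 _ _).div (h1 _ _)

/-- The set of `(w, m)` for which the absolute weight is positive. -/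
def goodSet (a a' : Fin 2) (k : ZPair) : Set (𝒲 × ℳ) := {v | 0 < absWeight P a a' k v.1}

lemma measurableSet_goodSet (a a' : Fin 2) (k : ZPair) :
    MeasurableSet (goodSet P a a' k) :=
  measurableSet_lt measurable_const ((measurable_absWeight P a a' k).comp measurable_fst)

/-- The mediator ratio transports the law of `(W, M)` on `Z = z, A = a` to that on
`Z = z', A = a'`. -/
theorem restrict_map_V_eq_withDensity {a a' : Fin 2} (h : Positivity P a a') (k : ZPair) :
    (((P : Measure (Obs 𝒲 ℳ)).restrict (evZA k.z' a')).map V).restrict (goodSet P a a' k) =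
      ((((P : Measure (Obs 𝒲 ℳ)).restrict (evZA k.z a)).map V).restrict
        (goodSet P a a' k)).withDensity fun v => ENNReal.ofReal (mediatorRatio P a a' k v) := by
  have hGW : MeasurableSet {w | 0 < absWeight P a a' k w} :=
    measurableSet_lt measurable_const (measurable_absWeight P a a' k)
  have key : ∀ ζ, k.z = ζ →
      (((P : Measure (Obs 𝒲 ℳ)).restrict (evZA ζ a')).map V).restrict (goodSet P a a' k) =
      ((((P : Measure (Obs 𝒲 ℳ)).restrict (evZA ζ a)).map V).restrict
        (goodSet P a a' k)).withDensity
          fun v => ENNReal.ofReal (e P a' v.2 ζ v.1 / e P a v.2 ζ v.1) := by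
    rintro ζ rfl
    refine restrict_withDensity_div (measurable_e P a k.z) (measurable_e P a' k.z)
      (fun v => e_nonneg _ _ _ _ _) (map_V_evZA_e P k.z a) (map_V_evZA_e P k.z a')
      (measurableSet_goodSet P a a' k) ?_
    refine absolutelyContinuous_map_V P hGW ?_
    filter_upwards [h.goodAt, h.treatment, h.mediator] with w h1 h2 h3 h4 h5
    refine ⟨h2 a, (h1 k h4).q_z, ?_⟩
    have h6 := (h1 k h4).q_z
    cases k
    · exact h3 .oneOne a (.inl rfl) h5 h6
    · exact h3 .oneOne a (.inl rfl) h5 h6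
    · exact h3 .zeroZero a (.inl rfl) h5 h6
  cases k
  · exact key 1 rfl
  -- For (1,0) the passage goes through the event `Z = 1, A = a'`: the ratio of `r` changes `Z` with
  -- `A = a'` fixed, then the ratio of `e` changes `A` with `Z = 1` fixed.
  · have h1 : (((P : Measure (Obs 𝒲 ℳ)).restrict (evZA 0 a')).map V).restrict
        (goodSet P a a' .oneZero) = ((((P : Measure (Obs 𝒲 ℳ)).restrict (evZA 1 a')).map V).restrict
        (goodSet P a a' .oneZero)).withDensity
          fun v => ENNReal.ofReal (r P 0 a' v.2 v.1 / r P 1 a' v.2 v.1) := by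
      refine restrict_withDensity_div (measurable_r P 1 a') (measurable_r P 0 a')
        (fun v => r_nonneg _ _ _ _ _) (map_V_evZA_r P 1 a') (map_V_evZA_r P 0 a')
        (measurableSet_goodSet P a a' .oneZero) ?_
      refine absolutelyContinuous_map_V P hGW ?_
      filter_upwards [h.goodAt, h.treatment, h.mediator] with w h1 h2 h3 h4 h5
      have h6 := h1 _ h4
      exact ⟨h2 a', h6.q_za', h3 .oneZero a' (.inr rfl) h5 h6.q_za'⟩
    simp only [ZPair.z, ZPair.z']
    have hm1 : Measurable fun v : 𝒲 × ℳ => e P a' v.2 1 v.1 / e P a v.2 1 v.1 :=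
      (measurable_e P a' 1).div (measurable_e P a 1)
    have hm2 : Measurable fun v : 𝒲 × ℳ => r P 0 a' v.2 v.1 / r P 1 a' v.2 v.1 :=
      (measurable_r P 0 a').div (measurable_r P 1 a')
    rw [h1, key 1 rfl, ← withDensity_mul₀ hm1.ennreal_ofReal.aemeasurable
      hm2.ennreal_ofReal.aemeasurable]
    congr 1
    ext v
    simp only [Pi.mul_apply, mediatorRatio]
    rw [ENNReal.ofReal_mul (div_nonneg (e_nonneg _ _ _ _ _) (e_nonneg _ _ _ _ _))]
  · exact key 0 rfl

end Mediation

/-! ### Laws with a density bounded above and below -/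

/-- `Q` has the density `p` with respect to `P`, with values in `[1/C, C]`. -/
structure BoundedTilt {Ω : Type*} [MeasurableSpace Ω] (P Q : ProbabilityMeasure Ω) (p : Ω → ℝ)
    (C : ℝ) : Prop where
  one_le : 1 ≤ C
  measurable : Measurable p
  lower : ∀ o, C⁻¹ ≤ p o
  upper : ∀ o, p o ≤ C
  eq : (Q : Measure Ω) = (P : Measure Ω).withDensity fun o => ENNReal.ofReal (p o)

namespace BoundedTilt

variable {Ω : Type*} [MeasurableSpace Ω] {P Q : ProbabilityMeasure Ω} {p : Ω → ℝ} {C : ℝ}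

lemma C_pos (h : BoundedTilt P Q p C) : 0 < C := zero_lt_one.trans_le h.one_le
lemma pos (h : BoundedTilt P Q p C) (o : Ω) : 0 < p o := (inv_pos.2 h.C_pos).trans_le (h.lower o)

lemma integrable (h : BoundedTilt P Q p C) {μ : Measure Ω} [IsFiniteMeasure μ] : Integrable p μ :=
  Integrable.of_mem_Icc C⁻¹ C h.measurable.aemeasurable (.of_forall fun o => ⟨h.lower o, h.upper o⟩)

lemma absolutelyContinuous (h : BoundedTilt P Q p C) : (Q : Measure Ω) ≪ P := by
  rw [h.eq]; exact withDensity_absolutelyContinuous _ _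

lemma restrict_eq (h : BoundedTilt P Q p C) {E : Set Ω} (hE : MeasurableSet E) :
    (Q : Measure Ω).restrict E
      = ((P : Measure Ω).restrict E).withDensity fun o => ENNReal.ofReal (p o) := by
  rw [h.eq, restrict_withDensity hE]

lemma integral_restrict (h : BoundedTilt P Q p C) {E : Set Ω} (hE : MeasurableSet E) (f : Ω → ℝ) :
    ∫ o in E, f o ∂(Q : Measure Ω) = ∫ o in E, p o * f o ∂(P : Measure Ω) := by
  rw [h.restrict_eq hE, integral_withDensity_ofReal h.measurable fun o => (h.pos o).le]

lemma integral_eq (h : BoundedTilt P Q p C) (f : Ω → ℝ) :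
    ∫ o, f o ∂(Q : Measure Ω) = ∫ o, p o * f o ∂(P : Measure Ω) := by
  rw [h.eq, integral_withDensity_ofReal h.measurable fun o => (h.pos o).le]

lemma integrable_mul (h : BoundedTilt P Q p C) {μ : Measure Ω} {f : Ω → ℝ} (hf : Integrable f μ) :
    Integrable (fun o => p o * f o) μ := by
  refine hf.bdd_mul (c := C) h.measurable.aestronglyMeasurable (.of_forall fun o => ?_)
  rw [Real.norm_of_nonneg (h.pos o).le]; exact h.upper o

lemma integrable_restrict (h : BoundedTilt P Q p C) {E : Set Ω} (hE : MeasurableSet E) {f : Ω → ℝ}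
    (hf : IntegrableOn f E P) : IntegrableOn f E Q := by
  rw [IntegrableOn, h.restrict_eq hE, integrable_withDensity_ofReal h.measurable fun o => (h.pos o).le]
  exact h.integrable_mul hf

lemma integrable_of (h : BoundedTilt P Q p C) {f : Ω → ℝ} (hf : Integrable f (P : Measure Ω)) :
    Integrable f (Q : Measure Ω) := by
  rw [h.eq, integrable_withDensity_ofReal h.measurable fun o => (h.pos o).le]
  exact h.integrable_mul hf

end BoundedTilt

/-- A ratio of two numbers in `[1/C, C]`. -/
lemma div_nonneg_le_sq {C x y : ℝ} (hC : 1 ≤ C) (hx : C⁻¹ ≤ x ∧ x ≤ C) (hy : C⁻¹ ≤ y ∧ y ≤ C) :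
    0 ≤ x / y ∧ x / y ≤ C ^ 2 := by
  have hC0 : 0 < C := zero_lt_one.trans_le hC
  have hx0 : 0 < x := (inv_pos.2 hC0).trans_le hx.1
  have hy0 : 0 < y := (inv_pos.2 hC0).trans_le hy.1
  refine ⟨by positivity, ?_⟩
  rw [div_le_iff₀ hy0]
  have h1 : 1 ≤ C * y := by
    have := mul_le_mul_of_nonneg_left hy.1 hC0.le
    rwa [mul_inv_cancel₀ hC0.ne'] at this
  nlinarith [hx.2]

namespace Mediation

variable {𝒲 ℳ : Type*} [MeasurableSpace 𝒲] [MeasurableSpace ℳ] [StandardBorelSpace ℳ] [Nonempty ℳ]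
  [StandardBorelSpace 𝒲] [Nonempty 𝒲] (P : ProbabilityMeasure (Obs 𝒲 ℳ)) (p : Obs 𝒲 ℳ → ℝ)

/-! ### Conditional means of the density -/

/-- `E(p | W)`. -/
def tiltW : 𝒲 → ℝ := condMean (P : Measure (Obs 𝒲 ℳ)) Obs.W p
/-- `E(p | A = α, W)`. -/
def tiltA (α : Fin 2) : 𝒲 → ℝ := condMean ((P : Measure (Obs 𝒲 ℳ)).restrict (evA α)) Obs.W p
/-- `E(p | Z = ζ, A = α, W)`. -/
def tiltZ (ζ α : Fin 2) : 𝒲 → ℝ :=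
  condMean ((P : Measure (Obs 𝒲 ℳ)).restrict (evZA ζ α)) Obs.W p
/-- `E(p | M, Z = ζ, A = α, W)`. -/
def tiltM (ζ α : Fin 2) : 𝒲 × ℳ → ℝ :=
  condMean ((P : Measure (Obs 𝒲 ℳ)).restrict (evZA ζ α)) V p

variable {P p} {Q : ProbabilityMeasure (Obs 𝒲 ℳ)} {C : ℝ} (h : BoundedTilt P Q p C)
include h

lemma isCondMean_tiltW : IsCondMean (P : Measure (Obs 𝒲 ℳ)) Obs.W p (tiltW P p) :=
  isCondMean_condMean measurable_W h.measurable h.integrable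
lemma isCondMean_tiltA (α : Fin 2) :
    IsCondMean ((P : Measure (Obs 𝒲 ℳ)).restrict (evA α)) Obs.W p (tiltA P p α) :=
  isCondMean_condMean measurable_W h.measurable h.integrable
lemma isCondMean_tiltZ (ζ α : Fin 2) :
    IsCondMean ((P : Measure (Obs 𝒲 ℳ)).restrict (evZA ζ α)) Obs.W p (tiltZ P p ζ α) :=
  isCondMean_condMean measurable_W h.measurable h.integrable
lemma isCondMean_tiltM (ζ α : Fin 2) :
    IsCondMean ((P : Measure (Obs 𝒲 ℳ)).restrict (evZA ζ α)) V p (tiltM P p ζ α) :=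
  isCondMean_condMean measurable_V h.measurable h.integrable

lemma tiltW_mem (w : 𝒲) : C⁻¹ ≤ tiltW P p w ∧ tiltW P p w ≤ C :=
  condMean_mem_Icc h.measurable h.lower h.upper w
lemma tiltA_mem (α : Fin 2) (w : 𝒲) : C⁻¹ ≤ tiltA P p α w ∧ tiltA P p α w ≤ C :=
  condMean_mem_Icc h.measurable h.lower h.upper w
lemma tiltZ_mem (ζ α : Fin 2) (w : 𝒲) : C⁻¹ ≤ tiltZ P p ζ α w ∧ tiltZ P p ζ α w ≤ C :=
  condMean_mem_Icc h.measurable h.lower h.upper w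
lemma tiltM_mem (ζ α : Fin 2) (v : 𝒲 × ℳ) : C⁻¹ ≤ tiltM P p ζ α v ∧ tiltM P p ζ α v ≤ C :=
  condMean_mem_Icc h.measurable h.lower h.upper v

lemma tiltW_pos (w : 𝒲) : 0 < tiltW P p w := (inv_pos.2 h.C_pos).trans_le (tiltW_mem h w).1
lemma tiltA_pos (α : Fin 2) (w : 𝒲) : 0 < tiltA P p α w :=
  (inv_pos.2 h.C_pos).trans_le (tiltA_mem h α w).1
lemma tiltZ_pos (ζ α : Fin 2) (w : 𝒲) : 0 < tiltZ P p ζ α w :=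
  (inv_pos.2 h.C_pos).trans_le (tiltZ_mem h ζ α w).1
lemma tiltM_pos (ζ α : Fin 2) (v : 𝒲 × ℳ) : 0 < tiltM P p ζ α v :=
  (inv_pos.2 h.C_pos).trans_le (tiltM_mem h ζ α v).1

/-- Bayes' rule: the conditional probability under `Q` is that under `P` times a ratio of
conditional means of `p`. It is stated without division, as is its analogue for `q`. -/
lemma tiltW_mul_g : ∀ᵐ w ∂(lawW P), ∀ α, tiltW P p w * g Q α w = g P α w * tiltA P p α w := by
  rw [ae_all_iff]
  intro α
  exact IsCondMean.tilt_mul_eq measurable_W (measurableSet_evA α) h.measurable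
    (fun o => (h.pos o).le) h.eq (g_nonneg P α) (isCondMean_g P α) (isCondMean_g Q α)
    (isCondMean_tiltW h) (isCondMean_tiltA h α)

lemma tiltA_mul_q (hg : ∀ᵐ w ∂(lawW P), ∀ α, 0 < g P α w) :
    ∀ᵐ w ∂(lawW P), ∀ ζ α, tiltA P p α w * q Q ζ α w = q P ζ α w * tiltZ P p ζ α w := by
  rw [ae_all_iff]; intro ζ
  rw [ae_all_iff]; intro α
  have h1 := IsCondMean.tilt_mul_eq measurable_W (measurableSet_evZ ζ) h.measurable
    (fun o => (h.pos o).le) (h.restrict_eq (measurableSet_evA α)) (q_nonneg P ζ α)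
    (isCondMean_q P ζ α) (isCondMean_q Q ζ α) (isCondMean_tiltA h α)
    (by rw [restrict_evA_evZ]; exact isCondMean_tiltZ h ζ α)
  -- The identity holds almost everywhere for the law of `W` on `A = α`. Positivity of `g` makes
  -- this almost everywhere for the law of `W`.
  rw [map_W_evA, ae_withDensity_iff (measurable_g P α).ennreal_ofReal] at h1
  filter_upwards [h1, hg] with w h2 h3
  exact h2 (by simpa using h3 α)

lemma q_tilt_le (hg : ∀ᵐ w ∂(lawW P), ∀ α, 0 < g P α w) :
    ∀ᵐ w ∂(lawW P), ∀ ζ α, q Q ζ α w ≤ C ^ 2 * q P ζ α w := by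
  filter_upwards [tiltA_mul_q h hg] with w h1 ζ α
  have h2 : q Q ζ α w = tiltZ P p ζ α w / tiltA P p α w * q P ζ α w := by
    have := (tiltA_pos h α w).ne'
    field_simp
    linarith [h1 ζ α]
  rw [h2]
  exact mul_le_mul_of_nonneg_right
    (div_nonneg_le_sq h.one_le (tiltZ_mem h ζ α w) (tiltA_mem h α w)).2 (q_nonneg P ζ α w)

/-- A single `q` grows by at most `C ^ 2` and a product of two by at most `C ^ 4`; the latter
exponent is used for all three pairs. The right side needs the absolute weight because `qDiff` may
vanish under `P` and not under `Q`. -/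
lemma abs_weight_tilt_le (hg : ∀ᵐ w ∂(lawW P), ∀ α, 0 < g P α w) (a a' : Fin 2) (k : ZPair) :
    ∀ᵐ w ∂(lawW P), |weight Q a a' k w| ≤ C ^ 4 * absWeight P a a' k w := by
  filter_upwards [q_tilt_le h hg] with w h1
  refine (abs_weight_le Q a a' k w).trans ?_
  have hq := q_nonneg Q
  have hp := q_nonneg P
  have hC : C ^ 2 ≤ C ^ 4 := pow_le_pow_right₀ h.one_le (by norm_num)
  have h2 : ∀ ζ α, q Q ζ α w ≤ C ^ 4 * q P ζ α w := fun ζ α =>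
    (h1 ζ α).trans (mul_le_mul_of_nonneg_right hC (hp _ _ _))
  have h3 : ∀ ζ α ζ' α', q Q ζ α w * q Q ζ' α' w ≤ C ^ 4 * (q P ζ α w * q P ζ' α' w) := by
    intro ζ α ζ' α'
    calc _ ≤ (C ^ 2 * q P ζ α w) * (C ^ 2 * q P ζ' α' w) :=
          mul_le_mul (h1 _ _) (h1 _ _) (hq _ _ _) (mul_nonneg (by positivity) (hp _ _ _))
      _ = _ := by ring
  cases k <;> simp only [absWeight, qSum]
  · exact h2 _ _
  · rw [mul_add]
    exact add_le_add (h3 _ _ _ _) (h3 _ _ _ _)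
  · exact h2 _ _

omit h in
/-- The inverse probability weight of the event `Z = z', A = a'`, with the absolute weight. -/
def invWeight (P : ProbabilityMeasure (Obs 𝒲 ℳ)) (a a' : Fin 2) (k : ZPair) (w : 𝒲) : ℝ :=
  absWeight P a a' k w / (g P a' w * q P k.z' a' w)

omit h in
/-- The factor by which the mediator term changes under a tilt from `P` to `Q`. -/
def factorM (P Q : ProbabilityMeasure (Obs 𝒲 ℳ)) (p : Obs 𝒲 ℳ → ℝ) (a a' : Fin 2) (k : ZPair)
    (w : 𝒲) : ℝ :=
  weight Q a a' k w / absWeight P a a' k w * (tiltW P p w / tiltZ P p k.z' a' w)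

omit h in
/-- The factor by which the outcome term changes under a tilt from `P` to `Q`. -/
def factorY (P Q : ProbabilityMeasure (Obs 𝒲 ℳ)) (p : Obs 𝒲 ℳ → ℝ) (a a' : Fin 2) (k : ZPair)
    (v : 𝒲 × ℳ) : ℝ :=
  factorM P Q p a a' k v.1 * (tiltM P p k.z' a' v / tiltM P p k.z a v)

omit h in
/-- The factor by which the confounder term changes under a tilt of `P`. -/
def factorZ (P : ProbabilityMeasure (Obs 𝒲 ℳ)) (p : Obs 𝒲 ℳ → ℝ) (α : Fin 2) (w : 𝒲) : ℝ :=
  tiltW P p w / tiltA P p α w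

lemma measurable_factorM (a a' : Fin 2) (k : ZPair) : Measurable (factorM P Q p a a' k) :=
  ((measurable_weight Q a a' k).div (measurable_absWeight P a a' k)).mul
    ((isCondMean_tiltW h).measurable.div (isCondMean_tiltZ h _ _).measurable)

lemma measurable_factorY (a a' : Fin 2) (k : ZPair) : Measurable (factorY P Q p a a' k) :=
  ((measurable_factorM h a a' k).comp measurable_fst).mul
    ((isCondMean_tiltM h _ _).measurable.div (isCondMean_tiltM h _ _).measurable)

lemma measurable_factorZ (α : Fin 2) : Measurable (factorZ P p α) :=
  (isCondMean_tiltW h).measurable.div (isCondMean_tiltA h _).measurable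

lemma abs_factorZ_le (α : Fin 2) (w : 𝒲) : |factorZ P p α w| ≤ C ^ 2 := by
  have := div_nonneg_le_sq h.one_le (tiltW_mem h w) (tiltA_mem h α w)
  rw [factorZ, abs_of_nonneg this.1]; exact this.2

lemma abs_factorM_le (hg : ∀ᵐ w ∂(lawW P), ∀ α, 0 < g P α w) (a a' : Fin 2) (k : ZPair) :
    ∀ᵐ w ∂(lawW P), |factorM P Q p a a' k w| ≤ C ^ 6 := by
  filter_upwards [abs_weight_tilt_le h hg a a' k] with w h1
  have h2 := div_nonneg_le_sq h.one_le (tiltW_mem h w) (tiltZ_mem h k.z' a' w)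
  have hC := h.C_pos
  have h3 : |weight Q a a' k w / absWeight P a a' k w| ≤ C ^ 4 := by
    rw [abs_div, abs_of_nonneg (absWeight_nonneg P a a' k w)]
    exact div_le_of_le_mul₀ (absWeight_nonneg P a a' k w) (by positivity) h1
  rw [factorM, abs_mul, abs_of_nonneg h2.1]
  calc _ ≤ C ^ 4 * C ^ 2 := mul_le_mul h3 h2.2 h2.1 (by positivity)
    _ = _ := by ring

lemma abs_factorY_le (hg : ∀ᵐ w ∂(lawW P), ∀ α, 0 < g P α w) (a a' : Fin 2) (k : ZPair) :
    ∀ᵐ w ∂(lawW P), ∀ m, |factorY P Q p a a' k (w, m)| ≤ C ^ 8 := by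
  filter_upwards [abs_factorM_le h hg a a' k] with w h1 m
  have h2 := div_nonneg_le_sq h.one_le (tiltM_mem h k.z' a' (w, m)) (tiltM_mem h k.z a (w, m))
  have hC := h.C_pos
  rw [factorY, abs_mul, abs_of_nonneg h2.1]
  calc _ ≤ C ^ 6 * C ^ 2 := mul_le_mul h1 h2.2 h2.1 (by positivity)
    _ = _ := by ring

/-- The inverse probability weight under `Q`. -/
lemma weight_tilt_eq {a a' : Fin 2} (hpos : Positivity P a a') (k : ZPair) :
    ∀ᵐ w ∂(lawW P), weight Q a a' k w
      = g Q a' w * q Q k.z' a' w * (factorM P Q p a a' k w * invWeight P a a' k w) := by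
  filter_upwards [abs_weight_tilt_le h hpos.treatment a a' k, tiltW_mul_g h,
    tiltA_mul_q h hpos.treatment, hpos.treatment, hpos.goodAt] with w h1 h2 h3 h4 h5
  rcases (absWeight_nonneg P a a' k w).lt_or_eq with h0 | h0
  · have h6 := (h5 k h0).q_z'
    have h7 := h4 a'
    have t1 := tiltW_pos h w
    have t2 := tiltA_pos h a' w
    have t3 := tiltZ_pos h k.z' a' w
    have h8 : g Q a' w = g P a' w * tiltA P p a' w / tiltW P p w := by
      rw [eq_div_iff t1.ne', ← h2 a']; ring
    have h9 : q Q k.z' a' w = q P k.z' a' w * tiltZ P p k.z' a' w / tiltA P p a' w := by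
      rw [eq_div_iff t2.ne', ← h3]; ring
    rw [h8, h9, factorM, invWeight]
    field_simp
  -- Where the absolute weight under `P` vanishes, domination forces the weight under `Q` to vanish,
  -- and both sides are zero.
  · rw [← h0, mul_zero] at h1
    have := abs_nonpos_iff.1 h1
    simp [factorM, invWeight, this]

end Mediation

/-! ### The weights in inverse probability form -/

namespace Mediation

variable {𝒲 ℳ : Type*} [MeasurableSpace 𝒲] [MeasurableSpace ℳ] [StandardBorelSpace ℳ] [Nonempty ℳ]
  (P : ProbabilityMeasure (Obs 𝒲 ℳ))

lemma indZA_mul (ζ α : Fin 2) (f : Obs 𝒲 ℳ → ℝ) :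
    (fun o => indZA ζ α o * f o) = (evZA ζ α).indicator f := by
  ext o
  by_cases h : o.Z = ζ ∧ o.A = α
  · rw [Set.indicator_of_mem (show o ∈ evZA ζ α from h), indZA, if_pos h, one_mul]
  · rw [Set.indicator_of_notMem (show o ∉ evZA ζ α from h), indZA, if_neg h, zero_mul]

lemma integrable_indZA_mul {μ : Measure (Obs 𝒲 ℳ)} {ζ α : Fin 2} {f : Obs 𝒲 ℳ → ℝ} :
    Integrable (fun o => indZA ζ α o * f o) μ ↔ IntegrableOn f (evZA ζ α) μ := by
  rw [indZA_mul, integrable_indicator_iff (measurableSet_evZA ζ α)]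

lemma integral_indZA_mul {μ : Measure (Obs 𝒲 ℳ)} {ζ α : Fin 2} {f : Obs 𝒲 ℳ → ℝ} :
    ∫ o, indZA ζ α o * f o ∂μ = ∫ o in evZA ζ α, f o ∂μ := by
  rw [indZA_mul, integral_indicator (measurableSet_evZA ζ α)]

lemma measurable_invWeight (a a' : Fin 2) (k : ZPair) : Measurable (invWeight P a a' k) :=
  (measurable_absWeight P a a' k).div ((measurable_g P a').mul (measurable_q P k.z' a'))

lemma measurable_g_mul_q (ζ α : Fin 2) : Measurable fun w => g P α w * q P ζ α w :=
  (measurable_g P α).mul (measurable_q P ζ α)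

/-- On the event `Z = ζ, A = α` its conditional probability is positive. -/
lemma ae_pos_of_mem_evZA (ζ α : Fin 2) : ∀ᵐ o ∂(P : Measure (Obs 𝒲 ℳ)),
    o ∈ evZA ζ α → 0 < g P α o.W ∧ 0 < q P ζ α o.W := by
  rw [← ae_restrict_iff' (measurableSet_evZA ζ α)]
  refine ae_of_ae_map (p := fun w => 0 < g P α w ∧ 0 < q P ζ α w) measurable_W.aemeasurable ?_
  rw [map_W_evZA, ae_withDensity_iff (measurable_g_mul_q P ζ α).ennreal_ofReal]
  refine .of_forall fun w hw => ?_
  have hw' : 0 < g P α w * q P ζ α w := by simpa using hw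
  exact ⟨pos_of_mul_pos_left hw' (q_nonneg P _ _ _), pos_of_mul_pos_right hw' (g_nonneg P _ _)⟩

/-- The outcome weight, with the absolute weight. -/
def absHY (a a' : Fin 2) (k : ZPair) (o : Obs 𝒲 ℳ) : ℝ :=
  indZA k.z a o * (mediatorRatio P a a' k (V o) * invWeight P a a' k o.W)

/-- The mediator weight, with the absolute weight. -/
def absHM (a a' : Fin 2) (k : ZPair) (o : Obs 𝒲 ℳ) : ℝ :=
  indZA k.z' a' o * invWeight P a a' k o.W

/-- Relative to the law of `(W, M)` on `Z = ζ`, the law on `Z = ζ, A = α` has density `e`. The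
latter charges only covariates with `q(ζ|α) > 0`, so `e` must vanish where `q` does. -/
lemma ae_e_eq_zero (α ζ : Fin 2) : ∀ᵐ o ∂(P : Measure (Obs 𝒲 ℳ)),
    o.Z = ζ → q P ζ α o.W = 0 → e P α o.M ζ o.W = 0 := by
  have h1 : ∀ᵐ o ∂(P : Measure (Obs 𝒲 ℳ)).restrict (evZA ζ α), q P ζ α o.W ≠ 0 := by
    rw [ae_restrict_iff' (measurableSet_evZA ζ α)]
    filter_upwards [ae_pos_of_mem_evZA P ζ α] with o h ho using (h ho).2.ne'
  have h2 : ∀ᵐ v ∂((P : Measure (Obs 𝒲 ℳ)).restrict (evZA ζ α)).map V, q P ζ α v.1 ≠ 0 := by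
    rw [ae_map_iff measurable_V.aemeasurable]
    · exact h1
    · exact (measurableSet_eq_fun ((measurable_q P ζ α).comp measurable_fst)
        measurable_const).compl
  rw [map_V_evZA_e, ae_withDensity_iff (measurable_e P α ζ).ennreal_ofReal] at h2
  have h3 := ae_of_ae_map measurable_V.aemeasurable h2
  rw [ae_restrict_iff' (measurableSet_evZ ζ)] at h3
  filter_upwards [h3] with o ho hZ hq
  by_contra hne
  refine ho hZ ?_ hq
  simpa [V] using (e_nonneg P α ζ o.M o.W).lt_of_ne' hne

/-- For (1,1) the inverse weight carries a quotient `q/q` that is absent from `HY`. It is 1 unless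
`q(1|a') = 0`, where both sides vanish because `e(a'|M,1,W) = 0` almost everywhere on `Z = 1`. For
the other pairs the identity is pointwise, with `x / 0 = 0` covering a vanishing absolute weight. -/
lemma HY_ae_eq (a a' : Fin 2) (k : ZPair) : ∀ᵐ o ∂(P : Measure (Obs 𝒲 ℳ)),
    HY P a a' k o = weight P a a' k o.W / absWeight P a a' k o.W * absHY P a a' k o := by
  cases k
  · filter_upwards [ae_e_eq_zero P a' 1] with o ho
    simp only [HY, absHY, weight, absWeight, mediatorRatio, invWeight, ZPair.z, ZPair.z', V]
    by_cases hZ : o.Z = 1 ∧ o.A = a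
    · by_cases hq : q P 1 a' o.W = 0
      · simp [ho hZ.1 hq]
      · rw [div_self hq, one_mul, mul_comm (g P a' o.W), ← div_div, div_self hq]
        ring
    · simp [indZA, hZ]
  · refine .of_forall fun o => ?_
    simp only [HY, HY10, absHY, weight, absWeight, mediatorRatio, invWeight, ZPair.z, ZPair.z', V]
    by_cases hq : qSum P a a' o.W = 0
    · have h1 := abs_weight_le P a a' .oneZero o.W
      simp only [weight, absWeight, hq] at h1
      simp [abs_nonpos_iff.1 h1]
    · field_simp
  · refine .of_forall fun o => ?_
    simp only [HY, absHY, weight, absWeight, mediatorRatio, invWeight, ZPair.z, ZPair.z', V]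
    by_cases hq : q P 0 a o.W = 0
    · simp [hq]
    · rw [div_self hq, one_mul, ← div_div]
      ring

lemma HM_ae_eq (a a' : Fin 2) (k : ZPair) : ∀ᵐ o ∂(P : Measure (Obs 𝒲 ℳ)),
    HM P a a' k o = weight P a a' k o.W / absWeight P a a' k o.W * absHM P a a' k o := by
  cases k
  · filter_upwards [ae_pos_of_mem_evZA P 1 a'] with o ho
    simp only [HM, absHM, weight, absWeight, invWeight, ZPair.z']
    by_cases hZ : o.Z = 1 ∧ o.A = a'
    · have hq := (ho hZ).2.ne'
      rw [div_self hq, one_mul, mul_comm (g P a' o.W), ← div_div, div_self hq]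
      ring
    · simp [indZA, hZ]
  · refine .of_forall fun o => ?_
    simp only [HM, HM10, absHM, weight, absWeight, invWeight, ZPair.z']
    by_cases hq : qSum P a a' o.W = 0
    · have h1 := abs_weight_le P a a' .oneZero o.W
      simp only [weight, absWeight, hq] at h1
      simp [abs_nonpos_iff.1 h1]
    · field_simp
  · refine .of_forall fun o => ?_
    simp only [HM, absHM, weight, absWeight, invWeight, ZPair.z']
    by_cases hq : q P 0 a o.W = 0
    · simp [hq]
    · rw [div_self hq, one_mul, mul_comm (q P 0 a' o.W)]
      ring

variable {P} {a a' : Fin 2}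

lemma HY_ae_eq_absHY (k : ZPair) (hk : ∀ w, weight P a a' k w = absWeight P a a' k w) :
    ∀ᵐ o ∂(P : Measure (Obs 𝒲 ℳ)), HY P a a' k o = absHY P a a' k o := by
  filter_upwards [HY_ae_eq P a a' k] with o ho
  rw [ho, hk]
  by_cases h0 : absWeight P a a' k o.W = 0
  · simp [absHY, invWeight, h0]
  · rw [div_self h0, one_mul]

lemma HM_ae_eq_absHM (k : ZPair) (hk : ∀ w, weight P a a' k w = absWeight P a a' k w) :
    ∀ᵐ o ∂(P : Measure (Obs 𝒲 ℳ)), HM P a a' k o = absHM P a a' k o := by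
  filter_upwards [HM_ae_eq P a a' k] with o ho
  rw [ho, hk]
  by_cases h0 : absWeight P a a' k o.W = 0
  · simp [absHM, invWeight, h0]
  · rw [div_self h0, one_mul]

/-- For (1,1) and (0,0) the weight is its own absolute weight; for (1,0) this is the integrability
condition with `qSum`. -/
lemma SquareIntegrable.absHY_memLp (h : SquareIntegrable P a a') (k : ZPair) :
    MemLp (fun o => absHY P a a' k o * resY P o) 2 (P : Measure (Obs 𝒲 ℳ)) := by
  have key : (∀ w, weight P a a' k w = absWeight P a a' k w) →
      MemLp (fun o => absHY P a a' k o * resY P o) 2 (P : Measure (Obs 𝒲 ℳ)) := fun hk =>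
    (memLp_congr_ae ((HY_ae_eq_absHY k hk).mono fun o ho => by simp only [ho])).1 (h.outcome k)
  cases k
  · exact key fun _ => rfl
  · convert h.outcome_sum using 2 with o
    congr 1
    simp only [HY10, absHY, mediatorRatio, invWeight, absWeight, V, ZPair.z, ZPair.z']
    ring
  · exact key fun _ => rfl

lemma SquareIntegrable.absHM_memLp (h : SquareIntegrable P a a') (k : ZPair) :
    MemLp (fun o => absHM P a a' k o * resM P a a' k o) 2 (P : Measure (Obs 𝒲 ℳ)) := by
  have key : (∀ w, weight P a a' k w = absWeight P a a' k w) →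
      MemLp (fun o => absHM P a a' k o * resM P a a' k o) 2 (P : Measure (Obs 𝒲 ℳ)) := fun hk =>
    (memLp_congr_ae ((HM_ae_eq_absHM k hk).mono fun o ho => by simp only [ho])).1
      (h.mediator k)
  cases k
  · exact key fun _ => rfl
  · convert h.mediator_sum using 2 with o
    congr 1
    simp only [HM10, absHM, invWeight, absWeight, ZPair.z']
    ring
  · exact key fun _ => rfl

lemma SquareIntegrable.rho_mul_absWeight_memLp (h : SquareIntegrable P a a') (k : ZPair) :
    MemLp (fun o => rho P a a' k.z k.z' o.W * absWeight P a a' k o.W) 2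
      (P : Measure (Obs 𝒲 ℳ)) := by
  cases k
  · exact h.plugin .oneOne
  · exact h.plugin_sum
  · exact h.plugin .zeroZero

variable (P) (a a')

lemma HW_eq (k : ZPair) (o : Obs 𝒲 ℳ) :
    HW P a a' k o = rho P a a' k.z k.z' o.W * weight P a a' k o.W := by
  cases k <;> rfl

lemma theta_eq_integral (k : ZPair) :
    theta a a' k P = ∫ o, HW P a a' k o ∂(P : Measure (Obs 𝒲 ℳ)) := by
  simp only [HW_eq]
  have := integral_map (μ := (P : Measure (Obs 𝒲 ℳ))) measurable_W.aemeasurable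
    (f := fun w => rho P a a' k.z k.z' w * weight P a a' k w)
    ((measurable_rho P a a' k.z k.z').mul (measurable_weight P a a' k)).aestronglyMeasurable
  rw [← this]
  rfl

/-! ### Integrals over the event `Z = ζ, A = α` -/

lemma integrable_V_iff {μ : Measure (Obs 𝒲 ℳ)} {G : 𝒲 × ℳ → ℝ} (hG : Measurable G) :
    Integrable G (μ.map V) ↔ Integrable (fun o => G (V o)) μ :=
  integrable_map_measure hG.aestronglyMeasurable measurable_V.aemeasurable

lemma integral_evZA_V {ζ α : Fin 2} {G : 𝒲 × ℳ → ℝ} (hG : Measurable G)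
    (hi : IntegrableOn (fun o => G (V o)) (evZA ζ α) (P : Measure (Obs 𝒲 ℳ))) :
    ∫ o in evZA ζ α, G (V o) ∂(P : Measure (Obs 𝒲 ℳ))
      = ∫ w, ∫ m, G (w, m) ∂(lawM P α ζ w)
          ∂(((P : Measure (Obs 𝒲 ℳ)).restrict (evZA ζ α)).map Obs.W) := by
  have h1 := (integrable_V_iff hG).2 hi
  rw [← integral_map measurable_V.aemeasurable hG.aestronglyMeasurable, map_V_evZA,
    Measure.integral_compProd (by rwa [← map_V_evZA])]
  rfl

lemma ae_integrable_lawM {ζ α : Fin 2} {G : 𝒲 × ℳ → ℝ} (hG : Measurable G)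
    (hi : IntegrableOn (fun o => G (V o)) (evZA ζ α) (P : Measure (Obs 𝒲 ℳ))) :
    ∀ᵐ w ∂(((P : Measure (Obs 𝒲 ℳ)).restrict (evZA ζ α)).map Obs.W),
      Integrable (fun m => G (w, m)) (lawM P α ζ w) := by
  have h1 := (integrable_V_iff hG).2 hi
  rw [map_V_evZA, Measure.integrable_compProd_iff hG.aestronglyMeasurable] at h1
  exact h1.1

/-- Inverse probability weighting. -/
lemma integral_evZA_W {ζ α : Fin 2} {ψ : 𝒲 → ℝ} (hψ : Measurable ψ) :
    ∫ o in evZA ζ α, ψ o.W ∂(P : Measure (Obs 𝒲 ℳ))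
      = ∫ o, g P α o.W * q P ζ α o.W * ψ o.W ∂(P : Measure (Obs 𝒲 ℳ)) :=
  integral_comp_of_map_eq_withDensity measurable_W (measurable_g_mul_q P ζ α)
    (fun w => mul_nonneg (g_nonneg P α w) (q_nonneg P ζ α w)) (map_W_evZA P ζ α) hψ

lemma integrableOn_evZA_W {ζ α : Fin 2} {ψ : 𝒲 → ℝ} (hψ : Measurable ψ) :
    IntegrableOn (fun o => ψ o.W) (evZA ζ α) (P : Measure (Obs 𝒲 ℳ))
      ↔ Integrable (fun o => g P α o.W * q P ζ α o.W * ψ o.W) (P : Measure (Obs 𝒲 ℳ)) :=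
  integrable_comp_iff_of_map_eq_withDensity measurable_W (measurable_g_mul_q P ζ α)
    (fun w => mul_nonneg (g_nonneg P α w) (q_nonneg P ζ α w)) (map_W_evZA P ζ α) hψ

/-- The mediator residual has conditional mean zero. -/
lemma integral_resM_eq_zero (k : ZPair) {ψ : 𝒲 → ℝ} (hψ : Measurable ψ)
    (hi : IntegrableOn (fun o => ψ o.W * resM P a a' k o) (evZA k.z' a')
      (P : Measure (Obs 𝒲 ℳ))) :
    ∫ o in evZA k.z' a', ψ o.W * resM P a a' k o ∂(P : Measure (Obs 𝒲 ℳ)) = 0 := by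
  have hG : Measurable fun v : 𝒲 × ℳ => ψ v.1 * (mu P v.2 k.z a v.1 - rho P a a' k.z k.z' v.1) :=
    (hψ.comp measurable_fst).mul
      ((measurable_mu P k.z a).sub ((measurable_rho P a a' k.z k.z').comp measurable_fst))
  have h1 := integral_evZA_V P hG hi
  have h2 := ae_integrable_lawM P hG hi
  change ∫ o in evZA k.z' a', ψ (V o).1 * (mu P (V o).2 k.z a (V o).1 - rho P a a' k.z k.z' (V o).1)
    ∂(P : Measure (Obs 𝒲 ℳ)) = 0
  rw [h1]
  refine integral_eq_zero_of_ae ?_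
  filter_upwards [h2] with w hw
  simp only [Pi.zero_apply]
  -- Integrability of the outcome regression under the mediator law is available only after dividing
  -- by `ψ w`; where `ψ w = 0` the integrand vanishes anyway.
  by_cases h0 : ψ w = 0
  · simp [h0]
  · have h3 : Integrable (fun m => mu P m k.z a w) (lawM P a' k.z' w) := by
      have h4 := (hw.const_mul (ψ w)⁻¹).add (integrable_const (rho P a a' k.z k.z' w))
      refine h4.congr (.of_forall fun m => ?_)
      simp [h0]
    rw [integral_const_mul, integral_sub h3 (integrable_const _)]
    simp [rho]

/-- The parameter as an inverse probability weighted mean of the outcome regression. -/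
lemma theta_eq_setIntegral (k : ZPair) {φ : 𝒲 → ℝ} (hφ : Measurable φ)
    (hw : ∀ᵐ w ∂(lawW P), weight P a a' k w = g P a' w * q P k.z' a' w * φ w)
    (hi : IntegrableOn (fun o => φ o.W * mu P o.M k.z a o.W) (evZA k.z' a')
      (P : Measure (Obs 𝒲 ℳ))) :
    theta a a' k P
      = ∫ o in evZA k.z' a', φ o.W * mu P o.M k.z a o.W ∂(P : Measure (Obs 𝒲 ℳ)) := by
  have hG : Measurable fun v : 𝒲 × ℳ => φ v.1 * mu P v.2 k.z a v.1 :=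
    (hφ.comp measurable_fst).mul (measurable_mu P k.z a)
  change _ = ∫ o in evZA k.z' a', φ (V o).1 * mu P (V o).2 k.z a (V o).1 ∂(P : Measure (Obs 𝒲 ℳ))
  rw [integral_evZA_V P hG hi, map_W_evZA, integral_withDensity_ofReal
    (measurable_g_mul_q P k.z' a')
    (fun w => mul_nonneg (g_nonneg P _ w) (q_nonneg P _ _ w)), theta]
  refine integral_congr_ae ?_
  filter_upwards [hw] with w hw
  rw [hw, integral_const_mul]
  ring

end Mediation

namespace Mediation

variable {𝒲 ℳ : Type*} [MeasurableSpace 𝒲] [MeasurableSpace ℳ] [StandardBorelSpace ℳ] [Nonempty ℳ]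
  [StandardBorelSpace 𝒲] [Nonempty 𝒲] {P Q : ProbabilityMeasure (Obs 𝒲 ℳ)} {p : Obs 𝒲 ℳ → ℝ} {C : ℝ}

lemma integrable_bdd_mul {Ω : Type*} [MeasurableSpace Ω] {μ : Measure Ω} {κ f : Ω → ℝ} {K : ℝ}
    (hκ : Measurable κ) (hK : ∀ᵐ o ∂μ, |κ o| ≤ K) (hf : Integrable f μ) :
    Integrable (fun o => κ o * f o) μ :=
  hf.bdd_mul hκ.aestronglyMeasurable hK

/-! ### The outcome term along a tilt -/

section Outcome

variable (h : BoundedTilt P Q p C) (hY : Integrable Obs.Y (P : Measure (Obs 𝒲 ℳ)))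
include h hY

/-- The residual is taken against the regression under `P` but averaged under `Q`, hence the
difference of the two regressions. The change of measure contributes the factor `tiltM`. -/
lemma isCondMean_outcome (ζ α : Fin 2) :
    IsCondMean ((P : Measure (Obs 𝒲 ℳ)).restrict (evZA ζ α)) V
      (fun o => p o * (o.Y - mu P o.M ζ α o.W))
      (fun v => tiltM P p ζ α v * (mu Q v.2 ζ α v.1 - mu P v.2 ζ α v.1)) :=
  IsCondMean.of_withDensity measurable_V h.measurable (fun o => (h.pos o).le)
    (h.restrict_eq (measurableSet_evZA ζ α)) (isCondMean_tiltM h ζ α)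
    ((isCondMean_mu Q (h.integrable_of hY) ζ α).sub_comp measurable_V (measurable_mu P ζ α)
      (h.integrable_restrict (measurableSet_evZA ζ α) (isCondMean_mu P hY ζ α).integrable_comp))

variable {a a' : Fin 2} (hpos : Positivity P a a') (hsq : SquareIntegrable P a a') (k : ZPair)
include hpos hsq

omit hY in
lemma integrable_outcome : Integrable
    (fun o => factorY P Q p a a' k (V o) * (absHY P a a' k o * resY P o))
    (P : Measure (Obs 𝒲 ℳ)) := by
  refine integrable_bdd_mul (K := C ^ 8) ((measurable_factorY h a a' k).comp measurable_V) ?_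
    ((hsq.absHY_memLp k).integrable one_le_two)
  filter_upwards [ae_of_ae_map measurable_W.aemeasurable (abs_factorY_le h hpos.treatment a a' k)]
    with o ho using ho o.M

/-- Under `Q`, the difference `μ_Q - μ_P` on `Z = z', A = a'` is carried to `Z = z, A = a`, where it
is the conditional mean of the outcome residual. The ratio of the two `tiltM` in `factorY` corrects
the mediator ratio from `P` to `Q`. Integrability is proved by the same transport, since only the
residual on `Z = z, A = a` is controlled by assumption. -/
lemma outcome_term :
    IntegrableOn (fun o => factorM P Q p a a' k o.W * invWeight P a a' k o.W
      * (mu Q o.M k.z a o.W - mu P o.M k.z a o.W)) (evZA k.z' a') (P : Measure (Obs 𝒲 ℳ)) ∧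
    ∫ o in evZA k.z' a', factorM P Q p a a' k o.W * invWeight P a a' k o.W
        * (mu Q o.M k.z a o.W - mu P o.M k.z a o.W) ∂(Q : Measure (Obs 𝒲 ℳ))
      = ∫ o, p o * (factorY P Q p a a' k (V o) * (absHY P a a' k o * resY P o))
          ∂(P : Measure (Obs 𝒲 ℳ)) := by
  set φ : 𝒲 → ℝ := fun w => factorM P Q p a a' k w * invWeight P a a' k w with hφdef
  set d : 𝒲 × ℳ → ℝ := fun v => mu Q v.2 k.z a v.1 - mu P v.2 k.z a v.1 with hd
  set t := tiltM P p k.z a with ht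
  set t' := tiltM P p k.z' a' with ht'
  set b := mediatorRatio P a a' k with hb
  have mφ : Measurable φ := (measurable_factorM h a a' k).mul (measurable_invWeight P a a' k)
  have md : Measurable d := (measurable_mu Q k.z a).sub (measurable_mu P k.z a)
  have mt : Measurable t := (isCondMean_tiltM h k.z a).measurable
  have mt' : Measurable t' := (isCondMean_tiltM h k.z' a').measurable
  have mb : Measurable b := measurable_mediatorRatio P a a' k
  have mΨ : Measurable fun v : 𝒲 × ℳ => b v * (φ v.1 * (t' v / t v)) :=
    mb.mul ((mφ.comp measurable_fst).mul (mt'.div mt))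
  have mΓ : Measurable fun v : 𝒲 × ℳ => φ v.1 * d v * t' v :=
    ((mφ.comp measurable_fst).mul md).mul mt'
  have hfun : (fun o => p o * (factorY P Q p a a' k (V o) * (absHY P a a' k o * resY P o)))
      = fun o => indZA k.z a o * ((b (V o) * (φ (V o).1 * (t' (V o) / t (V o))))
          * (p o * (o.Y - mu P o.M k.z a o.W))) := by
    ext o
    by_cases ho : o.Z = k.z ∧ o.A = a
    · simp only [absHY, factorY, resY, ho.1, ho.2, hφdef, V, ← hb, ← ht, ← ht']
      ring
    · simp [absHY, indZA, ho]
  have hi := h.integrable_mul (integrable_outcome h hpos hsq k)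
  rw [hfun, integrable_indZA_mul] at hi
  have Hc := isCondMean_outcome h hY k.z a
  have I1 := Hc.integrable_mul mΨ hi
  have E1 := Hc.integral_mul measurable_V mΨ hi
  rw [hfun, integral_indZA_mul, E1]
  -- The denominator of `factorY` is exactly the factor `tiltM` produced by the change of measure,
  -- and the two cancel.
  have hΓ : ∀ v : 𝒲 × ℳ, b v * (φ v.1 * (t' v / t v)) * (t v * d v)
      = b v * (φ v.1 * d v * t' v) := fun v => by
    have := (tiltM_pos h k.z a v).ne'
    simp only [← ht] at this
    field_simp
  change Integrable (fun o => b (V o) * (φ (V o).1 * (t' (V o) / t (V o))) * (t (V o) * d (V o))) _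
    at I1
  change _ ∧ _ = ∫ o in _, b (V o) * (φ (V o).1 * (t' (V o) / t (V o))) * (t (V o) * d (V o)) ∂_
  simp only [hΓ] at I1 ⊢
  have hG := measurableSet_goodSet P a a' k
  -- Off the good set the inverse weight is zero, so restricting to that set, where the mediator
  -- ratio is a density, changes no integral.
  have h0 : ∀ v ∉ goodSet P a a' k, φ v.1 * d v * t' v = 0 := by
    intro v hv
    have : absWeight P a a' k v.1 = 0 := le_antisymm (not_lt.1 hv) (absWeight_nonneg P a a' k _)
    simp [hφdef, invWeight, this]
  have hchg := restrict_map_V_eq_withDensity P hpos k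
  have mbΓ : Measurable fun v : 𝒲 × ℳ => b v * (φ v.1 * d v * t' v) := mb.mul mΓ
  have I2 : Integrable (fun o => φ (V o).1 * d (V o) * t' (V o))
      ((P : Measure (Obs 𝒲 ℳ)).restrict (evZA k.z' a')) := by
    rw [← integrable_V_iff mΓ, ← integrableOn_iff_integrable_of_support_subset
      (s := goodSet P a a' k) (fun v hv => by_contra fun hv' => hv (h0 v hv')), IntegrableOn,
      hchg, integrable_withDensity_ofReal mb (mediatorRatio_nonneg P a a' k)]
    exact ((integrable_V_iff mbΓ).2 I1).integrableOn
  have E2 : ∫ o in evZA k.z' a', φ (V o).1 * d (V o) * t' (V o) ∂(P : Measure (Obs 𝒲 ℳ))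
      = ∫ o in evZA k.z a, b (V o) * (φ (V o).1 * d (V o) * t' (V o))
          ∂(P : Measure (Obs 𝒲 ℳ)) := by
    rw [← integral_map (f := fun v : 𝒲 × ℳ => φ v.1 * d v * t' v) measurable_V.aemeasurable
      mΓ.aestronglyMeasurable,
      ← integral_map (f := fun v : 𝒲 × ℳ => b v * (φ v.1 * d v * t' v)) measurable_V.aemeasurable
      mbΓ.aestronglyMeasurable,
      ← setIntegral_eq_integral_of_forall_compl_eq_zero h0, hchg,
      integral_withDensity_ofReal mb (mediatorRatio_nonneg P a a' k)]
    refine setIntegral_eq_integral_of_forall_compl_eq_zero fun v hv => ?_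
    rw [h0 v hv, mul_zero]
  -- The factor `tiltM` is at least `1/C`, so it can be divided out without losing integrability.
  have I3 : Integrable (fun o => φ (V o).1 * d (V o))
      ((P : Measure (Obs 𝒲 ℳ)).restrict (evZA k.z' a')) := by
    have := integrable_bdd_mul (K := C) (κ := fun o => (t' (V o))⁻¹)
      (mt'.comp measurable_V).inv (.of_forall fun o => ?_) I2
    · refine this.congr (.of_forall fun o => ?_)
      have := (tiltM_pos h k.z' a' (V o)).ne'
      simp only [← ht'] at this
      field_simp
    · have h1 := tiltM_pos h k.z' a' (V o)
      rw [abs_of_nonneg (inv_nonneg.2 h1.le)]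
      exact inv_le_of_inv_le₀ h.C_pos (tiltM_mem h k.z' a' (V o)).1
  refine ⟨I3, ?_⟩
  rw [← E2, h.integral_restrict (measurableSet_evZA _ _)]
  have mφd : Measurable fun v : 𝒲 × ℳ => φ v.1 * d v := (mφ.comp measurable_fst).mul md
  have E3 := (isCondMean_tiltM h k.z' a').integral_mul measurable_V mφd
    ((h.integrable_mul I3).congr (.of_forall fun o => mul_comm _ _))
  rw [← ht'] at E3
  rw [← E3]
  refine integral_congr_ae (.of_forall fun o => mul_comm _ _)

/-- On the event `Z = z, A = a` all factors are functions of `(W, M)`, so the residual keeps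
conditional mean zero under `P`, whatever the tilt. -/
lemma integral_outcome_eq_zero :
    ∫ o, factorY P Q p a a' k (V o) * (absHY P a a' k o * resY P o) ∂(P : Measure (Obs 𝒲 ℳ))
      = 0 := by
  have mΨ : Measurable fun v : 𝒲 × ℳ => factorY P Q p a a' k v *
      (mediatorRatio P a a' k v * invWeight P a a' k v.1) :=
    (measurable_factorY h a a' k).mul ((measurable_mediatorRatio P a a' k).mul
      ((measurable_invWeight P a a' k).comp measurable_fst))
  have hfun : (fun o => factorY P Q p a a' k (V o) * (absHY P a a' k o * resY P o))
      = fun o => indZA k.z a o * ((factorY P Q p a a' k (V o) *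
      (mediatorRatio P a a' k (V o) * invWeight P a a' k (V o).1))
          * (o.Y - mu P o.M k.z a o.W)) := by
    ext o
    by_cases ho : o.Z = k.z ∧ o.A = a
    · simp only [absHY, resY, ho.1, ho.2, V]
      ring
    · simp [absHY, indZA, ho]
  have hi := integrable_outcome h hpos hsq k
  rw [hfun, integrable_indZA_mul] at hi
  have Hc := (isCondMean_mu P hY k.z a).sub_comp measurable_V (measurable_mu P k.z a)
    (isCondMean_mu P hY k.z a).integrable_comp
  rw [hfun, integral_indZA_mul]
  refine (Hc.integral_mul measurable_V mΨ hi).trans ?_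
  simp

end Outcome

/-! ### The mediator and plug-in terms along a tilt -/

section Mediator

variable (h : BoundedTilt P Q p C) {a a' : Fin 2} (hpos : Positivity P a a')
  (hsq : SquareIntegrable P a a') (k : ZPair)
include h hpos hsq

lemma integrable_mediator : Integrable
    (fun o => factorM P Q p a a' k o.W * (absHM P a a' k o * resM P a a' k o))
    (P : Measure (Obs 𝒲 ℳ)) :=
  integrable_bdd_mul (K := C ^ 6) ((measurable_factorM h a a' k).comp measurable_W)
    (ae_of_ae_map measurable_W.aemeasurable (abs_factorM_le h hpos.treatment a a' k))
    ((hsq.absHM_memLp k).integrable one_le_two)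

omit h hpos hsq in
lemma mediator_fun_eq :
    (fun o => factorM P Q p a a' k o.W * (absHM P a a' k o * resM P a a' k o))
      = fun o => indZA k.z' a' o * (factorM P Q p a a' k o.W * invWeight P a a' k o.W
          * resM P a a' k o) := by
  ext o; simp only [absHM]; ring

lemma integrableOn_mediator : IntegrableOn
    (fun o => factorM P Q p a a' k o.W * invWeight P a a' k o.W * resM P a a' k o)
    (evZA k.z' a') (P : Measure (Obs 𝒲 ℳ)) := by
  rw [← integrable_indZA_mul, ← mediator_fun_eq k]
  exact integrable_mediator h hpos hsq k

lemma mediator_term :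
    ∫ o in evZA k.z' a', factorM P Q p a a' k o.W * invWeight P a a' k o.W * resM P a a' k o
        ∂(Q : Measure (Obs 𝒲 ℳ))
      = ∫ o, p o * (factorM P Q p a a' k o.W * (absHM P a a' k o * resM P a a' k o))
          ∂(P : Measure (Obs 𝒲 ℳ)) := by
  rw [h.integral_restrict (measurableSet_evZA _ _), ← integral_indZA_mul]
  refine integral_congr_ae (.of_forall fun o => ?_)
  simp only [absHM]; ring

lemma integral_mediator_eq_zero :
    ∫ o, factorM P Q p a a' k o.W * (absHM P a a' k o * resM P a a' k o)
      ∂(P : Measure (Obs 𝒲 ℳ)) = 0 := by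
  rw [mediator_fun_eq k, integral_indZA_mul]
  exact integral_resM_eq_zero P a a' k (ψ := fun w => factorM P Q p a a' k w * invWeight P a a' k w)
    ((measurable_factorM h a a' k).mul (measurable_invWeight P a a' k))
    (integrableOn_mediator h hpos hsq k)

lemma integrable_plugin_tilt :
    Integrable (fun o => rho P a a' k.z k.z' o.W * weight Q a a' k o.W)
      (P : Measure (Obs 𝒲 ℳ)) := by
  refine (((hsq.rho_mul_absWeight_memLp k).integrable one_le_two).const_mul (C ^ 4)).mono
    (((measurable_rho P a a' k.z k.z').mul (measurable_weight Q a a' k)).comp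
      measurable_W).aestronglyMeasurable ?_
  filter_upwards [ae_of_ae_map measurable_W.aemeasurable
    (abs_weight_tilt_le h hpos.treatment a a' k)] with o ho
  have hC := h.C_pos
  have h0 := absWeight_nonneg P a a' k o.W
  rw [Real.norm_eq_abs, Real.norm_eq_abs, abs_mul, abs_mul, abs_mul,
    abs_of_nonneg h0, abs_of_nonneg (by positivity : 0 ≤ C ^ 4)]
  calc _ ≤ |rho P a a' k.z k.z' o.W| * (C ^ 4 * absWeight P a a' k o.W) :=
        mul_le_mul_of_nonneg_left ho (abs_nonneg _)
    _ = _ := by ring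

end Mediator

end Mediation

/-! ### The confounder term along a tilt -/

namespace Mediation

variable {𝒲 ℳ : Type*} [MeasurableSpace 𝒲] [MeasurableSpace ℳ] [StandardBorelSpace ℳ] [Nonempty ℳ]
  [StandardBorelSpace 𝒲] [Nonempty 𝒲] {P Q : ProbabilityMeasure (Obs 𝒲 ℳ)} {p : Obs 𝒲 ℳ → ℝ} {C : ℝ}

lemma integral_add₃ {Ω : Type*} [MeasurableSpace Ω] {μ : Measure Ω} {f₁ f₂ f₃ : Ω → ℝ}
    (h₁ : Integrable f₁ μ) (h₂ : Integrable f₂ μ) (h₃ : Integrable f₃ μ) :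
    ∫ o, (f₁ o + f₂ o + f₃ o) ∂μ = ∫ o, f₁ o ∂μ + ∫ o, f₂ o ∂μ + ∫ o, f₃ o ∂μ := by
  rw [← integral_add h₁ h₂]; exact integral_add (h₁.add h₂) h₃

lemma integral_add₄ {Ω : Type*} [MeasurableSpace Ω] {μ : Measure Ω} {f₁ f₂ f₃ f₄ : Ω → ℝ}
    (h₁ : Integrable f₁ μ) (h₂ : Integrable f₂ μ) (h₃ : Integrable f₃ μ) (h₄ : Integrable f₄ μ) :
    ∫ o, (f₁ o + f₂ o + f₃ o + f₄ o) ∂μ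
      = ∫ o, f₁ o ∂μ + ∫ o, f₂ o ∂μ + ∫ o, f₃ o ∂μ + ∫ o, f₄ o ∂μ := by
  rw [← integral_add₃ h₁ h₂ h₃]; exact integral_add ((h₁.add h₂).add h₃) h₄

/-- The coefficients of `q(1 | α, w)` in the weights. -/
def weightCoeff (a a' : Fin 2) : ZPair → Fin 2 → ℝ
  | .oneOne, α => if α = a' then 1 else 0
  | .oneZero, α => (if α = a then 1 else 0) - (if α = a' then 1 else 0)
  | .zeroZero, α => -(if α = a then 1 else 0)

/-- On `A = α` the denominator `g(α | W)` equals `g(A | W)`. This puts the three confounder weights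
in one form, with the coefficients of `weight_sub_weight`. -/
lemma HZ_eq (P : ProbabilityMeasure (Obs 𝒲 ℳ)) (a a' : Fin 2) (k : ZPair) (o : Obs 𝒲 ℳ) :
    HZ P a a' k o = weightCoeff a a' k o.A / g P o.A o.W * rho P a a' k.z k.z' o.W := by
  have h1 : ∀ α, indA α o / g P α o.W = (if o.A = α then 1 else 0) / g P o.A o.W := by
    intro α
    by_cases h : o.A = α
    · subst h; rfl
    · simp [indA, h]
  cases k <;> simp only [HZ, weightCoeff, h1, ZPair.z, ZPair.z']
  · ring
  · ring

/-- Each weight is affine in `q(1|0,w)` and `q(1|1,w)`. The minus sign for (0,0) comes from `q(0|a)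
= 1 - q(1|a)`. -/
lemma weight_sub_weight (P Q : ProbabilityMeasure (Obs 𝒲 ℳ)) (a a' : Fin 2) (k : ZPair) (w : 𝒲) :
    weight Q a a' k w - weight P a a' k w
      = ∑ α, weightCoeff a a' k α * (q Q 1 α w - q P 1 α w) := by
  cases k <;> simp only [weight, weightCoeff, qDiff, neg_mul, sub_mul, ite_mul, one_mul, zero_mul,
    Finset.sum_sub_distrib, Finset.sum_neg_distrib, Finset.sum_ite_eq', Finset.mem_univ, if_true]
  · ring
  · linarith [q_zero_add_q_one P a w, q_zero_add_q_one Q a w]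

lemma integral_evA_W {α : Fin 2} {ψ : 𝒲 → ℝ} (hψ : Measurable ψ) :
    ∫ o in evA α, ψ o.W ∂(P : Measure (Obs 𝒲 ℳ))
      = ∫ o, g P α o.W * ψ o.W ∂(P : Measure (Obs 𝒲 ℳ)) :=
  integral_comp_of_map_eq_withDensity measurable_W (measurable_g P α) (g_nonneg P α)
    (map_W_evA P α) hψ

lemma integrableOn_evA_W {α : Fin 2} {ψ : 𝒲 → ℝ} (hψ : Measurable ψ) :
    IntegrableOn (fun o => ψ o.W) (evA α) (P : Measure (Obs 𝒲 ℳ))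
      ↔ Integrable (fun o => g P α o.W * ψ o.W) (P : Measure (Obs 𝒲 ℳ)) :=
  integrable_comp_iff_of_map_eq_withDensity measurable_W (measurable_g P α) (g_nonneg P α)
    (map_W_evA P α) hψ

lemma integral_eq_sum_evA {f : Obs 𝒲 ℳ → ℝ} {μ : Measure (Obs 𝒲 ℳ)} (hf : Integrable f μ) :
    ∫ o, f o ∂μ = ∑ α, ∫ o in evA α, f o ∂μ := by
  have h1 : ∀ α, ∫ o in evA α, f o ∂μ = ∫ o, (evA α).indicator f o ∂μ :=
    fun α => (integral_indicator (measurableSet_evA α)).symm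
  simp only [h1]
  rw [← integral_finsetSum _ fun α _ => hf.indicator (measurableSet_evA α)]
  refine integral_congr_ae (.of_forall fun o => ?_)
  have h2 : ∀ α, (evA α).indicator f o = if o.A = α then f o else 0 := fun α => by
    by_cases h : o.A = α
    · rw [Set.indicator_of_mem (show o ∈ evA α from h), if_pos h]
    · rw [Set.indicator_of_notMem (show o ∉ evA α from h), if_neg h]
  simp [h2]

section Confounder

variable (h : BoundedTilt P Q p C) {a a' : Fin 2} (hpos : Positivity P a a')
  (hsq : SquareIntegrable P a a') (k : ZPair)
include h

lemma isCondMean_resZ (α : Fin 2) :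
    IsCondMean ((P : Measure (Obs 𝒲 ℳ)).restrict (evA α)) Obs.W
      (fun o => p o * ((evZ 1).indicator (fun _ => (1 : ℝ)) o - q P 1 α o.W))
      (fun w => tiltA P p α w * (q Q 1 α w - q P 1 α w)) :=
  IsCondMean.of_withDensity measurable_W h.measurable (fun o => (h.pos o).le)
    (h.restrict_eq (measurableSet_evA α)) (isCondMean_tiltA h α)
    ((isCondMean_q Q 1 α).sub_comp measurable_W (measurable_q P 1 α)
      (h.integrable_restrict (measurableSet_evA α) (isCondMean_q P 1 α).integrable_comp))

omit h in
lemma resZ_eq (o : Obs 𝒲 ℳ) :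
    resZ P o = (evZ 1).indicator (fun _ => (1 : ℝ)) o - q P 1 o.A o.W := by
  by_cases hZ : o.Z = 1
  · rw [resZ, if_pos hZ, Set.indicator_of_mem (show o ∈ evZ 1 from hZ)]
  · rw [resZ, if_neg hZ, Set.indicator_of_notMem (show o ∉ evZ 1 from hZ)]

/-- The weight of the confounder residual on the event `A = α`. -/
def confounderWeight (P : ProbabilityMeasure (Obs 𝒲 ℳ)) (p : Obs 𝒲 ℳ → ℝ) (a a' : Fin 2)
    (k : ZPair) (α : Fin 2) (w : 𝒲) : ℝ :=
  factorZ P p α w * (weightCoeff a a' k α / g P α w * rho P a a' k.z k.z' w)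

lemma measurable_confounderWeight (α : Fin 2) : Measurable (confounderWeight P p a a' k α) :=
  (measurable_factorZ h α).mul ((measurable_const.div (measurable_g P α)).mul
    (measurable_rho P a a' k.z k.z'))

omit h in
lemma confounder_eq_on {α : Fin 2} {o : Obs 𝒲 ℳ} (ho : o ∈ evA α) :
    factorZ P p o.A o.W * (HZ P a a' k o * resZ P o) = confounderWeight P p a a' k α o.W *
      ((evZ 1).indicator (fun _ => (1 : ℝ)) o - q P 1 α o.W) := by
  have ho' : o.A = α := ho
  rw [HZ_eq, resZ_eq, ho', confounderWeight]
  ring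

include hsq in
lemma integrable_confounder : Integrable
    (fun o => factorZ P p o.A o.W * (HZ P a a' k o * resZ P o)) (P : Measure (Obs 𝒲 ℳ)) := by
  refine integrable_bdd_mul (K := C ^ 2) ?_ (.of_forall fun o => abs_factorZ_le h o.A o.W)
    ((hsq.confounder k).integrable one_le_two)
  have : Measurable fun x : 𝒲 × Fin 2 => factorZ P p x.2 x.1 :=
    measurable_from_prod_countable_left fun α => measurable_factorZ h α
  exact this.comp (measurable_W.prodMk measurable_A)

include hsq hpos in
-- On each event `A = α` the tilted residual `Z - q_P` has conditional mean `tiltA · (q_Q - q_P)`.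
-- The factor `tiltW / tiltA` turns this into a `tiltW`-weighted integral, that is, an integral
-- under `Q`. Summing over `α` assembles the weight difference.
lemma confounder_term :
    ∫ o, rho P a a' k.z k.z' o.W * (weight Q a a' k o.W - weight P a a' k o.W)
        ∂(Q : Measure (Obs 𝒲 ℳ))
      = ∫ o, p o * (factorZ P p o.A o.W * (HZ P a a' k o * resZ P o))
          ∂(P : Measure (Obs 𝒲 ℳ)) := by
  have hi := h.integrable_mul (integrable_confounder h hsq k)
  set χ : Fin 2 → 𝒲 → ℝ := fun α w =>
    rho P a a' k.z k.z' w * (weightCoeff a a' k α * (q Q 1 α w - q P 1 α w)) with hχ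
  have mχ : ∀ α, Measurable (χ α) := fun α => (measurable_rho P a a' k.z k.z').mul
    (measurable_const.mul ((measurable_q Q 1 α).sub (measurable_q P 1 α)))
  have key : ∀ α, Integrable (fun o => p o * χ α o.W) (P : Measure (Obs 𝒲 ℳ)) ∧
      ∫ o in evA α, p o * (factorZ P p o.A o.W * (HZ P a a' k o * resZ P o))
          ∂(P : Measure (Obs 𝒲 ℳ)) = ∫ o, p o * χ α o.W ∂(P : Measure (Obs 𝒲 ℳ)) := by
    intro α
    have Hc := isCondMean_resZ h α
    have mψ := measurable_confounderWeight h (a := a) (a' := a') k α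
    have hE : ∀ o ∈ evA α, p o * (factorZ P p o.A o.W * (HZ P a a' k o * resZ P o))
        = confounderWeight P p a a' k α o.W *
          (p o * ((evZ 1).indicator (fun _ => (1 : ℝ)) o - q P 1 α o.W)) := fun o ho => by
      rw [confounder_eq_on k ho]; ring
    have hi' := (integrableOn_congr_fun hE (measurableSet_evA α)).1
      (hi.integrableOn (s := evA α))
    have I1 := Hc.integrable_mul mψ hi'
    have mψ' : Measurable fun w => confounderWeight P p a a' k α w *
        (tiltA P p α w * (q Q 1 α w - q P 1 α w)) := mψ.mul Hc.measurable
    rw [setIntegral_congr_fun (measurableSet_evA α) hE, Hc.integral_mul measurable_W mψ hi',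
      integral_evA_W mψ']
    have I2 := (integrableOn_evA_W (P := P) mψ').1 I1
    -- The propensity cancels the inverse weight, and `tiltA` cancels the denominator of `factorZ`.
    have hae : ∀ᵐ o ∂(P : Measure (Obs 𝒲 ℳ)), g P α o.W * (confounderWeight P p a a' k α o.W *
        (tiltA P p α o.W * (q Q 1 α o.W - q P 1 α o.W))) = χ α o.W * tiltW P p o.W := by
      filter_upwards [ae_of_ae_map measurable_W.aemeasurable hpos.treatment] with o ho
      have h1 := (ho α).ne'
      have h2 := (tiltA_pos h α o.W).ne'
      simp only [confounderWeight, factorZ, hχ]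
      field_simp
    have I3 : Integrable (fun o => χ α o.W) (P : Measure (Obs 𝒲 ℳ)) := by
      refine (integrable_bdd_mul (K := C) (κ := fun o => (tiltW P p o.W)⁻¹)
        ((isCondMean_tiltW h).measurable.comp measurable_W).inv (.of_forall fun o => ?_)
        (I2.congr hae)).congr (.of_forall fun o => ?_)
      · have h1 := tiltW_pos h o.W
        rw [abs_of_nonneg (inv_nonneg.2 h1.le)]
        exact inv_le_of_inv_le₀ h.C_pos (tiltW_mem h o.W).1
      · have := (tiltW_pos h o.W).ne'
        simp only
        field_simp
    have I4 := h.integrable_mul I3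
    refine ⟨I4, ?_⟩
    rw [integral_congr_ae hae]
    refine ((isCondMean_tiltW h).integral_mul measurable_W (mχ α)
      (I4.congr (.of_forall fun o => mul_comm _ _))).symm.trans ?_
    exact integral_congr_ae (.of_forall fun o => mul_comm _ _)
  rw [integral_eq_sum_evA hi, h.integral_eq]
  simp only [fun α => (key α).2]
  rw [← integral_finsetSum _ fun α _ => (key α).1]
  refine integral_congr_ae (.of_forall fun o => ?_)
  simp only [weight_sub_weight, hχ, Finset.mul_sum]

include hsq in
lemma integral_confounder_eq_zero :
    ∫ o, factorZ P p o.A o.W * (HZ P a a' k o * resZ P o) ∂(P : Measure (Obs 𝒲 ℳ)) = 0 := by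
  have hi := integrable_confounder h hsq k
  rw [integral_eq_sum_evA hi]
  refine Finset.sum_eq_zero fun α _ => ?_
  have Hc := (isCondMean_q P 1 α).sub_comp measurable_W (measurable_q P 1 α)
    (isCondMean_q P 1 α).integrable_comp
  have hE : ∀ o ∈ evA α, factorZ P p o.A o.W * (HZ P a a' k o * resZ P o)
      = confounderWeight P p a a' k α o.W *
        ((evZ 1).indicator (fun _ => (1 : ℝ)) o - q P 1 α o.W) := fun o ho =>
    confounder_eq_on k ho
  have hi' := (integrableOn_congr_fun hE (measurableSet_evA α)).1 (hi.integrableOn (s := evA α))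
  rw [setIntegral_congr_fun (measurableSet_evA α) hE]
  refine (Hc.integral_mul measurable_W (measurable_confounderWeight h k α) hi').trans ?_
  simp

end Confounder

/-! ### The exact expansion of the parameter along a tilt -/

/-- The influence function with its terms multiplied by the factors of a tilt. -/
def tiltedD (P Q : ProbabilityMeasure (Obs 𝒲 ℳ)) (p : Obs 𝒲 ℳ → ℝ) (a a' : Fin 2) (k : ZPair)
    (o : Obs 𝒲 ℳ) : ℝ :=
  factorY P Q p a a' k (V o) * (absHY P a a' k o * resY P o)
    + factorZ P p o.A o.W * (HZ P a a' k o * resZ P o)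
    + factorM P Q p a a' k o.W * (absHM P a a' k o * resM P a a' k o)
    + HW P a a' k o

variable (h : BoundedTilt P Q p C) (hY : Integrable Obs.Y (P : Measure (Obs 𝒲 ℳ)))
  {a a' : Fin 2} (hpos : Positivity P a a') (hsq : SquareIntegrable P a a') (k : ZPair)
include h hY hpos hsq

/-- The factors are constant given the variables each residual is centred on, so only the plug-in
term survives. -/
lemma integral_tiltedD :
    ∫ o, tiltedD P Q p a a' k o ∂(P : Measure (Obs 𝒲 ℳ)) = theta a a' k P := by
  have i1 := integrable_outcome h hpos hsq k
  have i2 := integrable_confounder h hsq k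
  have i3 := integrable_mediator h hpos hsq k
  have i4 := (hsq.plugin k).integrable one_le_two
  unfold tiltedD
  rw [integral_add₄ i1 i2 i3 i4,
    integral_outcome_eq_zero h hY hpos hsq k, integral_confounder_eq_zero h hsq k,
    integral_mediator_eq_zero h hpos hsq k, theta_eq_integral]
  simp

/-- The residual terms integrate, under `Q`, to the successive differences of a telescoping
decomposition of the parameter at `Q`. -/
lemma integral_mul_tiltedD :
    ∫ o, p o * tiltedD P Q p a a' k o ∂(P : Measure (Obs 𝒲 ℳ)) = theta a a' k Q := by
  have i1 := h.integrable_mul (integrable_outcome h hpos hsq k)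
  have i2 := h.integrable_mul (integrable_confounder h hsq k)
  have i3 := h.integrable_mul (integrable_mediator h hpos hsq k)
  have i4 := h.integrable_mul ((hsq.plugin k).integrable one_le_two)
  unfold tiltedD
  simp only [mul_add]
  rw [integral_add₄ i1 i2 i3 i4]
  obtain ⟨o1, o2⟩ := outcome_term h hY hpos hsq k
  have o1' := h.integrable_restrict (measurableSet_evZA _ _) o1
  have m1 := h.integrable_restrict (measurableSet_evZA _ _) (integrableOn_mediator h hpos hsq k)
  have w1 := h.integrable_of (integrable_plugin_tilt h hpos hsq k)
  have w2 : Integrable (HW P a a' k) (Q : Measure (Obs 𝒲 ℳ)) :=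
    h.integrable_of ((hsq.plugin k).integrable one_le_two)
  rw [← o2, ← mediator_term h hpos hsq k, ← confounder_term h hpos hsq k,
    ← h.integral_eq (HW P a a' k)]
  set φ : 𝒲 → ℝ := fun w => factorM P Q p a a' k w * invWeight P a a' k w with hφ
  have mφ : Measurable φ := (measurable_factorM h a a' k).mul (measurable_invWeight P a a' k)
  have hQP : lawW Q ≪ lawW P := h.absolutelyContinuous.map measurable_W
  -- The product `φ` of `factorM` and the inverse weight under `P` is the inverse probability weight
  -- under `Q`.
  have hw : ∀ᵐ w ∂(lawW Q), weight Q a a' k w = g Q a' w * q Q k.z' a' w * φ w :=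
    hQP.ae_le (weight_tilt_eq h hpos k)
  have mφρ : Measurable fun w => φ w * rho P a a' k.z k.z' w :=
    mφ.mul (measurable_rho P a a' k.z k.z')
  have hae : ∀ᵐ o ∂(Q : Measure (Obs 𝒲 ℳ)), rho P a a' k.z k.z' o.W * weight Q a a' k o.W
      = g Q a' o.W * q Q k.z' a' o.W * (φ o.W * rho P a a' k.z k.z' o.W) := by
    filter_upwards [ae_of_ae_map measurable_W.aemeasurable hw] with o ho
    rw [ho]; ring
  have i5 : IntegrableOn (fun o => φ o.W * rho P a a' k.z k.z' o.W) (evZA k.z' a')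
      (Q : Measure (Obs 𝒲 ℳ)) := (integrableOn_evZA_W Q mφρ).2 (w1.congr hae)
  have e5 : ∫ o in evZA k.z' a', φ o.W * rho P a a' k.z k.z' o.W ∂(Q : Measure (Obs 𝒲 ℳ))
      = ∫ o, rho P a a' k.z k.z' o.W * weight Q a a' k o.W ∂(Q : Measure (Obs 𝒲 ℳ)) :=
    (integral_evZA_W Q mφρ).trans (integral_congr_ae hae).symm
  -- Telescoping: outcome regression from `Q` to `P`, then its centring at `rho`, then `rho` itself.
  -- The last part is rewritten through `λ_Q = (λ_Q - λ_P) + λ_P`.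
  have hsum : (fun o : Obs 𝒲 ℳ => φ o.W * mu Q o.M k.z a o.W)
      = fun o => φ o.W * (mu Q o.M k.z a o.W - mu P o.M k.z a o.W)
        + φ o.W * resM P a a' k o + φ o.W * rho P a a' k.z k.z' o.W := by
    ext o; simp only [resM]; ring
  have hθ := theta_eq_setIntegral Q a a' k mφ hw (by
    rw [hsum]; exact (o1'.add m1).add i5)
  rw [hθ, hsum, integral_add₃ o1' m1 i5, e5]
  simp only [mul_sub]
  rw [integral_sub w1 (by simpa only [← HW_eq] using w2)]
  simp only [← HW_eq]
  ring

/-- Exact, with no second-order remainder: all dependence on `Q` beyond `p - 1` sits in the bounded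
factors inside `tiltedD`. -/
theorem theta_sub_theta :
    theta a a' k Q - theta a a' k P
      = ∫ o, (p o - 1) * tiltedD P Q p a a' k o ∂(P : Measure (Obs 𝒲 ℳ)) := by
  have i := (((integrable_outcome h hpos hsq k).add (integrable_confounder h hsq k)).add
    (integrable_mediator h hpos hsq k)).add ((hsq.plugin k).integrable one_le_two)
  rw [← integral_mul_tiltedD h hY hpos hsq k, ← integral_tiltedD h hY hpos hsq k]
  simp only [sub_mul, one_mul]
  exact (integral_sub (h.integrable_mul i) i).symm

end Mediation

/-! ### Almost everywhere limits of conditional means, and limits of products -/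

section Limits

variable {Ω β : Type*} [MeasurableSpace Ω] [MeasurableSpace β] {μ : Measure Ω}

/-- Summable L¹ norms make the sum of `|f n|` integrable, hence finite almost everywhere, so its
terms tend to zero. -/
lemma ae_tendsto_zero_of_tsum_lintegral {f : ℕ → Ω → ℝ} (hf : ∀ n, Measurable (f n))
    (hs : ∑' n, ∫⁻ o, ‖f n o‖ₑ ∂μ ≠ ∞) : ∀ᵐ o ∂μ, Tendsto (fun n => f n o) atTop (𝓝 0) := by
  rw [← lintegral_tsum fun n => (hf n).enorm.aemeasurable] at hs
  filter_upwards [ae_lt_top (Measurable.tsum fun n => (hf n).enorm) hs] with o ho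
  rw [tendsto_zero_iff_enorm_tendsto_zero]
  exact ENNReal.tendsto_atTop_zero_of_tsum_ne_top ho.ne

/-- Conditional means of densities converge almost everywhere along fast sequences. -/
lemma ae_tendsto_condMean [StandardBorelSpace Ω] [Nonempty Ω] {E : Set Ω} [IsFiniteMeasure μ]
    {X : Ω → β} (hX : Measurable X) {p : ℕ → Ω → ℝ} (hp : ∀ n, Measurable (p n))
    (hi : ∀ n, Integrable (p n) μ) (hs : ∑' n, ∫⁻ o, ‖p n o - 1‖ₑ ∂μ ≠ ∞) :
    ∀ᵐ x ∂((μ.restrict E).map X),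
      Tendsto (fun n => condMean (μ.restrict E) X (p n) x) atTop (𝓝 1) := by
  have h1 : ∑' n, ∫⁻ x, ‖condMean (μ.restrict E) X (p n) x - 1‖ₑ ∂((μ.restrict E).map X) ≠ ∞ := by
    refine ne_top_of_le_ne_top hs (ENNReal.tsum_le_tsum fun n => ?_)
    exact (lintegral_condMean_sub_le hX (hp n) (hi n).integrableOn 1).trans
      (lintegral_mono' Measure.restrict_le_self le_rfl)
  have h2 := ae_tendsto_zero_of_tsum_lintegral (fun n =>
    (isCondMean_condMean hX (hp n) (hi n).integrableOn).measurable.sub_const 1) h1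
  filter_upwards [h2] with x hx
  simpa using hx.add_const 1

/-- Strong L² convergence of one factor is paired with dominated almost everywhere convergence of
the other. The error from `u n - s` is at most `‖u n - s‖₂ ‖B‖₂` by Hölder, and `s * T n` is
dominated by the integrable `|s B|`. -/
lemma tendsto_integral_mul_of_L2 {u : ℕ → Ω → ℝ} {s : Ω → ℝ} {T : ℕ → Ω → ℝ} {D B : Ω → ℝ}
    (hu : ∀ n, MemLp (u n) 2 μ) (hs : MemLp s 2 μ)
    (hus : Tendsto (fun n => eLpNorm (fun o => u n o - s o) 2 μ) atTop (𝓝 0))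
    (hT : ∀ n, AEStronglyMeasurable (T n) μ) (hB : MemLp B 2 μ)
    (hTB : ∀ n, ∀ᵐ o ∂μ, |T n o| ≤ B o)
    (hTD : ∀ᵐ o ∂μ, Tendsto (fun n => T n o) atTop (𝓝 (D o))) :
    Tendsto (fun n => ∫ o, u n o * T n o ∂μ) atTop (𝓝 (∫ o, D o * s o ∂μ)) := by
  have mT : ∀ n, MemLp (T n) 2 μ := fun n => hB.mono (hT n) ((hTB n).mono fun o ho =>
    ho.trans (le_abs_self _))
  have i1 : ∀ n, Integrable (fun o => (u n o - s o) * T n o) μ := fun n =>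
    ((hu n).sub hs).integrable_mul (mT n)
  have i2 : ∀ n, Integrable (fun o => s o * T n o) μ := fun n => hs.integrable_mul (mT n)
  have iB : Integrable (fun o => s o * B o) μ := hs.integrable_mul hB
  have hsplit : ∀ n, ∫ o, u n o * T n o ∂μ
      = ∫ o, (u n o - s o) * T n o ∂μ + ∫ o, s o * T n o ∂μ := fun n => by
    rw [← integral_add (i1 n) (i2 n)]
    exact integral_congr_ae (.of_forall fun o => by ring)
  have h1 : Tendsto (fun n => ∫ o, (u n o - s o) * T n o ∂μ) atTop (𝓝 0) := by
    rw [tendsto_zero_iff_enorm_tendsto_zero]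
    have hlim : Tendsto (fun n => eLpNorm (fun o => u n o - s o) 2 μ * eLpNorm B 2 μ) atTop
        (𝓝 0) := by
      simpa using ENNReal.Tendsto.mul_const hus (.inr hB.eLpNorm_ne_top)
    refine tendsto_of_tendsto_of_tendsto_of_le_of_le tendsto_const_nhds hlim
      (fun _ => bot_le) fun n => ?_
    refine (enorm_integral_le_lintegral_enorm _).trans ?_
    rw [← eLpNorm_one_eq_lintegral_enorm]
    refine (eLpNorm_smul_le_mul_eLpNorm (p := 2) (q := 2) (r := 1) (f := T n)
      (φ := fun o => u n o - s o) (hT n) ((hu n).sub hs).aestronglyMeasurable).trans ?_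
    refine mul_le_mul_right (eLpNorm_mono_ae ((hTB n).mono fun o ho => ?_)) _
    exact ho.trans (le_abs_self _)
  have h2 : Tendsto (fun n => ∫ o, s o * T n o ∂μ) atTop (𝓝 (∫ o, s o * D o ∂μ)) := by
    refine tendsto_integral_of_dominated_convergence (fun o => ‖s o * B o‖)
      (fun n => (i2 n).aestronglyMeasurable) iB.norm (fun n => ?_) ?_
    · filter_upwards [hTB n] with o ho
      rw [norm_mul, norm_mul]
      exact mul_le_mul_of_nonneg_left (ho.trans (le_abs_self _)) (norm_nonneg _)
    · filter_upwards [hTD] with o ho using ho.const_mul _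
  simp only [hsplit, mul_comm (D _)]
  simpa using h1.add h2

end Limits

/-! ### Difference quotients of integrals along tilts -/

section Tilts

variable {Ω : Type*} [MeasurableSpace Ω] {P : ProbabilityMeasure Ω} {Q : ℕ → ProbabilityMeasure Ω}
  {p : ℕ → Ω → ℝ} {C : ℝ} (h : ∀ n, BoundedTilt P (Q n) (p n) C)
include h

omit h in
lemma BoundedTilt.sqrt_le {Q : ProbabilityMeasure Ω} {p : Ω → ℝ} (h : BoundedTilt P Q p C) (o : Ω) :
    √(p o) ≤ C := by
  refine Real.sqrt_le_iff.2 ⟨h.C_pos.le, (h.upper o).trans ?_⟩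
  nlinarith [h.one_le]

/-- Limits of difference quotients of integrals along a path that is differentiable in quadratic
mean. -/
lemma tendsto_integral_sub_div {t : ℕ → ℝ} {s : Ω → ℝ} {T : ℕ → Ω → ℝ} {D B : Ω → ℝ}
    (hs : ∑' n, ∫⁻ o, ‖p n o - 1‖ₑ ∂(P : Measure Ω) ≠ ∞) (hs2 : MemLp s 2 (P : Measure Ω))
    (hlim : Tendsto (fun n => eLpNorm (fun o => (√(p n o) - 1) / t n - s o / 2) 2
      (P : Measure Ω)) atTop (𝓝 0))
    (hT : ∀ n, AEStronglyMeasurable (T n) (P : Measure Ω)) (hB : MemLp B 2 (P : Measure Ω))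
    (hTB : ∀ n, ∀ᵐ o ∂(P : Measure Ω), |T n o| ≤ B o)
    (hTD : ∀ᵐ o ∂(P : Measure Ω), Tendsto (fun n => T n o) atTop (𝓝 (D o))) :
    Tendsto (fun n => (∫ o, (p n o - 1) * T n o ∂(P : Measure Ω)) / t n) atTop
      (𝓝 (∫ o, D o * s o ∂(P : Measure Ω))) := by
  have msqrt : ∀ n, Measurable fun o => √(p n o) := fun n => (h n).measurable.sqrt
  have hu : ∀ n, MemLp (fun o => (√(p n o) - 1) / t n) 2 (P : Measure Ω) := by
    intro n
    have : MemLp (fun o => √(p n o)) 2 (P : Measure Ω) :=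
      MemLp.of_bound (msqrt n).aestronglyMeasurable C (.of_forall fun o => by
        rw [Real.norm_of_nonneg (Real.sqrt_nonneg _)]; exact (h n).sqrt_le o)
    exact (this.sub (memLp_const 1)).mul_const (t n)⁻¹
  -- Here `(p - 1)/t` is factored as `((√p - 1)/t)(√p + 1)`: the first factor tends to `s/2` in L²,
  -- the second to 2 while staying below `C + 1`.
  have h1 := tendsto_integral_mul_of_L2 (u := fun n o => (√(p n o) - 1) / t n)
    (s := fun o => s o / 2) (T := fun n o => (√(p n o) + 1) * T n o) (D := fun o => 2 * D o)
    (B := fun o => (C + 1) * B o) hu (hs2.mul_const 2⁻¹) hlim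
    (fun n => ((msqrt n).add_const 1).aestronglyMeasurable.mul (hT n)) (hB.const_mul _)
    (fun n => by
      filter_upwards [hTB n] with o ho
      rw [abs_mul, abs_of_nonneg (by positivity)]
      exact mul_le_mul (by linarith [(h n).sqrt_le o]) ho (abs_nonneg _)
        (by linarith [(h n).C_pos])) (by
      filter_upwards [hTD, ae_tendsto_zero_of_tsum_lintegral
        (fun n => (h n).measurable.sub_const 1) hs] with o h1 h2
      have h3 : Tendsto (fun n => √(p n o)) atTop (𝓝 1) := by simpa using (h2.add_const 1).sqrt
      have h4 := (h3.add_const 1).mul h1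
      rwa [one_add_one_eq_two] at h4)
  convert h1 using 1
  · ext n
    rw [← integral_div]
    refine integral_congr_ae (.of_forall fun o => ?_)
    have := Real.mul_self_sqrt ((h n).pos o).le
    simp only
    linear_combination (-(T n o / t n)) * this
  · congr 1
    exact integral_congr_ae (.of_forall fun o => by ring)

/-- Scores have mean zero. -/
lemma integral_score_eq_zero {t : ℕ → ℝ} {s : Ω → ℝ}
    (hs : ∑' n, ∫⁻ o, ‖p n o - 1‖ₑ ∂(P : Measure Ω) ≠ ∞) (hs2 : MemLp s 2 (P : Measure Ω))
    (hlim : Tendsto (fun n => eLpNorm (fun o => (√(p n o) - 1) / t n - s o / 2) 2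
      (P : Measure Ω)) atTop (𝓝 0)) : ∫ o, s o ∂(P : Measure Ω) = 0 := by
  have h1 := tendsto_integral_sub_div h hs hs2 hlim (T := fun _ _ => 1) (D := fun _ => 1)
    (B := fun _ => 1) (fun n => aestronglyMeasurable_const) (memLp_const 1)
    (fun n => .of_forall fun o => by simp) (.of_forall fun o => tendsto_const_nhds)
  have h2 : ∀ n, ∫ o, (p n o - 1) * 1 ∂(P : Measure Ω) = 0 := fun n => by
    have h3 := (h n).integral_eq (fun _ => 1)
    simp only [mul_one] at h3 ⊢
    rw [integral_sub (h n).integrable (integrable_const 1), ← h3]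
    simp
  simp only [h2, zero_div, one_mul] at h1
  exact tendsto_nhds_unique h1 tendsto_const_nhds

end Tilts

/-! ### Limits of the factors and of the tilted influence function -/

namespace Mediation

variable {𝒲 ℳ : Type*} [MeasurableSpace 𝒲] [MeasurableSpace ℳ] [StandardBorelSpace ℳ] [Nonempty ℳ]
  [StandardBorelSpace 𝒲] [Nonempty 𝒲] {P : ProbabilityMeasure (Obs 𝒲 ℳ)}
  {Q : ℕ → ProbabilityMeasure (Obs 𝒲 ℳ)} {p : ℕ → Obs 𝒲 ℳ → ℝ} {C : ℝ}
  (h : ∀ n, BoundedTilt P (Q n) (p n) C)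
  (hs : ∑' n, ∫⁻ o, ‖p n o - 1‖ₑ ∂(P : Measure (Obs 𝒲 ℳ)) ≠ ∞)
  {a a' : Fin 2} (hpos : Positivity P a a')
include h hs

lemma ae_tendsto_tiltW : ∀ᵐ w ∂(lawW P), Tendsto (fun n => tiltW P (p n) w) atTop (𝓝 1) := by
  have h1 := ae_tendsto_condMean (E := Set.univ) measurable_W (fun n => (h n).measurable)
    (fun n => (h n).integrable) hs
  simp only [Measure.restrict_univ] at h1
  exact h1

include hpos

lemma ae_tendsto_tiltA : ∀ᵐ w ∂(lawW P), ∀ α,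
    Tendsto (fun n => tiltA P (p n) α w) atTop (𝓝 1) := by
  rw [ae_all_iff]
  intro α
  have h1 := ae_tendsto_condMean (E := evA α) measurable_W (fun n => (h n).measurable)
    (fun n => (h n).integrable) hs
  rw [map_W_evA, ae_withDensity_iff (measurable_g P α).ennreal_ofReal] at h1
  filter_upwards [h1, hpos.treatment] with w h2 h3
  exact h2 (by simpa using h3 α)

lemma ae_tendsto_tiltZ : ∀ᵐ w ∂(lawW P), ∀ ζ α, 0 < q P ζ α w →
    Tendsto (fun n => tiltZ P (p n) ζ α w) atTop (𝓝 1) := by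
  rw [ae_all_iff]; intro ζ
  rw [ae_all_iff]; intro α
  have h1 := ae_tendsto_condMean (E := evZA ζ α) measurable_W (fun n => (h n).measurable)
    (fun n => (h n).integrable) hs
  rw [map_W_evZA, ae_withDensity_iff (measurable_g_mul_q P ζ α).ennreal_ofReal] at h1
  filter_upwards [h1, hpos.treatment] with w h2 h3 h4
  exact h2 (by simpa using mul_pos (h3 α) h4)

lemma ae_tendsto_q : ∀ᵐ w ∂(lawW P), ∀ ζ α,
    Tendsto (fun n => q (Q n) ζ α w) atTop (𝓝 (q P ζ α w)) := by
  filter_upwards [ae_tendsto_tiltA h hs hpos, ae_tendsto_tiltZ h hs hpos,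
    ae_all_iff.2 fun n => tiltA_mul_q (h n) hpos.treatment] with w h1 h2 h3 ζ α
  have h4 : ∀ n, q (Q n) ζ α w = q P ζ α w * tiltZ P (p n) ζ α w / tiltA P (p n) α w := fun n => by
    rw [← h3 n, mul_div_cancel_left₀ _ (tiltA_pos (h n) α w).ne']
  simp only [h4]
  rcases (q_nonneg P ζ α w).lt_or_eq with h0 | h0
  · have h5 := ((h2 ζ α h0).const_mul (q P ζ α w)).div (h1 α) one_ne_zero
    rwa [mul_one, div_one] at h5
  · simp [← h0]

lemma ae_tendsto_weight (k : ZPair) : ∀ᵐ w ∂(lawW P),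
    Tendsto (fun n => weight (Q n) a a' k w) atTop (𝓝 (weight P a a' k w)) := by
  filter_upwards [ae_tendsto_q h hs hpos] with w h1
  cases k
  · exact h1 _ _
  · exact (h1 _ _).sub (h1 _ _)
  · exact h1 _ _

lemma ae_tendsto_factorZ : ∀ᵐ w ∂(lawW P), ∀ α,
    Tendsto (fun n => factorZ P (p n) α w) atTop (𝓝 1) := by
  filter_upwards [ae_tendsto_tiltW h hs, ae_tendsto_tiltA h hs hpos] with w h1 h2 α
  have h3 := h1.div (h2 α) one_ne_zero
  rwa [div_one] at h3

/-- The limit is the ratio of weight to absolute weight, which turns `absHM` back into `HM`. Where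
the absolute weight vanishes, every term and the limit are zero by the convention for division. -/
lemma ae_tendsto_factorM (k : ZPair) : ∀ᵐ w ∂(lawW P),
    Tendsto (fun n => factorM P (Q n) (p n) a a' k w) atTop
      (𝓝 (weight P a a' k w / absWeight P a a' k w)) := by
  filter_upwards [ae_tendsto_tiltW h hs, ae_tendsto_tiltZ h hs hpos,
    ae_tendsto_weight h hs hpos k, hpos.goodAt] with w h1 h2 h3 h4
  rcases (absWeight_nonneg P a a' k w).lt_or_eq with h0 | h0
  · have h5 := (h3.div_const (absWeight P a a' k w)).mul
      (h1.div (h2 _ _ (h4 k h0).q_z') one_ne_zero)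
    rwa [div_one, mul_one] at h5
  · simp [factorM, ← h0]

/-- Convergence of the numerator `tiltM` is known only for the law of `(W, M)` on `Z = z', A = a'`.
The mediator ratio carries it to `Z = z, A = a` wherever the ratio is nonzero. Elsewhere `absHY`
vanishes, so the factor is irrelevant. -/
lemma ae_tendsto_factorY (k : ZPair) : ∀ᵐ o ∂(P : Measure (Obs 𝒲 ℳ)),
    Tendsto (fun n => factorY P (Q n) (p n) a a' k (V o) * absHY P a a' k o) atTop
      (𝓝 (weight P a a' k o.W / absWeight P a a' k o.W * absHY P a a' k o)) := by
  have hM : ∀ ζ α, ∀ᵐ v ∂((P : Measure (Obs 𝒲 ℳ)).restrict (evZA ζ α)).map V,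
      Tendsto (fun n => tiltM P (p n) ζ α v) atTop (𝓝 1) := fun ζ α =>
    ae_tendsto_condMean (E := evZA ζ α) measurable_V (fun n => (h n).measurable)
      (fun n => (h n).integrable) hs
  have h1 := ae_of_ae_map measurable_V.aemeasurable (hM k.z a)
  have h2 := ae_restrict_of_ae (s := goodSet P a a' k) (hM k.z' a')
  rw [restrict_map_V_eq_withDensity P hpos k,
    ae_withDensity_iff (measurable_mediatorRatio P a a' k).ennreal_ofReal,
    ae_restrict_iff' (measurableSet_goodSet P a a' k)] at h2
  have h2' := ae_of_ae_map measurable_V.aemeasurable h2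
  rw [ae_restrict_iff' (measurableSet_evZA _ _)] at h1 h2'
  filter_upwards [h1, h2', ae_of_ae_map measurable_W.aemeasurable
    (ae_tendsto_factorM h hs hpos k)] with o h3 h4 h5
  by_cases h0 : absHY P a a' k o = 0
  · simp [h0]
  · have ho : o ∈ evZA k.z a := by
      by_contra hc
      exact h0 (by simp [absHY, indZA, show ¬ (o.Z = k.z ∧ o.A = a) from hc])
    have hr : mediatorRatio P a a' k (V o) ≠ 0 := fun hc => h0 (by simp [absHY, hc])
    have hw : V o ∈ goodSet P a a' k := by
      by_contra hc
      have : absWeight P a a' k o.W = 0 :=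
        le_antisymm (not_lt.1 hc) (absWeight_nonneg P a a' k _)
      exact h0 (by simp [absHY, invWeight, this])
    have h6 := h4 ho hw (by simpa using (mediatorRatio_nonneg P a a' k (V o)).lt_of_ne' hr)
    refine Tendsto.mul_const _ ?_
    have h7 := h5.mul (h6.div (h3 ho) one_ne_zero)
    rwa [div_one, mul_one] at h7

lemma ae_tendsto_tiltedD (k : ZPair) : ∀ᵐ o ∂(P : Measure (Obs 𝒲 ℳ)),
    Tendsto (fun n => tiltedD P (Q n) (p n) a a' k o) atTop (𝓝 (D P a a' k o)) := by
  filter_upwards [ae_tendsto_factorY h hs hpos k, ae_of_ae_map measurable_W.aemeasurable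
    (ae_tendsto_factorM h hs hpos k), ae_of_ae_map measurable_W.aemeasurable
    (ae_tendsto_factorZ h hs hpos), HY_ae_eq P a a' k, HM_ae_eq P a a' k] with o h1 h2 h3 h4 h5
  unfold tiltedD D
  rw [h4, h5]
  refine ((Tendsto.add ?_ ?_).add ?_).add tendsto_const_nhds
  · simp only [← mul_assoc]
    exact h1.mul_const _
  · simpa using (h3 o.A).mul_const (HZ P a a' k o * resZ P o)
  · simp only [← mul_assoc]
    exact (h2.mul_const _).mul_const _

/-- The exact expansion divided by `t n`, in the limit. The powers of `C` in the dominating function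
are the uniform bounds of the three factors, and square integrability of the absolute terms makes it
an L² function. -/
theorem tendsto_theta_sub_div (hY : Integrable Obs.Y (P : Measure (Obs 𝒲 ℳ)))
    (hsq : SquareIntegrable P a a') (k : ZPair) {t : ℕ → ℝ} {s : Obs 𝒲 ℳ → ℝ}
    (hs2 : MemLp s 2 (P : Measure (Obs 𝒲 ℳ)))
    (hlim : Tendsto (fun n => eLpNorm (fun o => (√(p n o) - 1) / t n - s o / 2) 2
      (P : Measure (Obs 𝒲 ℳ))) atTop (𝓝 0)) :
    Tendsto (fun n => (theta a a' k (Q n) - theta a a' k P) / t n) atTop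
      (𝓝 (∫ o, D P a a' k o * s o ∂(P : Measure (Obs 𝒲 ℳ)))) := by
  simp only [fun n => theta_sub_theta (h n) hY hpos hsq k]
  refine tendsto_integral_sub_div h hs hs2 hlim (fun n => ?_)
    (B := fun o => C ^ 8 * ‖absHY P a a' k o * resY P o‖ + C ^ 2 * ‖HZ P a a' k o * resZ P o‖
      + C ^ 6 * ‖absHM P a a' k o * resM P a a' k o‖ + ‖HW P a a' k o‖) ?_ (fun n => ?_)
    (ae_tendsto_tiltedD h hs hpos k)
  · exact ((((integrable_outcome (h n) hpos hsq k).add (integrable_confounder (h n) hsq k)).add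
      (integrable_mediator (h n) hpos hsq k)).add
      ((hsq.plugin k).integrable one_le_two)).aestronglyMeasurable
  · exact ((((hsq.absHY_memLp k).norm.const_mul _).add ((hsq.confounder k).norm.const_mul _)).add
      ((hsq.absHM_memLp k).norm.const_mul _)).add (hsq.plugin k).norm
  · filter_upwards [ae_of_ae_map measurable_W.aemeasurable
      (abs_factorY_le (h n) hpos.treatment a a' k), ae_of_ae_map measurable_W.aemeasurable
      (abs_factorM_le (h n) hpos.treatment a a' k)] with o h1 h2
    have hm : ∀ x y c : ℝ, |x| ≤ c → |x * y| ≤ c * ‖y‖ := fun x y c hc => by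
      rw [abs_mul]; exact mul_le_mul_of_nonneg_right hc (abs_nonneg _)
    unfold tiltedD
    refine (abs_add_le _ _).trans (add_le_add ((abs_add_le _ _).trans (add_le_add
      ((abs_add_le _ _).trans (add_le_add ?_ ?_)) ?_)) le_rfl)
    · exact hm _ _ _ (h1 o.M)
    · exact hm _ _ _ (abs_factorZ_le (h n) _ _)
    · exact hm _ _ _ h2

end Mediation

/-! ### Regular submodels as bounded tilts -/

section Submodels

variable {𝓞 : Type*} [MeasurableSpace 𝓞] {ν : Measure 𝓞} [SigmaFinite ν]
  {P Q : ProbabilityMeasure 𝓞} {p s : 𝓞 → ℝ} {C : ℝ}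

lemma nonparametricModel.absolutelyContinuous [TopologicalSpace 𝓞]
    (hP : P ∈ nonparametricModel ν) : (P : Measure 𝓞) ≪ ν := by
  obtain ⟨p, -, -, h⟩ := hP
  rw [h]; exact withDensity_absolutelyContinuous _ _

lemma BoundedTilt.dens_eq (h : BoundedTilt P Q p C) (hP : (P : Measure 𝓞) ≪ ν) :
    ∀ᵐ o ∂ν, dens ν Q o = p o * dens ν P o := by
  have h1 : (Q : Measure 𝓞) = ν.withDensity
      ((P : Measure 𝓞).rnDeriv ν * fun o => ENNReal.ofReal (p o)) := by
    rw [withDensity_mul₀ (Measure.measurable_rnDeriv _ _).aemeasurable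
      h.measurable.ennreal_ofReal.aemeasurable, Measure.withDensity_rnDeriv_eq _ _ hP, h.eq]
  have h2 := Measure.rnDeriv_withDensity ν
    ((Measure.measurable_rnDeriv (P : Measure 𝓞) ν).mul h.measurable.ennreal_ofReal)
  rw [← h1] at h2
  filter_upwards [h2] with o ho
  rw [dens, ho, dens, Pi.mul_apply, ENNReal.toReal_mul, ENNReal.toReal_ofReal (h.pos o).le, mul_comm]

/-- The distance of root densities, as an integral with respect to the base law. -/
lemma BoundedTilt.lintegral_sqrt_dens (h : BoundedTilt P Q p C) (hP : (P : Measure 𝓞) ≪ ν)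
    (hs : AEStronglyMeasurable s (P : Measure 𝓞)) (t : ℝ) :
    ∫⁻ o, ENNReal.ofReal
        (((√(dens ν Q o) - √(dens ν P o)) / t - s o * √(dens ν P o) / 2) ^ 2) ∂ν
      = ∫⁻ o, ENNReal.ofReal (((√(p o) - 1) / t - s o / 2) ^ 2) ∂(P : Measure 𝓞) := by
  obtain ⟨s', ms', hss'⟩ := hs
  -- The score is determined only up to `P`-null sets. This suffices, since both integrands vanish
  -- where the density of `P` does.
  have hs' : ∀ᵐ o ∂ν, (P : Measure 𝓞).rnDeriv ν o ≠ 0 → s o = s' o := by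
    rw [← ae_withDensity_iff (Measure.measurable_rnDeriv _ _), Measure.withDensity_rnDeriv_eq _ _ hP]
    exact hss'
  have hmeas : Measurable fun o => ENNReal.ofReal (((√(p o) - 1) / t - s' o / 2) ^ 2) :=
    ((((h.measurable.sqrt.sub_const 1).div_const t).sub
      (ms'.measurable.div_const 2)).pow_const 2).ennreal_ofReal
  have hRHS : ∫⁻ o, ENNReal.ofReal (((√(p o) - 1) / t - s o / 2) ^ 2) ∂(P : Measure 𝓞)
      = ∫⁻ o, ENNReal.ofReal (((√(p o) - 1) / t - s' o / 2) ^ 2) ∂(P : Measure 𝓞) :=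
    lintegral_congr_ae (hss'.mono fun o ho => by simp only [ho])
  rw [hRHS, ← lintegral_rnDeriv_mul hP hmeas.aemeasurable]
  refine lintegral_congr_ae ?_
  filter_upwards [h.dens_eq hP, hs', Measure.rnDeriv_lt_top (P : Measure 𝓞) ν] with o h1 h2 h3
  by_cases h0 : (P : Measure 𝓞).rnDeriv ν o = 0
  · have hd0 : dens ν P o = 0 := by simp [dens, h0]
    rw [h1, hd0]
    simp [h0]
  · have hd : 0 ≤ dens ν P o := ENNReal.toReal_nonneg
    rw [h1, Real.sqrt_mul (h.pos o).le, h2 h0]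
    have h4 : (P : Measure 𝓞).rnDeriv ν o = ENNReal.ofReal (dens ν P o) :=
      (ENNReal.ofReal_toReal h3.ne).symm
    rw [h4, ← ENNReal.ofReal_mul hd]
    congr 1
    have h5 := Real.mul_self_sqrt hd
    linear_combination (((√(p o) - 1) / t - s' o / 2) ^ 2) * h5

/-- Mutually bounded laws are bounded tilts of each other. -/
lemma exists_boundedTilt {K : ℝ≥0} (h1 : (Q : Measure 𝓞) ≤ K • (P : Measure 𝓞))
    (h2 : (P : Measure 𝓞) ≤ K • (Q : Measure 𝓞)) : ∃ p, BoundedTilt P Q p (max K 1) := by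
  set C : ℝ := max K 1 with hC
  have hC1 : 1 ≤ C := le_max_right _ _
  have hKC : (K : ℝ) ≤ C := le_max_left _ _
  have hC0 : 0 < C := zero_lt_one.trans_le hC1
  set ρ := (Q : Measure 𝓞).rnDeriv P with hρ
  have mρ : Measurable ρ := Measure.measurable_rnDeriv _ _
  have hac : (Q : Measure 𝓞) ≪ P :=
    (Measure.absolutelyContinuous_of_le h1).trans (Measure.smul_absolutelyContinuous)
  have hQ : (P : Measure 𝓞).withDensity ρ = Q := Measure.withDensity_rnDeriv_eq _ _ hac
  have hset : ∀ B, MeasurableSet B → ∫⁻ o in B, ρ o ∂(P : Measure 𝓞) = (Q : Measure 𝓞) B :=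
    fun B hB => by rw [← withDensity_apply _ hB, hQ]
  have hup : ∀ᵐ o ∂(P : Measure 𝓞), ρ o ≤ K := by
    refine ae_le_of_forall_setLIntegral_le_of_sigmaFinite mρ fun B hB _ => ?_
    rw [hset B hB, setLIntegral_const]
    exact h1 B
  have hlow : ∀ᵐ o ∂(P : Measure 𝓞), 1 ≤ K * ρ o := by
    refine ae_le_of_forall_setLIntegral_le_of_sigmaFinite measurable_const fun B hB _ => ?_
    rw [lintegral_const_mul _ mρ, hset B hB, setLIntegral_const, one_mul]
    exact h2 B
  -- The derivative satisfies the bounds only almost everywhere; clipping makes them hold everywhere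
  -- without changing the law.
  refine ⟨fun o => max C⁻¹ (min C (ρ o).toReal), hC1,
    measurable_const.max (measurable_const.min mρ.ennreal_toReal), fun o => le_max_left _ _,
    fun o => max_le ((inv_le_one_of_one_le₀ hC1).trans hC1) (min_le_left _ _), ?_⟩
  rw [← hQ]
  refine withDensity_congr_ae ?_
  filter_upwards [hup, hlow] with o h3 h4
  have hfin : ρ o ≠ ∞ := ne_top_of_le_ne_top ENNReal.coe_ne_top h3
  have h5 : (ρ o).toReal ≤ K := ENNReal.toReal_le_coe_of_le_coe h3
  have h6 : 1 ≤ (K : ℝ) * (ρ o).toReal := by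
    have := ENNReal.toReal_mono (ENNReal.mul_ne_top ENNReal.coe_ne_top hfin) h4
    simpa using this
  have h7 : C⁻¹ ≤ (ρ o).toReal := by
    rw [inv_le_iff_one_le_mul₀ hC0]
    exact h6.trans (by rw [mul_comm]; exact mul_le_mul_of_nonneg_left hKC ENNReal.toReal_nonneg)
  rw [min_eq_right (h5.trans hKC), max_eq_right h7, ENNReal.ofReal_toReal hfin]

lemma eLpNorm_two_eq {μ : Measure 𝓞} (f : 𝓞 → ℝ) :
    eLpNorm f 2 μ = (∫⁻ o, ENNReal.ofReal (f o ^ 2) ∂μ) ^ (1 / 2 : ℝ) := by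
  rw [eLpNorm_eq_lintegral_rpow_enorm_toReal (by norm_num) (by norm_num)]
  simp only [ENNReal.toReal_ofNat]
  congr 2
  ext o
  rw [← sq_abs, ENNReal.ofReal_pow (abs_nonneg _), ← Real.norm_eq_abs, ofReal_norm]
  norm_cast

/-- The total variation distance along a tilt is controlled by the remainder in quadratic mean. -/
lemma BoundedTilt.lintegral_sub_one_le (h : BoundedTilt P Q p C) (hs : MemLp s 2 (P : Measure 𝓞))
    {t : ℝ} (ht : t ≠ 0) :
    ∫⁻ o, ‖p o - 1‖ₑ ∂(P : Measure 𝓞) ≤ ENNReal.ofReal ((C + 1) * |t|) *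
      (eLpNorm (fun o => (√(p o) - 1) / t - s o / 2) 2 (P : Measure 𝓞)
        + eLpNorm (fun o => s o / 2) 2 (P : Measure 𝓞)) := by
  have m1 : AEStronglyMeasurable (fun o => (√(p o) - 1) / t) (P : Measure 𝓞) :=
    ((h.measurable.sqrt.sub_const 1).div_const t).aestronglyMeasurable
  have m2 : AEStronglyMeasurable (fun o => s o / 2) (P : Measure 𝓞) :=
    (hs.mul_const 2⁻¹).aestronglyMeasurable
  -- Use `|p - 1| = |√p - 1| (√p + 1)` with `√p ≤ C`, then L¹ ≤ L² for a probability law and the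
  -- triangle inequality.
  calc ∫⁻ o, ‖p o - 1‖ₑ ∂(P : Measure 𝓞)
      ≤ ∫⁻ o, ENNReal.ofReal ((C + 1) * |t|) * ‖(√(p o) - 1) / t‖ₑ ∂(P : Measure 𝓞) := by
        refine lintegral_mono fun o => ?_
        rw [← ofReal_norm, ← ofReal_norm, ← ENNReal.ofReal_mul (by
          have := h.C_pos; positivity)]
        refine ENNReal.ofReal_le_ofReal ?_
        have h1 : p o - 1 = (√(p o) - 1) * (√(p o) + 1) := by
          have := Real.mul_self_sqrt (h.pos o).le
          linear_combination -this
        have h2 := h.sqrt_le o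
        have h3 := Real.sqrt_nonneg (p o)
        rw [Real.norm_eq_abs, Real.norm_eq_abs, h1, abs_mul, abs_div,
          abs_of_nonneg (by linarith : 0 ≤ √(p o) + 1)]
        have h4 : |t| ≠ 0 := abs_ne_zero.2 ht
        have h5 : (C + 1) * |t| * (|√(p o) - 1| / |t|) = |√(p o) - 1| * (C + 1) := by
          field_simp
        rw [h5]
        exact mul_le_mul_of_nonneg_left (by linarith) (abs_nonneg _)
    _ = ENNReal.ofReal ((C + 1) * |t|) * eLpNorm (fun o => (√(p o) - 1) / t) 1 P := by
        rw [lintegral_const_mul'' _ m1.enorm, eLpNorm_one_eq_lintegral_enorm]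
    _ ≤ ENNReal.ofReal ((C + 1) * |t|) * eLpNorm (fun o => (√(p o) - 1) / t) 2 P :=
        mul_le_mul_right (eLpNorm_le_eLpNorm_of_exponent_le one_le_two m1) _
    _ ≤ _ := by
        refine mul_le_mul_right ?_ _
        have h6 := eLpNorm_add_le (m1.sub m2) m2 one_le_two
        rwa [sub_add_cancel] at h6

variable {𝓜 : Set (ProbabilityMeasure 𝓞)} {path : ℝ → ProbabilityMeasure 𝓞}

/-- Sequences along a regular submodel have subsequences of tilts that converge fast. -/
lemma IsRegularSubmodel.exists_subseq (hR : IsRegularSubmodel 𝓜 ν P path s)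
    (hP : (P : Measure 𝓞) ≪ ν) {t : ℕ → ℝ} (ht : Tendsto t atTop (𝓝[≠] 0)) :
    ∃ (φ : ℕ → ℕ) (p : ℕ → 𝓞 → ℝ) (C : ℝ),
      (∀ n, BoundedTilt P (path (t (φ n))) (p n) C) ∧
      ∑' n, ∫⁻ o, ‖p n o - 1‖ₑ ∂(P : Measure 𝓞) ≠ ∞ ∧
      Tendsto (fun n => eLpNorm (fun o => (√(p n o) - 1) / t (φ n) - s o / 2) 2 (P : Measure 𝓞))
        atTop (𝓝 0) := by
  obtain ⟨K, hK⟩ := hR.likelihood_ratio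
  have hK' : ∀ᶠ n in atTop, ∃ p, BoundedTilt P (path (t n)) p (max K 1) :=
    (ht.eventually (hK.filter_mono nhdsWithin_le_nhds)).mono fun n hn =>
      exists_boundedTilt hn.1 hn.2
  set E : ℕ → ℝ≥0∞ := fun n => ∫⁻ o, ENNReal.ofReal
      (((√(dens ν (path (t n)) o) - √(dens ν P o)) / t n - s o * √(dens ν P o) / 2) ^ 2) ∂ν with hE
  have hE0 : Tendsto (fun n => (E n) ^ (1 / 2 : ℝ)) atTop (𝓝 0) := by
    have h1 : Tendsto E atTop (𝓝 0) := hR.quadratic_mean.comp ht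
    have h2 := (ENNReal.continuous_rpow_const (y := 1 / 2)).tendsto 0 |>.comp h1
    rwa [ENNReal.zero_rpow_of_pos (by norm_num)] at h2
  set S := eLpNorm (fun o => s o / 2) 2 (P : Measure 𝓞) with hS
  have hSfin : S ≠ ∞ := (hR.score_memLp.mul_const 2⁻¹).eLpNorm_ne_top
  have hb : Tendsto (fun n => ENNReal.ofReal ((max (K : ℝ) 1 + 1) * |t n|) *
      ((E n) ^ (1 / 2 : ℝ) + S)) atTop (𝓝 0) := by
    have h1 : Tendsto (fun n => ENNReal.ofReal ((max (K : ℝ) 1 + 1) * |t n|)) atTop (𝓝 0) := by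
      have h2 : Tendsto (fun n => (max (K : ℝ) 1 + 1) * |t n|) atTop (𝓝 0) := by
        simpa using ((ht.mono_right nhdsWithin_le_nhds).abs).const_mul (max (K : ℝ) 1 + 1)
      simpa using ENNReal.tendsto_ofReal h2
    have h3 := hE0.add_const S
    rw [zero_add] at h3
    simpa using ENNReal.Tendsto.mul h1 (.inr hSfin) h3 (.inr ENNReal.zero_ne_top)
  -- The bound on `‖p - 1‖₁` tends to zero, so a subsequence keeps it below `2⁻¹ ^ n`, which is
  -- summable.
  obtain ⟨φ, hφ, hφP⟩ := extraction_forall_of_eventually (P := fun n k =>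
    (∃ p, BoundedTilt P (path (t k)) p (max K 1)) ∧ t k ≠ 0 ∧
      ENNReal.ofReal ((max (K : ℝ) 1 + 1) * |t k|) * ((E k) ^ (1 / 2 : ℝ) + S) ≤ 2⁻¹ ^ n)
    fun n => hK'.and ((ht.eventually self_mem_nhdsWithin).and
      (hb.eventually (ge_mem_nhds (by simp [pos_iff_ne_zero]))))
  choose p hp using fun n => (hφP n).1
  have hnorm : ∀ n, eLpNorm (fun o => (√(p n o) - 1) / t (φ n) - s o / 2) 2 (P : Measure 𝓞)
      = (E (φ n)) ^ (1 / 2 : ℝ) := fun n => by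
    rw [eLpNorm_two_eq, hE, ← (hp n).lintegral_sqrt_dens hP hR.score_memLp.aestronglyMeasurable]
  refine ⟨φ, p, max K 1, hp, ?_, ?_⟩
  · refine ne_top_of_le_ne_top (b := ∑' n : ℕ, (2⁻¹ : ℝ≥0∞) ^ n) ?_ (ENNReal.tsum_le_tsum fun n => ?_)
    · rw [ENNReal.tsum_geometric]; simp
    · refine ((hp n).lintegral_sub_one_le hR.score_memLp (hφP n).2.1).trans ?_
      rw [hnorm]; exact (hφP n).2.2
  · simp only [hnorm]
    exact hE0.comp hφ.tendsto_atTop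

/-- A parameter whose difference quotients converge along fast sequences of tilts is pathwise
differentiable. -/
lemma IsRegularSubmodel.hasDerivAt (hR : IsRegularSubmodel 𝓜 ν P path s)
    (hP : (P : Measure 𝓞) ≪ ν) {ψ : ProbabilityMeasure 𝓞 → ℝ} {c : ℝ}
    (H : ∀ (Q : ℕ → ProbabilityMeasure 𝓞) (p : ℕ → 𝓞 → ℝ) (C : ℝ) (t : ℕ → ℝ),
      (∀ n, BoundedTilt P (Q n) (p n) C) → ∑' n, ∫⁻ o, ‖p n o - 1‖ₑ ∂(P : Measure 𝓞) ≠ ∞ →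
      Tendsto (fun n => eLpNorm (fun o => (√(p n o) - 1) / t n - s o / 2) 2 (P : Measure 𝓞))
        atTop (𝓝 0) → Tendsto (fun n => (ψ (Q n) - ψ P) / t n) atTop (𝓝 c)) :
    HasDerivAt (fun t => ψ (path t)) c 0 := by
  rw [hasDerivAt_iff_tendsto_slope]
  -- The slope converges once every sequence tending to 0 has, along each subsequence, a further
  -- subsequence with the right limit; this leaves room to extract fast ones.
  refine tendsto_of_seq_tendsto fun t ht => tendsto_of_subseq_tendsto fun ns hns => ?_
  obtain ⟨φ, p, C, h1, h2, h3⟩ := hR.exists_subseq hP (ht.comp hns)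
  refine ⟨φ, (H _ p C _ h1 h2 h3).congr fun n => ?_⟩
  simp [slope_def_field, hR.base]

lemma IsRegularSubmodel.integral_score (hR : IsRegularSubmodel 𝓜 ν P path s)
    (hP : (P : Measure 𝓞) ≪ ν) : ∫ o, s o ∂(P : Measure 𝓞) = 0 := by
  obtain ⟨t, ht⟩ := exists_seq_tendsto (𝓝[≠] (0 : ℝ))
  obtain ⟨φ, p, C, h1, h2, h3⟩ := hR.exists_subseq hP ht
  exact integral_score_eq_zero h1 h2 hR.score_memLp h3

end Submodels

/-! ### The tangent space of the nonparametric model -/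

section Tangent

variable {𝓞 : Type*} [MeasurableSpace 𝓞] [TopologicalSpace 𝓞] [OpensMeasurableSpace 𝓞]
  {ν : Measure 𝓞} [SigmaFinite ν] {P : ProbabilityMeasure 𝓞}

/-- The law with density `1 + t h` with respect to `P` where this is safely positive, else `P`. -/
lemma exists_linear_tilt {h : 𝓞 → ℝ} (hc : Continuous h) {K : ℝ} (hK : ∀ o, |h o| ≤ K)
    (h0 : ∫ o, h o ∂(P : Measure 𝓞) = 0) (t : ℝ) :
    ∃ Q : ProbabilityMeasure 𝓞, (t = 0 → Q = P) ∧
      (|t| * K ≤ 1 / 2 → BoundedTilt P Q (fun o => 1 + t * h o) 2) := by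
  by_cases ht : |t| * K ≤ 1 / 2
  · have hb : ∀ o, |t * h o| ≤ 1 / 2 := fun o => by
      rw [abs_mul]
      exact (mul_le_mul_of_nonneg_left (hK o) (abs_nonneg t)).trans ht
    have hi : Integrable h (P : Measure 𝓞) :=
      Integrable.of_bound hc.measurable.aestronglyMeasurable K (.of_forall hK)
    have hi1 : Integrable (fun o => 1 + t * h o) (P : Measure 𝓞) :=
      (integrable_const 1).add (hi.const_mul t)
    have hprob : IsProbabilityMeasure
        ((P : Measure 𝓞).withDensity fun o => ENNReal.ofReal (1 + t * h o)) := by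
      constructor
      rw [withDensity_apply _ .univ, Measure.restrict_univ, ← ofReal_integral_eq_lintegral_ofReal
        hi1 (.of_forall fun o => by simpa using by linarith [neg_le_of_abs_le (hb o)]),
        integral_add (integrable_const 1) (hi.const_mul t), integral_const_mul, h0]
      simp
    refine ⟨⟨_, hprob⟩, fun h00 => Subtype.ext ?_, fun _ =>
      ⟨one_le_two, (hc.measurable.const_mul t).const_add 1, fun o => ?_, fun o => ?_, rfl⟩⟩
    · simp [h00]
    · have := neg_le_of_abs_le (hb o)
      norm_num; linarith
    · have := le_of_abs_le (hb o)
      linarith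
  · exact ⟨P, fun _ => rfl, fun h => absurd h ht⟩

/-- The error equals `-(√(1+x) - 1)² / 2`, and `|√(1+x) - 1| ≤ |x|` because `x = (√(1+x) - 1)(√(1+x)
+ 1)`. -/
lemma sqrt_one_add_sub_le {x : ℝ} (hx : |x| ≤ 1 / 2) : |√(1 + x) - 1 - x / 2| ≤ x ^ 2 := by
  have h1 : 0 ≤ 1 + x := by linarith [neg_le_of_abs_le hx]
  have h2 := Real.mul_self_sqrt h1
  have h3 := Real.sqrt_nonneg (1 + x)
  have h4 : √(1 + x) - 1 - x / 2 = -((√(1 + x) - 1) ^ 2 / 2) := by linear_combination h2 / 2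
  have h5 : (√(1 + x) - 1) ^ 2 ≤ x ^ 2 := by
    have h6 : x = (√(1 + x) - 1) * (√(1 + x) + 1) := by linear_combination -h2
    calc (√(1 + x) - 1) ^ 2 ≤ (√(1 + x) - 1) ^ 2 * (√(1 + x) + 1) ^ 2 :=
          le_mul_of_one_le_right (sq_nonneg _) (by nlinarith)
      _ = x ^ 2 := by rw [← mul_pow, ← h6]
  rw [h4, abs_neg, abs_of_nonneg (by positivity)]
  linarith [sq_nonneg (√(1 + x) - 1)]

/-- Bounded continuous functions of mean zero are scores. -/
lemma exists_regularSubmodel (hP : P ∈ nonparametricModel ν) {h s : 𝓞 → ℝ} (hc : Continuous h)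
    {K : ℝ} (hK : ∀ o, |h o| ≤ K) (h0 : ∫ o, h o ∂(P : Measure 𝓞) = 0)
    (hs : s =ᵐ[(P : Measure 𝓞)] h) :
    ∃ Q : ℝ → ProbabilityMeasure 𝓞, IsRegularSubmodel (nonparametricModel ν) ν P Q s := by
  choose Q hQ0 hQ using exists_linear_tilt (P := P) hc hK h0
  have hPν := nonparametricModel.absolutelyContinuous hP
  have hev : ∀ᶠ t in 𝓝 (0 : ℝ), |t| * K ≤ 1 / 2 := by
    have : Tendsto (fun t : ℝ => |t| * K) (𝓝 0) (𝓝 0) := by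
      have h := (tendsto_id (α := ℝ) (x := 𝓝 0)).abs.mul_const K
      simpa using h
    exact this.eventually (ge_mem_nhds (by norm_num))
  have hsm : MemLp s 2 (P : Measure 𝓞) := (memLp_congr_ae hs).2
    (MemLp.of_bound hc.measurable.aestronglyMeasurable K (.of_forall hK))
  refine ⟨Q, hQ0 0 rfl, ?_, ⟨2, ?_⟩, hsm, ?_⟩
  · filter_upwards [hev] with t ht
    obtain ⟨d, hd, hd0, hPd⟩ := hP
    have hT := hQ t ht
    -- Continuity of `h` is what keeps the path inside the model: the product of continuous
    -- densities is continuous.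
    refine ⟨fun o => d o * (1 + t * h o), by fun_prop, fun o => mul_nonneg (hd0 o) (hT.pos o).le, ?_⟩
    rw [hT.eq, hPd, ← withDensity_mul₀ hd.measurable.ennreal_ofReal.aemeasurable
      hT.measurable.ennreal_ofReal.aemeasurable]
    congr 1
    ext o
    simp [ENNReal.ofReal_mul (hd0 o)]
  · filter_upwards [hev] with t ht
    have hT := hQ t ht
    constructor
    · calc (Q t : Measure 𝓞) = _ := hT.eq
        _ ≤ (P : Measure 𝓞).withDensity (fun _ => 2) := withDensity_mono (.of_forall fun o => by
            simpa using ENNReal.ofReal_le_ofReal (hT.upper o))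
        _ = (2 : ℝ≥0) • (P : Measure 𝓞) := by rw [withDensity_const]; rfl
    · calc (P : Measure 𝓞) = (P : Measure 𝓞).withDensity 1 := withDensity_one.symm
        _ ≤ (P : Measure 𝓞).withDensity
            ((2 : ℝ≥0∞) • fun o => ENNReal.ofReal (1 + t * h o)) :=
          withDensity_mono (.of_forall fun o => by
            have h1 := hT.lower o
            have h2 : (1 : ℝ) ≤ 2 * (1 + t * h o) := by
              norm_num at h1; linarith
            have h3 := ENNReal.ofReal_le_ofReal h2
            rw [ENNReal.ofReal_mul zero_le_two] at h3
            simpa using h3)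
        _ = (2 : ℝ≥0) • (Q t : Measure 𝓞) := by
            rw [withDensity_smul _ hT.measurable.ennreal_ofReal, ← hT.eq]; rfl
  -- The second-order bound on the root gives a remainder of at most `|t| K²`, uniformly in the
  -- observation, once `|t| K ≤ 1/2`.
  · have hlim : Tendsto (fun t : ℝ => ENNReal.ofReal ((|t| * K ^ 2) ^ 2)) (𝓝[≠] 0) (𝓝 0) := by
      have h1 : Tendsto (fun t : ℝ => (|t| * K ^ 2) ^ 2) (𝓝 0) (𝓝 0) := by
        have h := ((tendsto_id (α := ℝ) (x := 𝓝 0)).abs.mul_const (K ^ 2)).pow 2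
        simpa using h
      simpa using (ENNReal.tendsto_ofReal h1).mono_left nhdsWithin_le_nhds
    refine tendsto_of_tendsto_of_tendsto_of_le_of_le' tendsto_const_nhds hlim
      (.of_forall fun _ => bot_le) ?_
    filter_upwards [hev.filter_mono nhdsWithin_le_nhds, self_mem_nhdsWithin] with t ht ht0
    rw [(hQ t ht).lintegral_sqrt_dens hPν hsm.aestronglyMeasurable]
    calc _ ≤ ∫⁻ _, ENNReal.ofReal ((|t| * K ^ 2) ^ 2) ∂(P : Measure 𝓞) := by
          refine lintegral_mono_ae ?_
          filter_upwards [hs] with o ho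
          refine ENNReal.ofReal_le_ofReal (sq_le_sq' ?_ ?_ |>.trans_eq rfl)
          all_goals
            have hb : |t * h o| ≤ 1 / 2 := by
              rw [abs_mul]
              exact (mul_le_mul_of_nonneg_left (hK o) (abs_nonneg t)).trans ht
            have hb' : |(√(1 + t * h o) - 1) / t - s o / 2| ≤ |t| * K ^ 2 := by
              have h1 : (√(1 + t * h o) - 1) / t - s o / 2
                  = (√(1 + t * h o) - 1 - t * h o / 2) / t := by
                rw [ho]; field_simp [show t ≠ 0 from ht0]
              rw [h1, abs_div, div_le_iff₀ (abs_pos.2 ht0)]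
              refine (sqrt_one_add_sub_le hb).trans ?_
              have h2 : h o ^ 2 ≤ K ^ 2 := sq_le_sq' (neg_le_of_abs_le (hK o)) (le_of_abs_le (hK o))
              calc (t * h o) ^ 2 = t ^ 2 * h o ^ 2 := by ring
                _ ≤ t ^ 2 * K ^ 2 := mul_le_mul_of_nonneg_left h2 (sq_nonneg t)
                _ = |t| * K ^ 2 * |t| := by rw [← sq_abs]; ring
          · exact neg_le_of_abs_le hb'
          · exact le_of_abs_le hb'
      _ = _ := by simp

/-- The tangent space of the nonparametric model contains every square integrable function of
mean zero. -/
theorem toLp_mem_tangentSpace [NormalSpace 𝓞] [BorelSpace 𝓞] [(P : Measure 𝓞).WeaklyRegular]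
    (hP : P ∈ nonparametricModel ν) {φ : 𝓞 → ℝ} (hφ : MemLp φ 2 (P : Measure 𝓞))
    (h0 : ∫ o, φ o ∂(P : Measure 𝓞) = 0) :
    hφ.toLp φ ∈ tangentSpace (nonparametricModel ν) ν P := by
  rw [tangentSpace, ← SetLike.mem_coe, Submodule.topologicalClosure_coe, EMetric.mem_closure_iff]
  intro ε hε
  obtain ⟨δ, hδ0, hδ⟩ : ∃ δ : ℝ≥0∞, δ ≠ 0 ∧ δ + δ < ε := by
    obtain ⟨r, h1, h2⟩ := exists_between hε
    exact ⟨r / 2, (ENNReal.half_pos h1.ne').ne', by rwa [ENNReal.add_halves]⟩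
  obtain ⟨f, hf1, hf2⟩ := hφ.exists_boundedContinuous_eLpNorm_sub_le (by norm_num) hδ0
  -- The approximant is centred to become a score. As `φ` has mean zero, `|c| ≤ ‖φ - f‖₂`, so
  -- centring costs at most a second `δ`.
  set c : ℝ := ∫ o, f o ∂(P : Measure 𝓞) with hc
  have hfi : Integrable f (P : Measure 𝓞) := hf2.integrable one_le_two
  have hφi : Integrable φ (P : Measure 𝓞) := hφ.integrable one_le_two
  set k : 𝓞 → ℝ := fun o => f o - c with hk
  have hk2 : MemLp k 2 (P : Measure 𝓞) := hf2.sub (memLp_const c)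
  have hkb : ∀ o, |k o| ≤ ‖f‖ + |c| := fun o =>
    (abs_sub _ _).trans (add_le_add (f.norm_coe_le_norm o) le_rfl)
  have hk0 : ∫ o, k o ∂(P : Measure 𝓞) = 0 := by
    rw [integral_sub hfi (integrable_const c)]; simp [hc]
  refine ⟨hk2.toLp k, Submodule.subset_span ?_, ?_⟩
  · exact exists_regularSubmodel hP (f.continuous.sub continuous_const) hkb hk0 hk2.coeFn_toLp
  · rw [Lp.edist_toLp_toLp]
    have hcb : ‖c‖ₑ ≤ eLpNorm (φ - ⇑f) 2 (P : Measure 𝓞) := by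
      have h1 : c = -∫ o, (φ - ⇑f) o ∂(P : Measure 𝓞) := by
        simp only [Pi.sub_apply]
        rw [integral_sub hφi hfi, h0, hc]; ring
      rw [h1, enorm_neg]
      refine (enorm_integral_le_lintegral_enorm _).trans ?_
      rw [← eLpNorm_one_eq_lintegral_enorm]
      exact eLpNorm_le_eLpNorm_of_exponent_le one_le_two (hφ.sub hf2).aestronglyMeasurable
    have h2 : φ - k = (φ - ⇑f) + fun _ => c := by
      ext o; simp [hk]; ring
    rw [h2]
    refine (eLpNorm_add_le (hφ.sub hf2).aestronglyMeasurable aestronglyMeasurable_const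
      one_le_two).trans_lt ?_
    rw [eLpNorm_const c (by norm_num) (IsProbabilityMeasure.ne_zero _)]
    refine (add_le_add hf1 ?_).trans_lt hδ
    simpa using hcb.trans hf1

end Tangent

/-! ### From limits along tilts to the efficient influence function -/

/-- A mean zero square integrable function that gives the limits of the difference quotients along
fast sequences of tilts is the efficient influence function in the nonparametric model. -/
lemma isEfficientInfluenceFunction_of_tendsto {𝓞 : Type*} [MeasurableSpace 𝓞] [TopologicalSpace 𝓞]
    [BorelSpace 𝓞] [NormalSpace 𝓞] {ν : Measure 𝓞} [SigmaFinite ν] {P : ProbabilityMeasure 𝓞}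
    [(P : Measure 𝓞).WeaklyRegular] (hP : P ∈ nonparametricModel ν)
    {ψ : ProbabilityMeasure 𝓞 → ℝ} {φ : 𝓞 → ℝ} (hφ : MemLp φ 2 (P : Measure 𝓞))
    (hmean : ∫ o, φ o ∂(P : Measure 𝓞) = ψ P)
    (H : ∀ (Q : ℕ → ProbabilityMeasure 𝓞) (p : ℕ → 𝓞 → ℝ) (C : ℝ) (t : ℕ → ℝ) (s : 𝓞 → ℝ),
      MemLp s 2 (P : Measure 𝓞) → (∀ n, BoundedTilt P (Q n) (p n) C) →
      ∑' n, ∫⁻ o, ‖p n o - 1‖ₑ ∂(P : Measure 𝓞) ≠ ∞ →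
      Tendsto (fun n => eLpNorm (fun o => (√(p n o) - 1) / t n - s o / 2) 2 (P : Measure 𝓞))
        atTop (𝓝 0) →
      Tendsto (fun n => (ψ (Q n) - ψ P) / t n) atTop (𝓝 (∫ o, φ o * s o ∂(P : Measure 𝓞)))) :
    IsEfficientInfluenceFunction (nonparametricModel ν) ν ψ P (fun o => φ o - ψ P) := by
  have hm : MemLp (fun o => φ o - ψ P) 2 (P : Measure 𝓞) := hφ.sub (memLp_const _)
  have h0 : ∫ o, (φ o - ψ P) ∂(P : Measure 𝓞) = 0 := by
    rw [integral_sub (hφ.integrable one_le_two) (integrable_const _), hmean]; simp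
  refine ⟨hm, h0, toLp_mem_tangentSpace hP hm h0, fun Q s hR => ?_⟩
  have hPν := nonparametricModel.absolutelyContinuous hP
  have hs := hR.score_memLp
  have h1 : ∫ o, (φ o - ψ P) * s o ∂(P : Measure 𝓞) = ∫ o, φ o * s o ∂(P : Measure 𝓞) := by
    simp only [sub_mul]
    have hi : Integrable (fun o => φ o * s o) (P : Measure 𝓞) := hφ.integrable_mul hs
    rw [integral_sub hi ((hs.integrable one_le_two).const_mul _),
      integral_const_mul, hR.integral_score hPν]
    simp
  rw [h1]
  exact hR.hasDerivAt hPν fun Q p C t hQ hsum hlim => H Q p C t s hs hQ hsum hlim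

namespace Mediation

variable {𝒲 ℳ : Type*} [MeasurableSpace 𝒲] [MeasurableSpace ℳ] [StandardBorelSpace ℳ] [Nonempty ℳ]
  {P : ProbabilityMeasure (Obs 𝒲 ℳ)} {a a' : Fin 2}

lemma SquareIntegrable.D_memLp (h : SquareIntegrable P a a') (k : ZPair) :
    MemLp (D P a a' k) 2 (P : Measure (Obs 𝒲 ℳ)) :=
  (((h.outcome k).add (h.confounder k)).add (h.mediator k)).add (h.plugin k)

/-- The uncentered influence function has mean `θ_{z,z'}`. -/
lemma integral_D [StandardBorelSpace 𝒲] [Nonempty 𝒲]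
    (hY : Integrable Obs.Y (P : Measure (Obs 𝒲 ℳ))) (hpos : Positivity P a a')
    (hsq : SquareIntegrable P a a') (k : ZPair) :
    ∫ o, D P a a' k o ∂(P : Measure (Obs 𝒲 ℳ)) = theta a a' k P := by
  have h : BoundedTilt P P (fun _ => 1) 1 :=
    ⟨le_rfl, measurable_const, fun _ => by simp, fun _ => le_rfl, by simp⟩
  rw [← integral_tiltedD h hY hpos hsq k]
  refine integral_congr_ae ?_
  -- Along the constant sequence with density 1, `tiltedD` is constant in `n` and converges to `D`,
  -- so the two agree almost everywhere.
  filter_upwards [ae_tendsto_tiltedD (Q := fun _ => P) (fun _ => h) (by simp) hpos k] with o ho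
  exact tendsto_nhds_unique ho tendsto_const_nhds

end Mediation

end

theorem mainTheorem3 {𝒲 ℳ : Type*}
    [TopologicalSpace 𝒲] [PolishSpace 𝒲] [MeasurableSpace 𝒲] [BorelSpace 𝒲]
    [TopologicalSpace ℳ] [PolishSpace ℳ] [MeasurableSpace ℳ] [BorelSpace ℳ] [Nonempty ℳ]
    (ν : Measure (Obs 𝒲 ℳ)) [SigmaFinite ν]
    (P : ProbabilityMeasure (Obs 𝒲 ℳ)) (hP : P ∈ nonparametricModel ν)
    (a a' : Fin 2)
    (hY : Integrable Obs.Y (P : Measure (Obs 𝒲 ℳ)))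
    (hpos : Mediation.Positivity P a a')
    (hsq : Mediation.SquareIntegrable P a a') :
    (∀ k : ZPair, IsEfficientInfluenceFunction (nonparametricModel ν) ν
      (Mediation.theta a a' k) P
      (fun o => Mediation.D P a a' k o - Mediation.theta a a' k P)) ∧
    IsEfficientInfluenceFunction (nonparametricModel ν) ν
      (Mediation.thetaTotal a a') P
      (fun o => Mediation.DTotal P a a' o - Mediation.thetaTotal a a' P) := by
  have hne : Nonempty (Obs 𝒲 ℳ) := P.nonempty
  have : Nonempty 𝒲 := hne.map Obs.W
  have hD := hsq.D_memLp
  have hiD : ∀ k, Integrable (Mediation.D P a a' k) (P : Measure (Obs 𝒲 ℳ)) :=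
    fun k => (hD k).integrable one_le_two
  have hmean := Mediation.integral_D hY hpos hsq
  refine ⟨fun k => isEfficientInfluenceFunction_of_tendsto hP (hD k) (hmean k)
    fun Q p C t s hs hQ hsum hlim =>
      Mediation.tendsto_theta_sub_div hQ hsum hpos hY hsq k hs hlim, ?_⟩
  refine isEfficientInfluenceFunction_of_tendsto hP
    (((hD .oneOne).add (hD .oneZero)).add (hD .zeroZero)) ?_ fun Q p C t s hs hQ hsum hlim => ?_
  · exact (Mediation.integral_add₃ (hiD _) (hiD _) (hiD _)).trans (by simp only [hmean]; rfl)
  · have h := fun k => Mediation.tendsto_theta_sub_div hQ hsum hpos hY hsq k hs hlim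
    have hi : ∀ k, Integrable (fun o => Mediation.D P a a' k o * s o) (P : Measure (Obs 𝒲 ℳ)) :=
      fun k => (hD k).integrable_mul hs
    convert ((h .oneOne).add (h .oneZero)).add (h .zeroZero) using 1
    · ext n; simp only [Mediation.thetaTotal]; ring
    · rw [← Mediation.integral_add₃ (hi _) (hi _) (hi _)]
      congr 1
      exact integral_congr_ae (.of_forall fun o => by simp only [Mediation.DTotal]; ring)
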